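/- An algebra $\mathbf A$ is a set $A$ with a family of basic operations of finite arity; it is idempotent if $f(a,\dots,a)=a$ for every basic operation $f$ and every $a\in A$. For congruences $\alpha,\beta$ of $\mathbf A$ let $M(\alpha,\beta)$ be the subalgebra of $\mathbf A^4$ (written as $2\times2$ matrices) generated by all $\begin{pmatrix}a&a\\a'&a'\end{pmatrix}$ with $a\mathrel{\alpha}a'$ and all $\begin{pmatrix}b&b'\\b&b'\end{pmatrix}$ with $b\mathrel{\beta}b'$. The commutator $[\alpha,\beta]$ is the least congruence $\gamma$ such that for every $\begin{pmatrix}x&y\\u&v\end{pmatrix}\in M(\alpha,\beta)$, $x\mathrel{\gamma}y$ implies $u\mathrel{\gamma}v$. A difference term operation of $\mathbf A$ is a ternary term operation $d$ such that, for all $a,b\in A$, $d(a,a,b)=b$, and $d(a,b,b)\mathrel{[\theta,\theta]}a$ for every congruence $\theta$ containing $(a,b)$. Write $\theta_{ab}$ for the congruence generated by $(a,b)$. Corollary. (1) A finite idempotent algebra $\mathbf A$ has a difference term operation if and only if for all $a,b,a',b'\in A$ the subuniverse of $\mathbf A^2$ generated by $(a,a'),(b,a'),(b,b')$ has nonempty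 intersection with $a/[\theta_{ab},\theta_{ab}]\times\{b'\}$, where $a/\delta$ denotes the $\delta$-class of $a$. (2) There is a polynomial-time algorithm that takes as input any nonempty finite idempotent algebra $\mathbf A$ with finitely many basic operations, given by their tables, and decides whether $\mathbf A$ has a difference term operation. More precisely, there are a program for a random access machine (unit cost per instruction, with addition and truncated subtraction as the only arithmetic operations) and constants $C,e$, such that on every such input the program stops with the correct answer after at most \[ C\,(r\,m^2n^4+n^7) \] steps, and also after at most $C\,(n+m)^e$ steps, where $n=|A|$, $r$ is the largest arity of the basic operations ($0$ if there are none), and $m=\sum_{i=0}^{r}k_i n^i$ with $k_i$ the number of basic operations of arity $i$. -/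

import Mathlib

universe u v

/-- An algebra with universe `A` whose basic operations, each of finite arity, are indexed by `ι`. -/
structure UniversalAlgebra (ι : Type v) (A : Type u) where
  arity : ι → ℕ
  op : (i : ι) → (Fin (arity i) → A) → A

namespace UniversalAlgebra

variable {ι : Type v} {A : Type u}

/-- Every basic operation satisfies `f(a, ..., a) = a`. -/
def IsIdempotent (𝔸 : UniversalAlgebra ι A) : Prop :=
  ∀ (i : ι) (a : A), 𝔸.op i (fun _ => a) = a

/-- The square `𝔸 × 𝔸`, with coordinatewise operations. -/
def sq (𝔸 : UniversalAlgebra ι A) : UniversalAlgebra ι (A × A) where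
  arity := 𝔸.arity
  op i x := (𝔸.op i (fun j => (x j).1), 𝔸.op i (fun j => (x j).2))

/-- A subuniverse: a subset closed under the basic operations. -/
def IsSubuniverse (𝔸 : UniversalAlgebra ι A) (S : Set A) : Prop :=
  ∀ (i : ι) (x : Fin (𝔸.arity i) → A), (∀ j, x j ∈ S) → 𝔸.op i x ∈ S

/-- The subuniverse generated by `X`. -/
def Sg (𝔸 : UniversalAlgebra ι A) (X : Set A) : Set A :=
  ⋂₀ {S | X ⊆ S ∧ 𝔸.IsSubuniverse S}

/-- A congruence: an equivalence relation compatible with the basic operations. -/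
def IsCongruence (𝔸 : UniversalAlgebra ι A) (θ : Setoid A) : Prop :=
  ∀ (i : ι) (x y : Fin (𝔸.arity i) → A), (∀ j, θ (x j) (y j)) → θ (𝔸.op i x) (𝔸.op i y)

/-- The principal congruence `θ_ab`: the least congruence relating `a` and `b`. -/
def Cg (𝔸 : UniversalAlgebra ι A) (a b : A) : Setoid A :=
  sInf {θ | 𝔸.IsCongruence θ ∧ θ a b}

/-- `M(α, β)`, with the `2 × 2` matrix with rows `(x, y)` and `(u, v)` written `((x, y), (u, v))`:
the subuniverse of `𝔸⁴` generated by the matrices with rows `(a, a)`, `(a', a')` for `a α a'`, and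
the matrices with rows `(b, b')`, `(b, b')` for `b β b'`. -/
def matrices (𝔸 : UniversalAlgebra ι A) (α β : Setoid A) : Set ((A × A) × (A × A)) :=
  𝔸.sq.sq.Sg
    ({p | ∃ a a' : A, α a a' ∧ p = ((a, a), (a', a'))} ∪
      {p | ∃ b b' : A, β b b' ∧ p = ((b, b'), (b, b'))})

/-- `γ` satisfies the term condition for `α`, `β`: for every matrix in `M(α, β)`, if the entries
of the first row are `γ`-related, then so are the entries of the second row. -/
def Centralizes (𝔸 : UniversalAlgebra ι A) (α β γ : Setoid A) : Prop :=
  ∀ x y u v : A, ((x, y), (u, v)) ∈ 𝔸.matrices α β → γ x y → γ u v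

/-- The commutator `[α, β]`: the least congruence satisfying the term condition. -/
def commutator (𝔸 : UniversalAlgebra ι A) (α β : Setoid A) : Setoid A :=
  sInf {γ | 𝔸.IsCongruence γ ∧ 𝔸.Centralizes α β γ}

theorem Cg_isLeast (𝔸 : UniversalAlgebra ι A) (a b : A) :
    IsLeast {θ | 𝔸.IsCongruence θ ∧ θ a b} (𝔸.Cg a b) := by
  refine ⟨⟨fun i x y h => ?_, ?_⟩, fun θ hθ => sInf_le hθ⟩
  · intro θ hθ
    exact hθ.1 i x y (fun j => h j θ hθ)
  · intro θ hθ
    exact hθ.2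

theorem commutator_isLeast (𝔸 : UniversalAlgebra ι A) (α β : Setoid A) :
    IsLeast {γ | 𝔸.IsCongruence γ ∧ 𝔸.Centralizes α β γ} (𝔸.commutator α β) := by
  refine ⟨⟨fun i x y h => ?_, fun x y w z hM h => ?_⟩, fun γ hγ => sInf_le hγ⟩
  · intro γ hγ
    exact hγ.1 i x y (fun j => h j γ hγ)
  · intro γ hγ
    exact hγ.2 x y w z hM (h γ hγ)

/-- The `k`-ary term operations of `𝔸`: the least set of `k`-ary operations on `A` that contains
the projections and is closed under composition with the basic operations. -/
inductive IsTermOp (𝔸 : UniversalAlgebra ι A) (k : ℕ) : ((Fin k → A) → A) → Prop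
  | proj (j : Fin k) : IsTermOp 𝔸 k (fun x => x j)
  | comp (i : ι) (t : Fin (𝔸.arity i) → (Fin k → A) → A) (ht : ∀ j, IsTermOp 𝔸 k (t j)) :
      IsTermOp 𝔸 k (fun x => 𝔸.op i (fun j => t j x))

/-- `𝔸` has a difference term operation: a ternary term operation `d` such that, for all `a`, `b`,
`d(a, a, b) = b`, and `d(a, b, b) [θ, θ] a` for every congruence `θ` that contains `(a, b)`. -/
def HasDifferenceTermOperation (𝔸 : UniversalAlgebra ι A) : Prop :=
  ∃ d : (Fin 3 → A) → A, 𝔸.IsTermOp 3 d ∧ ∀ a b : A,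
    d ![a, a, b] = b ∧
    ∀ θ : Setoid A, 𝔸.IsCongruence θ → θ a b → 𝔸.commutator θ θ (d ![a, b, b]) a

/-- For all `a`, `b`, `a'`, `b'`, the subuniverse of `𝔸 × 𝔸` generated by `(a, a')`, `(b, a')`,
`(b, b')` meets `a/[θ_ab, θ_ab] × {b'}`. -/
def PassesLocalTest (𝔸 : UniversalAlgebra ι A) : Prop :=
  ∀ a b a' b' : A,
    (𝔸.sq.Sg {(a, a'), (b, a'), (b, b')} ∩
      {c | 𝔸.commutator (𝔸.Cg a b) (𝔸.Cg a b) a c} ×ˢ {b'}).Nonempty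

section Finite

variable {n k : ℕ}

/-- The largest arity of the basic operations (`0` if there are none). -/
def maxArity (𝔸 : UniversalAlgebra (Fin k) (Fin n)) : ℕ :=
  Finset.univ.sup 𝔸.arity

/-- The input size `‖𝔸‖ = ∑ i, k_i * n ^ i`, where `k_i` is the number of basic operations of
arity `i`: each basic operation of arity `i` contributes the size `n ^ i` of its table. -/
def inputSize (𝔸 : UniversalAlgebra (Fin k) (Fin n)) : ℕ :=
  ∑ f : Fin k, n ^ 𝔸.arity f

/-- The table of a basic operation `f` of arity `r`, a list of length `n ^ r`: the value
`f(x_0, ..., x_(r-1))` stands at position `∑ j, x_j * n ^ j`. -/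
def table (𝔸 : UniversalAlgebra (Fin k) (Fin n)) (f : Fin k) : List ℕ :=
  List.ofFn fun p : Fin (n ^ 𝔸.arity f) => (𝔸.op f (finFunctionFinEquiv.symm p) : ℕ)

/-- The algebra as input of a machine: the number of elements, the number of basic operations,
the list of their arities, and then their tables, one after the other. -/
def encode (𝔸 : UniversalAlgebra (Fin k) (Fin n)) : List ℕ :=
  n :: k :: (List.ofFn 𝔸.arity ++ (List.ofFn 𝔸.table).flatten)

end Finite

end UniversalAlgebra

/-!
Random access machines with unit cost. The memory is an array of natural numbers, initially `0`,
and the input is a read-only array. Addition and truncated subtraction are the only arithmetic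
operations (there is no unit-cost multiplication), so that polynomial time on these machines is
polynomial time in the usual sense.
-/
namespace RAM

/-- The instructions; numbers `d`, `s`, `t` are addresses of memory cells. -/
inductive Instr
  /-- `mem[d] := c` -/
  | const (d c : ℕ)
  /-- `mem[d] := mem[s]` -/
  | move (d s : ℕ)
  /-- `mem[d] := mem[s] + mem[t]` -/
  | add (d s t : ℕ)
  /-- `mem[d] := mem[s] - mem[t]`, or `0` if this is negative -/
  | sub (d s t : ℕ)
  /-- `mem[d] := mem[mem[s]]` -/
  | load (d s : ℕ)
  /-- `mem[mem[d]] := mem[s]` -/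
  | store (d s : ℕ)
  /-- `mem[d] := input[mem[s]]`, or `0` beyond the end of the input -/
  | read (d s : ℕ)
  /-- continue at line `l` -/
  | jump (l : ℕ)
  /-- if `mem[s] = 0`, continue at line `l` -/
  | jumpZero (s l : ℕ)
  /-- stop -/
  | halt

/-- A program is a finite list of instructions, in lines `0, 1, 2, ...`. -/
abbrev Program := List Instr

/-- A configuration: the current line and the contents of the memory. -/
structure Config where
  pc : ℕ
  mem : ℕ → ℕ

/-- The initial configuration. -/
def init : Config := ⟨0, fun _ => 0⟩

/-- Write `x` into the cell with address `d` and go to the next line. -/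
def Config.write (c : Config) (d x : ℕ) : Config :=
  ⟨c.pc + 1, Function.update c.mem d x⟩

/-- One step of the computation on input `w`: the execution of one instruction. -/
def step (P : Program) (w : List ℕ) (c : Config) : Config :=
  match P[c.pc]? with
  | none => c
  | some .halt => c
  | some (.const d x) => c.write d x
  | some (.move d s) => c.write d (c.mem s)
  | some (.add d s t) => c.write d (c.mem s + c.mem t)
  | some (.sub d s t) => c.write d (c.mem s - c.mem t)
  | some (.load d s) => c.write d (c.mem (c.mem s))
  | some (.store d s) => c.write (c.mem d) (c.mem s)
  | some (.read d s) => c.write d (w.getD (c.mem s) 0)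
  | some (.jump l) => ⟨l, c.mem⟩
  | some (.jumpZero s l) => if c.mem s = 0 then ⟨l, c.mem⟩ else ⟨c.pc + 1, c.mem⟩

/-- The computation has stopped: at a `halt` instruction or outside the program. -/
def Halted (P : Program) (c : Config) : Prop :=
  P[c.pc]? = none ∨ P[c.pc]? = some .halt

/-- On input `w`, the program stops after at most `T` steps, with `out` in the memory cell `0`. -/
def OutputsWithin (P : Program) (w : List ℕ) (T out : ℕ) : Prop :=
  Halted P ((step P w)^[T] init) ∧ ((step P w)^[T] init).mem 0 = out

end RAM

/-! Part (1). A difference term, applied to the three generators, gives the required element of the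
generated subuniverse. Conversely, the elements of a three-generated subuniverse of the square are
values of ternary terms (`mem_Sg_sq_iff`), so the local test yields, for each choice of `a, b, a',
b'`, a term that behaves well at `(a, b)` modulo the commutator and at `(a', b')` exactly. Finitely
many such terms are merged by composition: `PassesLocalTest.exists_term_finset` collects all pairs
`(a', b')` for a fixed `(a, b)`, and then `PassesLocalTest.hasDifferenceTermOperation` collects all
`(a, b)`. Idempotence keeps each composition from spoiling what was already achieved, and
monotonicity of the commutator reduces arbitrary `θ` to principal congruences.

Part (2). Principal congruences, commutators and generated subuniverses are all least closed sets.
The local test is therefore a question about the least model of a system of Horn clauses with two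
premises, with atoms coded as numbers (`passesLocalTest_iff`). Forward chaining finds this model in
time linear in the number of clauses (`Horn.Inv.mark_iff`, `chain_spec`), so what remains is to keep
the clauses few. Closure under an operation is expressed through tuples assembled one entry at a
time, which costs about `r m^2` clauses per relation.

The delicate point is `M(θ, θ)`: closing sets of matrices under the operations directly would
involve four coordinates at once. Only special matrices are derived instead. They start from the
rows `(a, a)`, `(b, b)` and their reverse, and arise by applying an operation to one derived matrix
and otherwise to matrices with two equal rows from `θ`. Every matrix of `M(θ, θ)` has its rows
joined by a chain of these (`chain_of_matrices`), and the term condition passes along chains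
(`derivable_of_commutator`). This costs about `r m^2 n^2` clauses for each pair `(a, b)`, hence `r
m^2 n^4` in all. Idempotence excludes nullary operations when `n ≥ 2`, so that terms of order `m^2`
are absorbed by `r m^2`; the case `n = 1` is trivial.

For the machine, a language of arrays and bounded loops is compiled with a constant overhead per
unit of cost (`Cmd.run_code`). Products are avoided by loop accumulators and by tables of multiples.
The clauses are emitted by nested loops, and `decideCmd_spec` collects correctness and cost. -/

/-! ### A small language with arrays and bounded loops, compiled to random access machines -/

namespace LoopLang

/-- Expressions; `var i` is the variable bound `i` binders further out. -/
inductive Expr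
  | lit (c : ℕ)
  | var (i : ℕ)
  | add (a b : Expr)
  | sub (a b : Expr)
  | arr (k : Fin 31) (e : Expr)
  | inp (e : Expr)

/-- The contents of the arrays. -/
abbrev Store := Fin 31 → ℕ → ℕ

/-- Extension of an environment by a new innermost variable. -/
def cons (x : ℕ) (ρ : ℕ → ℕ) : ℕ → ℕ
  | 0 => x
  | i + 1 => ρ i

@[simp] theorem cons_zero (x : ℕ) (ρ : ℕ → ℕ) : cons x ρ 0 = x := rfl
@[simp] theorem cons_succ (x : ℕ) (ρ : ℕ → ℕ) (i : ℕ) : cons x ρ (i + 1) = ρ i := rfl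

/-- The value of an expression on input `w`. -/
def Expr.eval (w : List ℕ) (ρ : ℕ → ℕ) (σ : Store) : Expr → ℕ
  | lit c => c
  | var i => ρ i
  | add a b => a.eval w ρ σ + b.eval w ρ σ
  | sub a b => a.eval w ρ σ - b.eval w ρ σ
  | arr k e => σ k (e.eval w ρ σ)
  | inp e => w.getD (e.eval w ρ σ) 0

/-- `σ` with the entry `i` of the array `k` replaced by `x`. -/
def put (σ : Store) (k : Fin 31) (i x : ℕ) : Store :=
  Function.update σ k (Function.update (σ k) i x)

/-- Commands. `loop s m b c` runs `c` with a counter `i = 0, ..., m - 1` (innermost variable) and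
an accumulator `i * s + b` (next variable), followed by `m` and `s`. -/
inductive Cmd
  | skip
  | store (k : Fin 31) (i e : Expr)
  | seq (c₁ c₂ : Cmd)
  | ite (e : Expr) (c₁ c₂ : Cmd)
  | loop (s m b : Expr) (c : Cmd)

/-- `f (m - 1) (... (f 0 σ))`. -/
def iter (f : ℕ → Store → Store) : ℕ → Store → Store
  | 0, σ => σ
  | m + 1, σ => f m (iter f m σ)

/-- The environment of the body of a loop in round `i`. -/
def loopEnv (s m b i : ℕ) (ρ : ℕ → ℕ) : ℕ → ℕ :=
  cons i (cons (i * s + b) (cons m (cons s ρ)))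

/-- The effect of a command. -/
def Cmd.eval (w : List ℕ) : Cmd → (ℕ → ℕ) → Store → Store
  | skip, _, σ => σ
  | store k i e, ρ, σ => put σ k (i.eval w ρ σ) (e.eval w ρ σ)
  | seq c₁ c₂, ρ, σ => c₂.eval w ρ (c₁.eval w ρ σ)
  | ite e c₁ c₂, ρ, σ => if e.eval w ρ σ = 0 then c₂.eval w ρ σ else c₁.eval w ρ σ
  | loop s m b c, ρ, σ =>
      iter (fun i => c.eval w (loopEnv (s.eval w ρ σ) (m.eval w ρ σ) (b.eval w ρ σ) i ρ))
        (m.eval w ρ σ) σ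

/-- The running time of a command, up to a constant factor. -/
def Cmd.ticks (w : List ℕ) : Cmd → (ℕ → ℕ) → Store → ℕ
  | skip, _, _ => 0
  | store _ _ _, _, _ => 1
  | seq c₁ c₂, ρ, σ => c₁.ticks w ρ σ + c₂.ticks w ρ (c₁.eval w ρ σ)
  | ite e c₁ c₂, ρ, σ => 1 + if e.eval w ρ σ = 0 then c₂.ticks w ρ σ else c₁.ticks w ρ σ
  | loop s m b c, ρ, σ =>
      1 + ∑ i ∈ Finset.range (m.eval w ρ σ),
        (1 + c.ticks w (loopEnv (s.eval w ρ σ) (m.eval w ρ σ) (b.eval w ρ σ) i ρ)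
          (iter (fun i => c.eval w (loopEnv (s.eval w ρ σ) (m.eval w ρ σ) (b.eval w ρ σ) i ρ)) i σ))

/-! ### Compilation -/

open RAM (Instr Program Config step)

/-- Code that writes the value of an expression into cell `32 * t`, where `d` is the number of
variables in scope; the variable `i` is kept in cell `32 * (d - 1 - i)`. -/
def Expr.code (d : ℕ) : Expr → ℕ → List Instr
  | lit c, t => [.const (32 * t) c]
  | var i, t => [if i < d then .move (32 * t) (32 * (d - 1 - i)) else .const (32 * t) 0]
  | add a b, t => a.code d t ++ (b.code d (t + 1) ++ [.add (32 * t) (32 * t) (32 * (t + 1))])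
  | sub a b, t => a.code d t ++ (b.code d (t + 1) ++ [.sub (32 * t) (32 * t) (32 * (t + 1))])
  | arr k e, t => e.code d t ++
      [.add (32 * t) (32 * t) (32 * t), .add (32 * t) (32 * t) (32 * t),
       .add (32 * t) (32 * t) (32 * t), .add (32 * t) (32 * t) (32 * t),
       .add (32 * t) (32 * t) (32 * t), .const (32 * (t + 1)) (k + 1),
       .add (32 * t) (32 * t) (32 * (t + 1)), .load (32 * t) (32 * t)]
  | inp e, t => e.code d t ++ [.read (32 * t) (32 * t)]

/-- The length of the code of a command. -/
def Cmd.len (d : ℕ) : Cmd → ℕ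
  | skip => 0
  | store _ i e => (i.code d d).length + (e.code d (d + 1)).length + 8
  | seq c₁ c₂ => c₁.len d + c₂.len d
  | ite e c₁ c₂ => (e.code d d).length + c₁.len d + c₂.len d + 2
  | loop s m b c => (s.code d d).length + (m.code d (d + 1)).length + (b.code d (d + 2)).length +
      c.len (d + 4) + 7

/-- The code of a command that starts in line `l`, with `d` variables in scope. -/
def Cmd.code : Cmd → ℕ → ℕ → List Instr
  | skip, _, _ => []
  | store k i e, d, _ => i.code d d ++ (e.code d (d + 1) ++
      [.add (32 * d) (32 * d) (32 * d), .add (32 * d) (32 * d) (32 * d),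
       .add (32 * d) (32 * d) (32 * d), .add (32 * d) (32 * d) (32 * d),
       .add (32 * d) (32 * d) (32 * d), .const (32 * (d + 2)) (k + 1),
       .add (32 * d) (32 * d) (32 * (d + 2)), .store (32 * d) (32 * (d + 1))])
  | seq c₁ c₂, d, l => c₁.code d l ++ c₂.code d (l + c₁.len d)
  | ite e c₁ c₂, d, l =>
      let l₁ := l + (e.code d d).length + 1
      e.code d d ++ (.jumpZero (32 * d) (l₁ + c₁.len d + 1) :: (c₁.code d l₁ ++
        (.jump (l₁ + c₁.len d + 1 + c₂.len d) :: c₂.code d (l₁ + c₁.len d + 1))))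
  | loop s m b c, d, l =>
      let l₁ := l + (s.code d d).length + (m.code d (d + 1)).length +
        (b.code d (d + 2)).length + 1
      s.code d d ++ (m.code d (d + 1) ++ (b.code d (d + 2) ++ (.const (32 * (d + 3)) 0 ::
        .sub (32 * (d + 4)) (32 * (d + 1)) (32 * (d + 3)) ::
        .jumpZero (32 * (d + 4)) (l₁ + 2 + c.len (d + 4) + 4) ::
        (c.code (d + 4) (l₁ + 2) ++
          [.add (32 * (d + 2)) (32 * (d + 2)) (32 * d), .const (32 * (d + 4)) 1,
           .add (32 * (d + 3)) (32 * (d + 3)) (32 * (d + 4)), .jump l₁]))))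

/-- A forward jump needs the length of code that is still to come. `Cmd.len` supplies it without
reference to the starting line, and the targets are right because the two lengths agree. -/
theorem Cmd.length_code (c : Cmd) : ∀ d l, (c.code d l).length = c.len d := by
  induction c with
  | skip => intros; rfl
  | store k i e => intros; simp [code, len]; omega
  | seq c₁ c₂ h₁ h₂ => intros; simp [code, len, h₁, h₂]
  | ite e c₁ c₂ h₁ h₂ => intros; simp [code, len, h₁, h₂]; omega
  | loop s m b c h => intros; simp [code, len, h]; omega

/-- A bound for the number of machine steps per tick. -/
def Cmd.weight (d : ℕ) : Cmd → ℕ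
  | skip => 0
  | store k i e => (store k i e).len d
  | seq c₁ c₂ => c₁.weight d + c₂.weight d
  | ite e c₁ c₂ => (e.code d d).length + 2 + c₁.weight d + c₂.weight d
  | loop s m b c => (s.code d d).length + (m.code d (d + 1)).length +
      (b.code d (d + 2)).length + 7 + c.weight (d + 4)

/-! ### Placement of code and representation of states in memory. -/

/-- The code `code` stands in `P` from line `l` on. -/
def At (P : Program) (l : ℕ) (code : List Instr) : Prop :=
  ∀ i < code.length, P[l + i]? = code[i]?

theorem At.left {P : Program} {l : ℕ} {a b : List Instr} (h : At P l (a ++ b)) : At P l a := by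
  intro i hi
  rw [h i (by simp; omega), List.getElem?_append_left hi]

theorem At.right {P : Program} {l : ℕ} {a b : List Instr} (h : At P l (a ++ b)) :
    At P (l + a.length) b := by
  intro i hi
  rw [add_assoc, h (a.length + i) (by simp; omega),
    List.getElem?_append_right (by omega), Nat.add_sub_cancel_left]

theorem At.head {P : Program} {l : ℕ} {x : Instr} {b : List Instr} (h : At P l (x :: b)) :
    P[l]? = some x := h 0 (by simp)

theorem At.tail {P : Program} {l : ℕ} {x : Instr} {b : List Instr} (h : At P l (x :: b)) :
    At P (l + 1) b := At.right (a := [x]) h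

/-- `mem'` agrees with `mem` except possibly on the cells `32 * t'` with `t' ≥ t`. -/
def Agree (t : ℕ) (mem mem' : ℕ → ℕ) : Prop :=
  ∀ a, (∀ t', t ≤ t' → a ≠ 32 * t') → mem' a = mem a

theorem Agree.trans {t : ℕ} {m₁ m₂ m₃ : ℕ → ℕ} (h : Agree t m₁ m₂) (h' : Agree t m₂ m₃) :
    Agree t m₁ m₃ := fun a ha => (h' a ha).trans (h a ha)

theorem Agree.mono {t t' : ℕ} {m₁ m₂ : ℕ → ℕ} (htt : t' ≤ t) (h : Agree t m₁ m₂) :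
    Agree t' m₁ m₂ := fun a ha => h a fun s hs => ha s (htt.trans hs)

theorem Agree.low {t s : ℕ} {m₁ m₂ : ℕ → ℕ} (h : Agree t m₁ m₂) (hs : s < t) :
    m₂ (32 * s) = m₁ (32 * s) := h _ fun t' ht' => by omega

theorem agree_update (t s : ℕ) (hs : t ≤ s) (mem : ℕ → ℕ) (x : ℕ) :
    Agree t mem (Function.update mem (32 * s) x) := fun a ha => by
  rw [Function.update_of_ne (ha s hs)]

/-- The memory `mem` represents the environment `ρ` with `d` variables and the store `σ`. -/
structure Rel (d : ℕ) (ρ : ℕ → ℕ) (σ : Store) (mem : ℕ → ℕ) : Prop where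
  arr : ∀ (k : Fin 31) i, mem (32 * i + (k + 1)) = σ k i
  var : ∀ i < d, mem (32 * (d - 1 - i)) = ρ i
  out : ∀ i, d ≤ i → ρ i = 0

/-- Variables in scope occupy cells `32 * s` with `s < d`, and array entries occupy cells whose
address is not divisible by `32`. Scratch work in the cells `32 * t'` with `t' ≥ d` disturbs
neither. -/
theorem Rel.agree {d t : ℕ} {ρ : ℕ → ℕ} {σ : Store} {mem mem' : ℕ → ℕ} (h : Rel d ρ σ mem)
    (hm : Agree t mem mem') (ht : d ≤ t) : Rel d ρ σ mem' where
  arr k i := by rw [hm _ (fun t' _ => by omega), h.arr]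
  var i hi := by rw [hm.low (by omega), h.var i hi]
  out := h.out

theorem Rel.cons {d x : ℕ} {ρ : ℕ → ℕ} {σ : Store} {mem : ℕ → ℕ} (h : Rel d ρ σ mem)
    (hx : mem (32 * d) = x) : Rel (d + 1) (cons x ρ) σ mem where
  arr := h.arr
  var i hi := by
    cases i with
    | zero => simpa using hx
    | succ i => rw [cons_succ, ← h.var i (by omega)]; congr 2; omega
  out i hi := by
    obtain ⟨i, rfl⟩ : ∃ j, i = j + 1 := ⟨i - 1, by omega⟩
    exact h.out i (by omega)

theorem Rel.tail {d x : ℕ} {ρ : ℕ → ℕ} {σ : Store} {mem : ℕ → ℕ}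
    (h : Rel (d + 1) (LoopLang.cons x ρ) σ mem) : Rel d ρ σ mem where
  arr := h.arr
  var i hi := by rw [← cons_succ x ρ, ← h.var (i + 1) (by omega)]; congr 2; omega
  out i hi := h.out (i + 1) (by omega)

theorem Rel.head {d x : ℕ} {ρ : ℕ → ℕ} {σ : Store} {mem : ℕ → ℕ}
    (h : Rel (d + 1) (LoopLang.cons x ρ) σ mem) : mem (32 * d) = x := by
  simpa using h.var 0 (by omega)

/-! ### Correctness and running time of compiled code. -/

section Run

variable {P : Program} {w : List ℕ}

theorem run_append {s t : ℕ} {c₁ c₂ c₃ : Config} (h : (step P w)^[s] c₁ = c₂)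
    (h' : (step P w)^[t] c₂ = c₃) : (step P w)^[s + t] c₁ = c₃ := by
  rw [add_comm, Function.iterate_add_apply, h, h']

/-- Code of expressions contains no jumps, so it runs for exactly as many steps as it has lines. A
left operand waits in cell `32 * t` while the right operand uses only scratch cells from `32 * (t +
1)` on. -/
theorem Expr.run_code {d : ℕ} {ρ : ℕ → ℕ} {σ : Store} (e : Expr) :
    ∀ (t l : ℕ) (mem : ℕ → ℕ), d ≤ t → At P l (e.code d t) → Rel d ρ σ mem →
      ∃ mem', (step P w)^[(e.code d t).length] ⟨l, mem⟩ = ⟨l + (e.code d t).length, mem'⟩ ∧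
        Agree t mem mem' ∧ mem' (32 * t) = e.eval w ρ σ := by
  induction e with
  | lit c =>
    intro t l mem hd hP hR
    have := hP.head
    exact ⟨Function.update mem (32 * t) c, by simp [code, step, this, Config.write],
      agree_update t t le_rfl _ _, by simp [eval]⟩
  | var i =>
    intro t l mem hd hP hR
    have := hP.head
    by_cases hi : i < d
    · refine ⟨Function.update mem (32 * t) (ρ i), ?_, agree_update t t le_rfl _ _, by simp [eval]⟩
      simp [code, step, this, Config.write, hi, hR.var i hi]
    · refine ⟨Function.update mem (32 * t) 0, ?_, agree_update t t le_rfl _ _, ?_⟩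
      · simp [code, step, this, Config.write, hi]
      · simp [eval, hR.out i (by omega)]
  | add a b ha hb =>
    intro t l mem hd hP hR
    obtain ⟨m₁, h₁, g₁, e₁⟩ := ha t l mem hd hP.left hR
    obtain ⟨m₂, h₂, g₂, e₂⟩ := hb (t + 1) _ m₁ (by omega) hP.right.left (hR.agree g₁ hd)
    have := hP.right.right.head
    refine ⟨Function.update m₂ (32 * t) (a.eval w ρ σ + b.eval w ρ σ), ?_, ?_, by simp [eval]⟩
    · have h₃ : (step P w)^[1] ⟨l + (a.code d t).length + (b.code d (t + 1)).length, m₂⟩ =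
          ⟨l + (a.code d t).length + (b.code d (t + 1)).length + 1,
            Function.update m₂ (32 * t) (a.eval w ρ σ + b.eval w ρ σ)⟩ := by
        simp [step, this, Config.write, e₂, g₂.low (Nat.lt_succ_self t), e₁]
      have := run_append h₁ (run_append h₂ h₃)
      simpa [code, add_assoc] using this
    · exact (g₁.trans (g₂.mono (Nat.le_succ t))).trans (agree_update t t le_rfl _ _)
  | sub a b ha hb =>
    intro t l mem hd hP hR
    obtain ⟨m₁, h₁, g₁, e₁⟩ := ha t l mem hd hP.left hR
    obtain ⟨m₂, h₂, g₂, e₂⟩ := hb (t + 1) _ m₁ (by omega) hP.right.left (hR.agree g₁ hd)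
    have := hP.right.right.head
    refine ⟨Function.update m₂ (32 * t) (a.eval w ρ σ - b.eval w ρ σ), ?_, ?_, by simp [eval]⟩
    · have h₃ : (step P w)^[1] ⟨l + (a.code d t).length + (b.code d (t + 1)).length, m₂⟩ =
          ⟨l + (a.code d t).length + (b.code d (t + 1)).length + 1,
            Function.update m₂ (32 * t) (a.eval w ρ σ - b.eval w ρ σ)⟩ := by
        simp [step, this, Config.write, e₂, g₂.low (Nat.lt_succ_self t), e₁]
      have := run_append h₁ (run_append h₂ h₃)
      simpa [code, add_assoc] using this
    · exact (g₁.trans (g₂.mono (Nat.le_succ t))).trans (agree_update t t le_rfl _ _)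
  | inp e he =>
    intro t l mem hd hP hR
    obtain ⟨m₁, h₁, g₁, e₁⟩ := he t l mem hd hP.left hR
    have := hP.right.head
    refine ⟨Function.update m₁ (32 * t) (w.getD (e.eval w ρ σ) 0), ?_,
      g₁.trans (agree_update t t le_rfl _ _), by simp [eval]⟩
    have h₃ : (step P w)^[1] ⟨l + (e.code d t).length, m₁⟩ = ⟨l + (e.code d t).length + 1,
        Function.update m₁ (32 * t) (w.getD (e.eval w ρ σ) 0)⟩ := by
      simp [step, this, Config.write, e₁]
    have := run_append h₁ h₃
    simpa [code, add_assoc] using this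
  | arr k e he =>
    intro t l mem hd hP hR
    obtain ⟨m₁, h₁, g₁, e₁⟩ := he t l mem hd hP.left hR
    have i₀ := hP.right.head
    have i₁ := hP.right.tail.head
    have i₂ := hP.right.tail.tail.head
    have i₃ := hP.right.tail.tail.tail.head
    have i₄ := hP.right.tail.tail.tail.tail.head
    have i₅ := hP.right.tail.tail.tail.tail.tail.head
    have i₆ := hP.right.tail.tail.tail.tail.tail.tail.head
    have i₇ := hP.right.tail.tail.tail.tail.tail.tail.tail.head
    have hne : 32 * (t + 1) ≠ 32 * t := by omega
    have hne' : 32 * t ≠ 32 * (t + 1) := by omega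
    set x := e.eval w ρ σ with hx
    have hk : (k : ℕ) < 31 := k.2
    let m₂ := Function.update m₁ (32 * t) (32 * x)
    let m₃ := Function.update m₂ (32 * (t + 1)) (k + 1)
    let m₄ := Function.update m₃ (32 * t) (32 * x + (k + 1))
    let m₅ := Function.update m₄ (32 * t) (σ k x)
    -- Five doublings stand in for the multiplication by `32`.
    have ad : 32 * x = x + x + (x + x) + (x + x + (x + x)) + (x + x + (x + x) + (x + x + (x + x)))
        + (x + x + (x + x) + (x + x + (x + x)) + (x + x + (x + x) + (x + x + (x + x)))) := by ring
    have h₂ : (step P w)^[5] ⟨l + (e.code d t).length, m₁⟩ =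
        ⟨l + (e.code d t).length + 1 + 1 + 1 + 1 + 1, m₂⟩ := by
      simp [step, i₀, i₁, i₂, i₃, i₄, Config.write, e₁, m₂, ad]
    have h₃ : (step P w)^[3] ⟨l + (e.code d t).length + 1 + 1 + 1 + 1 + 1, m₂⟩ =
        ⟨l + (e.code d t).length + 1 + 1 + 1 + 1 + 1 + 1 + 1 + 1, m₅⟩ := by
      have hR' : m₄ (32 * x + (k + 1)) = σ k x := by
        rw [← hR.arr k x]
        -- Since `0 < k + 1 < 32`, array cells never coincide with scratch cells.
        have : ∀ s, 32 * x + (k + 1) ≠ 32 * s := fun s => by omega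
        simp only [m₄, m₃, m₂]
        rw [Function.update_of_ne (this _), Function.update_of_ne (this _),
          Function.update_of_ne (this _), g₁ _ fun s _ => this s]
      have e₂ : m₂ (32 * t) = 32 * x := by simp [m₂]
      simp only [Function.iterate_succ, Function.iterate_zero, Function.comp, id]
      have s₁ : step P w ⟨l + (e.code d t).length + 1 + 1 + 1 + 1 + 1, m₂⟩ =
          ⟨l + (e.code d t).length + 1 + 1 + 1 + 1 + 1 + 1, m₃⟩ := by
        simp [step, i₅, Config.write, m₃]
      have s₂ : step P w ⟨l + (e.code d t).length + 1 + 1 + 1 + 1 + 1 + 1, m₃⟩ =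
          ⟨l + (e.code d t).length + 1 + 1 + 1 + 1 + 1 + 1 + 1, m₄⟩ := by
        simp [step, i₆, Config.write, m₄, m₃, e₂]
      have s₃ : step P w ⟨l + (e.code d t).length + 1 + 1 + 1 + 1 + 1 + 1 + 1, m₄⟩ =
          ⟨l + (e.code d t).length + 1 + 1 + 1 + 1 + 1 + 1 + 1 + 1, m₅⟩ := by
        have : m₄ (32 * t) = 32 * x + (k + 1) := by simp [m₄]
        simp only [step, i₇, Config.write, this, hR', m₅]
      rw [s₁, s₂, s₃]
    refine ⟨m₅, ?_, ?_, by simp [m₅, eval, hx]⟩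
    · have := run_append h₁ (run_append h₂ h₃)
      simpa [code, add_assoc] using this
    · exact (((g₁.trans (agree_update t t le_rfl _ _)).trans
        (agree_update t (t + 1) (by omega) _ _)).trans (agree_update t t le_rfl _ _)).trans
        (agree_update t t le_rfl _ _)

end Run
end LoopLang

namespace LoopLang
open RAM (Instr Program Config step)
section Run

variable {P : Program} {w : List ℕ}

theorem run_one {l l' : ℕ} {mem mem' : ℕ → ℕ} (h : step P w ⟨l, mem⟩ = ⟨l', mem'⟩) :
    (step P w)^[1] ⟨l, mem⟩ = ⟨l', mem'⟩ := h

theorem Rel.put {d : ℕ} {ρ : ℕ → ℕ} {σ : Store} {mem : ℕ → ℕ} (h : Rel d ρ σ mem) (k : Fin 31)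
    (i x : ℕ) : Rel d ρ (put σ k i x) (Function.update mem (32 * i + (k + 1)) x) where
  arr k' i' := by
    by_cases hk : k' = k
    · subst hk
      by_cases hi : i' = i
      · subst hi; simp [LoopLang.put]
      · rw [Function.update_of_ne (by omega), h.arr]
        simp [LoopLang.put, Function.update_of_ne hi]
    · have : (k' : ℕ) ≠ k := fun h => hk (Fin.ext h)
      rw [Function.update_of_ne (by omega), h.arr]
      simp [LoopLang.put, Function.update_of_ne hk]
  var i' hi' := by rw [Function.update_of_ne (by omega), h.var i' hi']
  out := h.out

theorem Cmd.run_store {d : ℕ} {ρ : ℕ → ℕ} {σ : Store} (k : Fin 31) (i e : Expr) (l : ℕ)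
    (mem : ℕ → ℕ) (hP : At P l ((store k i e).code d l)) (hR : Rel d ρ σ mem) :
    ∃ mem', (step P w)^[(store k i e).len d] ⟨l, mem⟩ = ⟨l + (store k i e).len d, mem'⟩ ∧
      Rel d ρ (put σ k (i.eval w ρ σ) (e.eval w ρ σ)) mem' := by
  obtain ⟨m₀, h₀, g₀, e₀⟩ := i.run_code (w := w) d l mem le_rfl hP.left hR
  obtain ⟨m₁, h₁, g₁, e₁⟩ := e.run_code (w := w) (d + 1) _ m₀ (by omega) hP.right.left
    (hR.agree g₀ le_rfl)
  have hP' := hP.right.right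
  have i₀ := hP'.head
  have i₁ := hP'.tail.head
  have i₂ := hP'.tail.tail.head
  have i₃ := hP'.tail.tail.tail.head
  have i₄ := hP'.tail.tail.tail.tail.head
  have i₅ := hP'.tail.tail.tail.tail.tail.head
  have i₆ := hP'.tail.tail.tail.tail.tail.tail.head
  have i₇ := hP'.tail.tail.tail.tail.tail.tail.tail.head
  set L := l + (i.code d d).length + (e.code d (d + 1)).length with hL
  set x := i.eval w ρ σ with hx
  set y := e.eval w ρ σ with hy
  have hk : (k : ℕ) < 31 := k.2
  have e₁' : m₁ (32 * d) = x := by rw [g₁.low (Nat.lt_succ_self d), e₀]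
  let m₂ := Function.update m₁ (32 * d) (32 * x)
  let m₃ := Function.update m₂ (32 * (d + 2)) (k + 1)
  let m₄ := Function.update m₃ (32 * d) (32 * x + (k + 1))
  let m₅ := Function.update m₄ (32 * x + (k + 1)) y
  have ad : 32 * x = x + x + (x + x) + (x + x + (x + x)) + (x + x + (x + x) + (x + x + (x + x)))
      + (x + x + (x + x) + (x + x + (x + x)) + (x + x + (x + x) + (x + x + (x + x)))) := by ring
  have h₂ : (step P w)^[5] ⟨L, m₁⟩ = ⟨L + 1 + 1 + 1 + 1 + 1, m₂⟩ := by
    simp [step, i₀, i₁, i₂, i₃, i₄, Config.write, e₁', m₂, ad]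
  have s₁ : step P w ⟨L + 1 + 1 + 1 + 1 + 1, m₂⟩ = ⟨L + 1 + 1 + 1 + 1 + 1 + 1, m₃⟩ := by
    simp [step, i₅, Config.write, m₃]
  have s₂ : step P w ⟨L + 1 + 1 + 1 + 1 + 1 + 1, m₃⟩ =
      ⟨L + 1 + 1 + 1 + 1 + 1 + 1 + 1, m₄⟩ := by
    simp [step, i₆, Config.write, m₄, m₃, m₂]
  have s₃ : step P w ⟨L + 1 + 1 + 1 + 1 + 1 + 1 + 1, m₄⟩ =
      ⟨L + 1 + 1 + 1 + 1 + 1 + 1 + 1 + 1, m₅⟩ := by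
    have a₁ : m₄ (32 * d) = 32 * x + (k + 1) := by simp [m₄]
    have a₂ : m₄ (32 * (d + 1)) = y := by
      simp only [m₄, m₃, m₂]
      rw [Function.update_of_ne (by omega), Function.update_of_ne (by omega),
        Function.update_of_ne (by omega), e₁]
    simp only [step, i₇, Config.write, a₁, a₂, m₅]
  have h₃ : (step P w)^[3] ⟨L + 1 + 1 + 1 + 1 + 1, m₂⟩ =
      ⟨L + 1 + 1 + 1 + 1 + 1 + 1 + 1 + 1, m₅⟩ := by
    simp only [Function.iterate_succ, Function.iterate_zero, Function.comp, id]
    rw [s₁, s₂, s₃]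
  refine ⟨m₅, ?_, Rel.put ?_ k x y⟩
  · have := run_append h₀ (run_append h₁ (run_append h₂ h₃))
    simpa [len, hL, add_assoc] using this
  · exact hR.agree ((((g₀.trans (g₁.mono (by omega))).trans (agree_update d d le_rfl _ _)).trans
      (agree_update d (d + 2) (by omega) _ _)).trans (agree_update d d le_rfl _ _)) le_rfl

/-- Induction on the command. Each store, branch, loop and loop round is charged at least one tick,
and `weight` bounds the instructions executed on account of one tick, including tests and jumps. -/
theorem Cmd.run_code (c : Cmd) : ∀ (d l : ℕ) (ρ : ℕ → ℕ) (σ : Store) (mem : ℕ → ℕ),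
    At P l (c.code d l) → Rel d ρ σ mem →
      ∃ t ≤ c.weight d * c.ticks w ρ σ, ∃ mem',
        (step P w)^[t] ⟨l, mem⟩ = ⟨l + c.len d, mem'⟩ ∧ Rel d ρ (c.eval w ρ σ) mem' := by
  induction c with
  | skip => exact fun d l ρ σ mem _ hR => ⟨0, Nat.zero_le _, mem, rfl, hR⟩
  | store k i e =>
    intro d l ρ σ mem hP hR
    obtain ⟨mem', h, hR'⟩ := run_store (w := w) k i e l mem hP hR
    exact ⟨_, by simp [weight, ticks], mem', h, hR'⟩
  | seq c₁ c₂ h₁ h₂ =>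
    intro d l ρ σ mem hP hR
    obtain ⟨t₁, b₁, m₁, r₁, R₁⟩ := h₁ d l ρ σ mem hP.left hR
    have hP₂ := hP.right
    rw [length_code] at hP₂
    obtain ⟨t₂, b₂, m₂, r₂, R₂⟩ := h₂ d _ ρ _ m₁ hP₂ R₁
    refine ⟨t₁ + t₂, ?_, m₂, ?_, R₂⟩
    · refine (Nat.add_le_add b₁ b₂).trans ?_
      simp only [weight, ticks]
      rw [Nat.mul_add]
      exact Nat.add_le_add (Nat.mul_le_mul (by omega) le_rfl) (Nat.mul_le_mul (by omega) le_rfl)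
    · rw [run_append r₁ r₂, len, add_assoc]
  | ite e c₁ c₂ h₁ h₂ =>
    intro d l ρ σ mem hP hR
    obtain ⟨m₀, r₀, g₀, e₀⟩ := e.run_code (w := w) d l mem le_rfl hP.left hR
    have R₀ := hR.agree g₀ le_rfl
    have hP' := hP.right
    have i₀ := hP'.head
    by_cases he : e.eval w ρ σ = 0
    · have hP₂ := hP'.tail.right.tail
      rw [length_code] at hP₂
      obtain ⟨t, b, m, r, R⟩ := h₂ d _ ρ σ m₀ hP₂ R₀
      have s : step P w ⟨l + (e.code d d).length, m₀⟩ =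
          ⟨l + (e.code d d).length + 1 + c₁.len d + 1, m₀⟩ := by simp [step, i₀, e₀, he]
      have total := run_append r₀ (run_append (run_one s) r)
      refine ⟨_, ?_, m, total.trans ?_, ?_⟩
      rotate_left
      · rw [len]
        congr 1
        omega
      · simpa [eval, he] using R
      · simp only [weight, ticks, he, if_true]
        rw [Nat.mul_add, Nat.mul_one]
        have : c₂.weight d * c₂.ticks w ρ σ ≤ ((e.code d d).length + 2 + c₁.weight d +
          c₂.weight d) * c₂.ticks w ρ σ := Nat.mul_le_mul (by omega) le_rfl
        omega
    · have hP₂ := hP'.tail.left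
      have i₁ := hP'.tail.right.head
      rw [length_code] at i₁
      obtain ⟨t, b, m, r, R⟩ := h₁ d _ ρ σ m₀ hP₂ R₀
      have s : step P w ⟨l + (e.code d d).length, m₀⟩ =
          ⟨l + (e.code d d).length + 1, m₀⟩ := by simp [step, i₀, e₀, he]
      have s' : step P w ⟨l + (e.code d d).length + 1 + c₁.len d, m⟩ =
          ⟨l + (e.code d d).length + 1 + c₁.len d + 1 + c₂.len d, m⟩ := by simp [step, i₁]
      have total := run_append r₀ (run_append (run_one s) (run_append r (run_one s')))
      refine ⟨_, ?_, m, total.trans ?_, ?_⟩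
      rotate_left
      · rw [len]
        congr 1
        omega
      · simpa [eval, he] using R
      · simp only [weight, ticks, he, if_false]
        rw [Nat.mul_add, Nat.mul_one]
        have : c₁.weight d * c₁.ticks w ρ σ ≤ ((e.code d d).length + 2 + c₁.weight d +
          c₂.weight d) * c₁.ticks w ρ σ := Nat.mul_le_mul (by omega) le_rfl
        omega
  | loop s m b c h =>
    intro d l ρ σ mem hP hR
    obtain ⟨m₁, r₁, g₁, e₁⟩ := s.run_code (w := w) d l mem le_rfl hP.left hR
    obtain ⟨m₂, r₂, g₂, e₂⟩ := m.run_code (w := w) (d + 1) _ m₁ (by omega) hP.right.left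
      (hR.agree g₁ le_rfl)
    obtain ⟨m₃, r₃, g₃, e₃⟩ := b.run_code (w := w) (d + 2) _ m₂ (by omega) hP.right.right.left
      (hR.agree (g₁.trans (g₂.mono (by omega))) le_rfl)
    have hP' := hP.right.right.right
    have i₀ := hP'.head
    have i₁ := hP'.tail.head
    have i₂ := hP'.tail.tail.head
    have hb := hP'.tail.tail.tail.left
    have ht := hP'.tail.tail.tail.right
    rw [length_code] at ht
    have j₀ := ht.head
    have j₁ := ht.tail.head
    have j₂ := ht.tail.tail.head
    have j₃ := ht.tail.tail.tail.head
    set L := l + (s.code d d).length + (m.code d (d + 1)).length + (b.code d (d + 2)).length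
      with hL
    set S := s.eval w ρ σ with hS
    set M := m.eval w ρ σ with hM
    set B := b.eval w ρ σ with hB
    set f : ℕ → Store → Store := fun i => c.eval w (loopEnv S M B i ρ) with hf
    let m₄ := Function.update m₃ (32 * (d + 3)) 0
    have s₀ : step P w ⟨L, m₃⟩ = ⟨L + 1, m₄⟩ := by simp [step, i₀, Config.write, m₄]
    have R₀ : Rel (d + 4) (loopEnv S M B 0 ρ) σ m₄ := by
      have a₃ : Agree (d + 3) m₃ m₄ := agree_update _ _ le_rfl _ _
      have := (((hR.agree ((g₁.trans (g₂.mono (by omega))).trans (g₃.mono (by omega)) |>.trans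
        (a₃.mono (by omega))) le_rfl).cons (x := S) ?_).cons (x := M) ?_).cons (x := B) ?_ |>.cons
        (x := 0) ?_
      · simpa [loopEnv] using this
      · rw [a₃.low (by omega), g₃.low (by omega), g₂.low (by omega), e₁]
      · rw [a₃.low (by omega), g₃.low (by omega), e₂]
      · rw [a₃.low (by omega), e₃]
      · simp [m₄]
    set W := (loop s m b c).weight d with hW
    have hWc : W = (s.code d d).length + (m.code d (d + 1)).length +
      (b.code d (d + 2)).length + 7 + c.weight (d + 4) := rfl
    -- Induction on the rounds. The invariant refers to line `L + 1`, where the loop test stands,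
    -- and describes the memory as the environment of the coming round.
    have key : ∀ i ≤ M, ∃ t ≤ W * ∑ j ∈ Finset.range i, (1 + c.ticks w (loopEnv S M B j ρ)
        (iter f j σ)), ∃ mem', (step P w)^[t] ⟨L + 1, m₄⟩ = ⟨L + 1, mem'⟩ ∧
          Rel (d + 4) (loopEnv S M B i ρ) (iter f i σ) mem' := by
      intro i
      induction i with
      | zero => exact fun _ => ⟨0, by simp, m₄, rfl, R₀⟩
      | succ i ih =>
        intro hi
        obtain ⟨t, bt, mi, ri, Ri⟩ := ih (by omega)
        have v₀ : mi (32 * (d + 3)) = i := Ri.head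
        have v₂ : mi (32 * (d + 1)) = M := Ri.tail.tail.head
        let n₁ := Function.update mi (32 * (d + 4)) (M - i)
        have z₁ : step P w ⟨L + 1, mi⟩ = ⟨L + 1 + 1, n₁⟩ := by
          simp [step, i₁, Config.write, n₁, v₀, v₂]
        have z₂ : step P w ⟨L + 1 + 1, n₁⟩ = ⟨L + 1 + 2, n₁⟩ := by
          have : M - i ≠ 0 := by omega
          simp [step, i₂, n₁, this]
        obtain ⟨t', bt', n₂, r', R'⟩ := h (d + 4) (L + 1 + 2) _ _ n₁ hb
          (Ri.agree (agree_update _ _ le_rfl _ _) le_rfl)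
        have u₀ : n₂ (32 * (d + 3)) = i := R'.head
        have u₁ : n₂ (32 * (d + 2)) = i * S + B := R'.tail.head
        have u₂ : n₂ (32 * (d + 1)) = M := R'.tail.tail.head
        have u₃ : n₂ (32 * d) = S := R'.tail.tail.tail.head
        let n₃ := Function.update n₂ (32 * (d + 2)) (i * S + B + S)
        let n₄ := Function.update n₃ (32 * (d + 4)) 1
        let n₅ := Function.update n₄ (32 * (d + 3)) (i + 1)
        have y₀ : step P w ⟨L + 1 + 2 + c.len (d + 4), n₂⟩ =
            ⟨L + 1 + 2 + c.len (d + 4) + 1, n₃⟩ := by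
          have := j₀
          simp only [step, Config.write, n₃]
          rw [show L + 1 + 2 = L + 1 + 1 + 1 from rfl, this]
          simp [u₁, u₃]
        have y₁ : step P w ⟨L + 1 + 2 + c.len (d + 4) + 1, n₃⟩ =
            ⟨L + 1 + 2 + c.len (d + 4) + 1 + 1, n₄⟩ := by
          have := j₁
          simp only [step, Config.write, n₄]
          rw [show L + 1 + 2 = L + 1 + 1 + 1 from rfl, this]
        have y₂ : step P w ⟨L + 1 + 2 + c.len (d + 4) + 1 + 1, n₄⟩ =
            ⟨L + 1 + 2 + c.len (d + 4) + 1 + 1 + 1, n₅⟩ := by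
          have := j₂
          simp only [step, Config.write, n₅]
          rw [show L + 1 + 2 = L + 1 + 1 + 1 from rfl, this]
          have q₁ : n₄ (32 * (d + 3)) = i := by
            simp only [n₄, n₃]
            rw [Function.update_of_ne (by omega), Function.update_of_ne (by omega), u₀]
          have q₂ : n₄ (32 * (d + 4)) = 1 := by simp [n₄]
          simp [q₁, q₂]
        have y₃ : step P w ⟨L + 1 + 2 + c.len (d + 4) + 1 + 1 + 1, n₅⟩ = ⟨L + 1, n₅⟩ := by
          have := j₃
          simp only [step]
          rw [show L + 1 + 2 = L + 1 + 1 + 1 from rfl, this]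
        have R'' : Rel (d + 4) (loopEnv S M B (i + 1) ρ) (iter f (i + 1) σ) n₅ := by
          have a : Agree (d + 2) n₂ n₅ := ((agree_update _ _ le_rfl _ _).trans
            (agree_update _ _ (by omega) _ _)).trans (agree_update _ _ (by omega) _ _)
          have := ((R'.tail.tail.agree a le_rfl).cons (x := i * S + B + S) ?_).cons
            (x := i + 1) ?_
          -- One addition per round keeps the accumulator equal to `i * S + B`; this is how products
          -- are obtained without multiplying.
          · have e : (i + 1) * S + B = i * S + B + S := by ring
            simpa [loopEnv, e, iter, hf] using this
          · simp only [n₅, n₄, n₃]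
            rw [Function.update_of_ne (by omega), Function.update_of_ne (by omega)]
            simp
          · simp [n₅]
        have total := run_append ri (run_append (run_one z₁) (run_append (run_one z₂)
          (run_append r' (run_append (run_one y₀) (run_append (run_one y₁) (run_append (run_one y₂)
            (run_one y₃)))))))
        refine ⟨_, ?_, n₅, total, R''⟩
        rw [Finset.sum_range_succ, Nat.mul_add, Nat.mul_add, Nat.mul_one]
        have : c.weight (d + 4) * c.ticks w (loopEnv S M B i ρ) (iter f i σ) ≤
          W * c.ticks w (loopEnv S M B i ρ) (iter f i σ) := Nat.mul_le_mul (by omega) le_rfl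
        omega
    obtain ⟨t, bt, mi, ri, Ri⟩ := key M le_rfl
    have v₀ : mi (32 * (d + 3)) = M := Ri.head
    have v₂ : mi (32 * (d + 1)) = M := Ri.tail.tail.head
    let n₁ := Function.update mi (32 * (d + 4)) 0
    have z₁ : step P w ⟨L + 1, mi⟩ = ⟨L + 1 + 1, n₁⟩ := by
      simp [step, i₁, Config.write, n₁, v₀, v₂]
    have z₂ : step P w ⟨L + 1 + 1, n₁⟩ = ⟨L + 1 + 2 + c.len (d + 4) + 4, n₁⟩ := by
      simp [step, i₂, n₁]
    have total := run_append r₁ (run_append r₂ (run_append r₃ (run_append (run_one s₀)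
      (run_append ri (run_append (run_one z₁) (run_one z₂))))))
    refine ⟨_, ?_, n₁, total.trans ?_, Ri.tail.tail.tail.tail.agree
      ((agree_update _ _ le_rfl _ _).mono (by omega)) le_rfl⟩
    · have : (loop s m b c).ticks w ρ σ = 1 + ∑ j ∈ Finset.range M,
          (1 + c.ticks w (loopEnv S M B j ρ) (iter f j σ)) := rfl
      rw [this, Nat.mul_add, Nat.mul_one]
      omega
    · rw [len]
      congr 1
      omega

/-- The program that executes a command and outputs the entry `0` of the array `0`. -/
def Cmd.program (c : Cmd) : Program :=
  c.code 1 0 ++ [.move 0 1]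

/-- The zero memory represents the zero store. Cell `1` is entry `0` of array `0`; copying it into
cell `0` is the one extra step, and it leaves the line counter outside the program. -/
theorem Cmd.outputsWithin (c : Cmd) : ∃ t ≤ c.weight 1 * c.ticks w (fun _ => 0) (fun _ _ => 0) + 1,
    RAM.OutputsWithin c.program w t (c.eval w (fun _ => 0) (fun _ _ => 0) 0 0) := by
  have hP : At c.program 0 (c.code 1 0 ++ [.move 0 1]) := fun i _ => by rw [zero_add]; rfl
  obtain ⟨t, bt, m, r, R⟩ := c.run_code (w := w) 1 0 (fun _ => 0) (fun _ _ => 0) (fun _ => 0)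
    hP.left ⟨fun _ _ => rfl, fun _ _ => rfl, fun _ _ => rfl⟩
  have i₀ := hP.right.head
  rw [length_code] at i₀
  have s : step c.program w ⟨0 + c.len 1, m⟩ =
      ⟨0 + c.len 1 + 1, Function.update m 0 (m 1)⟩ := by
    simp only [step, i₀, Config.write]
  have := run_append r (run_one s)
  refine ⟨t + 1, by omega, ?_⟩
  rw [RAM.OutputsWithin, show RAM.init = ⟨0, fun _ => 0⟩ from rfl, this]
  refine ⟨Or.inl ?_, ?_⟩
  · simp [program, length_code]
  · have := R.arr 0 0
    simpa using this

end Run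
end LoopLang

/-! ### Horn clauses with two premises, and their least model -/

/-- The clause `p ∧ q → r`, where atoms are natural numbers. -/
abbrev HornClause := ℕ × ℕ × ℕ

/-- The atoms that follow from the clauses in `L`; the atom `0` is always true. -/
inductive Derivable (L : List HornClause) : ℕ → Prop
  | zero : Derivable L 0
  | mp {p q r : ℕ} (h : (p, q, r) ∈ L) (hp : Derivable L p) (hq : Derivable L q) : Derivable L r

/-! ### Occurrences of atoms as premises. -/

namespace Horn

/-- The premises of the clauses in `L`, numbered from `1` on. -/
def premise (L : List HornClause) (o : ℕ) : ℕ :=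
  if o % 2 = 1 then (L.getD (o / 2) 0).1 else (L.getD (o / 2 - 1) 0).2.1

/-- The last `o` with `1 ≤ o ≤ m` and `f o = p`, or `0`. -/
def last (f : ℕ → ℕ) (p : ℕ) : ℕ → ℕ
  | 0 => 0
  | m + 1 => if f (m + 1) = p then m + 1 else last f p m

theorem last_le (f : ℕ → ℕ) (p m : ℕ) : last f p m ≤ m := by
  induction m with
  | zero => exact le_rfl
  | succ m ih => rw [last]; split_ifs <;> omega

theorem apply_last {f : ℕ → ℕ} {p m : ℕ} (h : last f p m ≠ 0) : f (last f p m) = p := by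
  induction m with
  | zero => exact absurd rfl h
  | succ m ih =>
    rw [last] at h ⊢
    split_ifs at h ⊢ with hm
    · exact hm
    · exact ih h

theorem le_last {f : ℕ → ℕ} {p m o : ℕ} (h0 : 0 < o) (hm : o ≤ m) (h : f o = p) :
    o ≤ last f p m := by
  induction m with
  | zero => omega
  | succ m ih =>
    rw [last]
    split_ifs with hf
    · exact hm
    · rcases Nat.of_le_succ hm with h' | rfl
      · exact ih h'
      · exact absurd h hf

theorem last_congr {f g : ℕ → ℕ} {p m : ℕ} (h : ∀ o, 0 < o → o ≤ m → f o = g o) :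
    last f p m = last g p m := by
  induction m with
  | zero => rfl
  | succ m ih =>
    rw [last, last, h _ (by omega) le_rfl, ih fun o h0 hm => h o h0 (by omega)]

theorem premise_odd (L : List HornClause) (c : ℕ) :
    premise L (2 * c + 1) = (L.getD c 0).1 := by
  rw [premise, if_pos (by omega)]; congr 2; omega

theorem premise_even (L : List HornClause) (c : ℕ) :
    premise L (2 * c + 2) = (L.getD c 0).2.1 := by
  rw [premise, if_neg (by omega)]; congr 3; omega

theorem premise_append {L : List HornClause} (a : HornClause) {o : ℕ} (h0 : 0 < o)
    (h : o ≤ 2 * L.length) : premise (L ++ [a]) o = premise L o := by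
  obtain ⟨c, hc⟩ : ∃ c, o = 2 * c + 1 ∨ o = 2 * c + 2 := ⟨(o - 1) / 2, by omega⟩
  rcases hc with rfl | rfl
  · rw [premise_odd, premise_odd, List.getD_append _ _ _ _ (by omega)]
  · rw [premise_even, premise_even, List.getD_append _ _ _ _ (by omega)]

/-! ### Forward chaining and its invariant. -/

/-- A state of the forward chaining procedure: the queue `qu` of length `tl` holds the atoms
found, those before position `h` have been taken out, and the premises with number at most `o` that
are equal to the last one of these still have to be crossed out. -/
def Crossed (L : List HornClause) (o h : ℕ) (qu : ℕ → ℕ) (x : ℕ) : Prop :=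
  (∃ j < h, qu j = premise L x) ∧ ¬(0 < h ∧ premise L x = qu (h - 1) ∧ x ≤ o)

open Classical in
/-- The invariant of forward chaining after `i` rounds; `mk` marks the atoms found, and `fl` the
clauses of which at least one premise has been crossed out. -/
structure Inv (L : List HornClause) (i o h tl : ℕ) (qu mk fl : ℕ → ℕ) : Prop where
  h_le : h ≤ tl
  tl_pos : 0 < tl
  qu_zero : qu 0 = 0
  mark : ∀ p, mk p ≠ 0 ↔ ∃ j < tl, qu j = p
  inj : ∀ j < tl, ∀ j' < tl, qu j = qu j' → j = j'
  cur : o = 0 ∨ (0 < h ∧ o ≤ 2 * L.length ∧ premise L o = qu (h - 1))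
  sound : ∀ j < tl, Derivable L (qu j)
  img : ∀ j < tl, qu j = 0 ∨ ∃ c < L.length, qu j = (L.getD c 0).2.2
  flag : ∀ c < L.length, fl c ≠ 0 ↔ Crossed L o h qu (2 * c + 1) ∨ Crossed L o h qu (2 * c + 2)
  fire : ∀ c < L.length, Crossed L o h qu (2 * c + 1) → Crossed L o h qu (2 * c + 2) →
    mk (L.getD c 0).2.2 ≠ 0
  progress : i ≤ h + ((Finset.Icc 1 (2 * L.length)).filter (Crossed L o h qu)).card ∨
    (o = 0 ∧ h = tl)

section

variable {L : List HornClause} {i o h tl : ℕ} {qu mk fl : ℕ → ℕ}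

theorem Inv.init {mk qu fl : ℕ → ℕ} (hmk : ∀ p, mk p ≠ 0 ↔ p = 0) (hqu : qu 0 = 0)
    (hfl : ∀ c, fl c = 0) : Inv L 0 0 0 1 qu mk fl where
  h_le := by omega
  tl_pos := by omega
  qu_zero := hqu
  mark p := by
    rw [hmk]
    constructor
    · rintro rfl; exact ⟨0, by omega, hqu⟩
    · rintro ⟨j, hj, rfl⟩; rw [Nat.lt_one_iff.1 hj, hqu]
  inj := by omega
  cur := Or.inl rfl
  sound j hj := by rw [Nat.lt_one_iff.1 hj, hqu]; exact .zero
  img j hj := by rw [Nat.lt_one_iff.1 hj]; exact Or.inl hqu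
  flag c _ := by simp [hfl, Crossed]
  fire c _ := by simp [Crossed]
  progress := Or.inl (by omega)

/-- The occurrences of the current atom are visited in decreasing order, so moving from `o` to the
previous occurrence crosses out `o` and nothing else. Allowing a queue `qu'` that agrees with `qu`
below `h` covers the case where an atom is appended in the same round. -/
theorem crossed_next (hI : Inv L i o h tl qu mk fl) (ho : o ≠ 0) {qu' : ℕ → ℕ}
    (hq : ∀ j < h, qu' j = qu j) (x : ℕ) :
    Crossed L (last (premise L) (premise L o) (o - 1)) h qu' (x + 1) ↔
      Crossed L o h qu (x + 1) ∨ x + 1 = o := by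
  obtain ⟨hh, ho', hc⟩ := hI.cur.resolve_left ho
  have e₁ : (∃ j < h, qu' j = premise L (x + 1)) ↔ ∃ j < h, qu j = premise L (x + 1) :=
    exists_congr fun j => and_congr_right fun hj => by rw [hq j hj]
  have hl := last_le (premise L) (premise L o) (o - 1)
  rw [Crossed, Crossed, e₁, hq _ (by omega)]
  constructor
  · rintro ⟨h₁, h₂⟩
    by_cases hx : x + 1 = o
    · exact Or.inr hx
    · refine Or.inl ⟨h₁, fun h₃ => h₂ ⟨hh, h₃.2.1, ?_⟩⟩
      exact le_last (by omega) (by omega) (h₃.2.1.trans hc.symm)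
  · rintro (⟨h₁, h₂⟩ | rfl)
    · exact ⟨h₁, fun h₃ => h₂ ⟨hh, h₃.2.1, by omega⟩⟩
    · exact ⟨⟨h - 1, by omega, hc.symm⟩, fun h₃ => by omega⟩

theorem not_crossed (hI : Inv L i o h tl qu mk fl) (ho : o ≠ 0) : ¬ Crossed L o h qu o := by
  obtain ⟨hh, ho', hc⟩ := hI.cur.resolve_left ho
  exact fun H => H.2 ⟨hh, hc, le_rfl⟩

theorem cur_next (hI : Inv L i o h tl qu mk fl) (ho : o ≠ 0) {qu' : ℕ → ℕ}
    (hq : ∀ j < h, qu' j = qu j) (o' : ℕ) (ho' : o' = last (premise L) (premise L o) (o - 1)) :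
    o' = 0 ∨ (0 < h ∧ o' ≤ 2 * L.length ∧ premise L o' = qu' (h - 1)) := by
  obtain ⟨hh, ho₁, hc⟩ := hI.cur.resolve_left ho
  have hl := last_le (premise L) (premise L o) (o - 1)
  by_cases h0 : o' = 0
  · exact Or.inl h0
  · refine Or.inr ⟨hh, by omega, ?_⟩
    subst ho'
    rw [hq _ (by omega), ← hc, apply_last h0]

-- The number of atoms taken out plus the number of premises crossed out serves as potential:
-- crossing out `o` raises it by one, since `o` was not crossed out before.
open Classical in
theorem progress_next (hI : Inv L i o h tl qu mk fl) (ho : o ≠ 0) {qu' : ℕ → ℕ}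
    (hq : ∀ j < h, qu' j = qu j) : i + 1 ≤ h + ((Finset.Icc 1 (2 * L.length)).filter
      (Crossed L (last (premise L) (premise L o) (o - 1)) h qu')).card := by
  obtain ⟨hh, ho₁, hc⟩ := hI.cur.resolve_left ho
  have h₁ := hI.progress.resolve_right fun H => ho H.1
  have : (Finset.Icc 1 (2 * L.length)).filter
      (Crossed L (last (premise L) (premise L o) (o - 1)) h qu') =
      insert o ((Finset.Icc 1 (2 * L.length)).filter (Crossed L o h qu)) := by
    ext x
    simp only [Finset.mem_filter, Finset.mem_insert, Finset.mem_Icc]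
    cases x with
    | zero => omega
    | succ x =>
      rw [crossed_next hI ho hq]
      constructor
      · rintro ⟨a, b | b⟩
        · exact Or.inr ⟨a, b⟩
        · exact Or.inl b
      · rintro (a | ⟨a, b⟩)
        · exact ⟨by omega, Or.inr a⟩
        · exact ⟨a, Or.inl b⟩
  rw [this, Finset.card_insert_of_notMem (by simp [not_crossed hI ho])]
  omega

/-- A flag that is still down says that no premise of this clause was crossed out before. After the
present one the other is still missing, so the clause cannot fire yet. -/
theorem Inv.first (hI : Inv L i o h tl qu mk fl) (ho : o ≠ 0) {c : ℕ} (hc : c = (o - 1) / 2)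
    (hf : fl c = 0) :
    Inv L (i + 1) (last (premise L) (premise L o) (o - 1)) h tl qu mk (Function.update fl c 1) where
  h_le := hI.h_le
  tl_pos := hI.tl_pos
  qu_zero := hI.qu_zero
  mark := hI.mark
  inj := hI.inj
  cur := cur_next hI ho (fun _ _ => rfl) _ rfl
  sound := hI.sound
  img := hI.img
  flag c' hc' := by
    rw [crossed_next hI ho fun _ _ => rfl, crossed_next hI ho fun _ _ => rfl]
    by_cases h : c' = c
    · subst h
      simp only [Function.update_self, ne_eq, one_ne_zero, not_false_eq_true, true_iff]
      omega
    · rw [Function.update_of_ne h, hI.flag c' hc']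
      have h₁ : 2 * c' + 1 ≠ o := by omega
      have h₂ : 2 * c' + 1 + 1 ≠ o := by omega
      simp only [h₁, h₂, or_false]
  fire c' hc' h₁ h₂ := by
    rw [crossed_next hI ho fun _ _ => rfl] at h₁ h₂
    have := (hI.flag c' hc').not.1
    by_cases h : c' = c
    · subst h
      have := this (by simp [hf])
      rcases h₁ with h₁ | h₁
      · exact absurd (Or.inl h₁) this
      · rcases h₂ with h₂ | h₂
        · exact absurd (Or.inr h₂) this
        · omega
    · exact hI.fire c' hc' (h₁.resolve_right (by omega)) (h₂.resolve_right (by omega))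
  progress := Or.inl (progress_next hI ho fun _ _ => rfl)

theorem Inv.derivable_of_crossed (hI : Inv L i o h tl qu mk fl) {x : ℕ}
    (hx : Crossed L o h qu x) : Derivable L (premise L x) := by
  obtain ⟨⟨j, hj, e⟩, -⟩ := hx
  rw [← e]
  exact hI.sound j (hj.trans_le hI.h_le)

/-- The premise `o` is not crossed out yet, so a raised flag must be due to the other premise of the
clause. Both premises are then queued atoms, hence derivable. -/
theorem Inv.derivable_concl (hI : Inv L i o h tl qu mk fl) (ho : o ≠ 0) {c : ℕ}
    (hc : c = (o - 1) / 2) (hf : fl c ≠ 0) : Derivable L (L.getD c 0).2.2 := by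
  obtain ⟨hh, ho₁, hcur⟩ := hI.cur.resolve_left ho
  have hlt : c < L.length := by omega
  have ho' : Derivable L (premise L o) := hcur ▸ hI.sound _ (by have := hI.h_le; omega)
  have hm : ((L.getD c 0).1, (L.getD c 0).2.1, (L.getD c 0).2.2) ∈ L := by
    rw [List.getD_eq_getElem _ _ hlt]; exact List.getElem_mem _
  have hcr := (hI.flag c hlt).1 hf
  have hno := not_crossed hI ho
  obtain rfl | rfl : o = 2 * c + 1 ∨ o = 2 * c + 2 := by omega
  · refine .mp hm ?_ ?_
    · rwa [premise_odd] at ho'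
    · rw [← premise_even]; exact hI.derivable_of_crossed (hcr.resolve_left hno)
  · refine .mp hm ?_ ?_
    · rw [← premise_odd]; exact hI.derivable_of_crossed (hcr.resolve_right hno)
    · rwa [premise_even] at ho'

theorem Inv.flag_next (hI : Inv L i o h tl qu mk fl) (ho : o ≠ 0) {c : ℕ}
    (hc : c = (o - 1) / 2) (hf : fl c ≠ 0) {qu' : ℕ → ℕ} (hq : ∀ j < h, qu' j = qu j) (c' : ℕ)
    (hc' : c' < L.length) :
    fl c' ≠ 0 ↔ Crossed L (last (premise L) (premise L o) (o - 1)) h qu' (2 * c' + 1) ∨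
      Crossed L (last (premise L) (premise L o) (o - 1)) h qu' (2 * c' + 2) := by
  rw [crossed_next hI ho hq, crossed_next hI ho hq]
  by_cases h : c' = c
  · subst h
    have := (hI.flag c' hc').1 hf
    simp only [hf, ne_eq, not_false_eq_true, true_iff]
    tauto
  · rw [hI.flag c' hc']
    have h₁ : 2 * c' + 1 ≠ o := by omega
    have h₂ : 2 * c' + 1 + 1 ≠ o := by omega
    simp only [h₁, h₂, or_false]

theorem Inv.fire_old (hI : Inv L i o h tl qu mk fl) (ho : o ≠ 0) {c : ℕ}
    (hc : c = (o - 1) / 2) {qu' : ℕ → ℕ} (hq : ∀ j < h, qu' j = qu j) {c' : ℕ} (hne : c' ≠ c)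
    (hc' : c' < L.length)
    (h₁ : Crossed L (last (premise L) (premise L o) (o - 1)) h qu' (2 * c' + 1))
    (h₂ : Crossed L (last (premise L) (premise L o) (o - 1)) h qu' (2 * c' + 2)) :
    mk (L.getD c' 0).2.2 ≠ 0 := by
  rw [crossed_next hI ho hq] at h₁ h₂
  exact hI.fire c' hc' (h₁.resolve_right (by omega)) (h₂.resolve_right (by omega))

theorem Inv.second (hI : Inv L i o h tl qu mk fl) (ho : o ≠ 0) {c : ℕ} (hc : c = (o - 1) / 2)
    (hf : fl c ≠ 0) (hm : mk (L.getD c 0).2.2 ≠ 0) :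
    Inv L (i + 1) (last (premise L) (premise L o) (o - 1)) h tl qu mk fl where
  h_le := hI.h_le
  tl_pos := hI.tl_pos
  qu_zero := hI.qu_zero
  mark := hI.mark
  inj := hI.inj
  cur := cur_next hI ho (fun _ _ => rfl) _ rfl
  sound := hI.sound
  img := hI.img
  flag := hI.flag_next ho hc hf fun _ _ => rfl
  fire c' hc' h₁ h₂ := by
    by_cases h : c' = c
    · exact h ▸ hm
    · exact hI.fire_old ho hc (fun _ _ => rfl) h hc' h₁ h₂
  progress := Or.inl (progress_next hI ho fun _ _ => rfl)

/-- The conclusion is marked at the moment it is queued, so no atom enters the queue twice; this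
distinctness later bounds the length of the queue. -/
theorem Inv.push (hI : Inv L i o h tl qu mk fl) (ho : o ≠ 0) {c : ℕ} (hc : c = (o - 1) / 2)
    (hf : fl c ≠ 0) {r : ℕ} (hr : r = (L.getD c 0).2.2) (hm : mk r = 0) :
    Inv L (i + 1) (last (premise L) (premise L o) (o - 1)) h (tl + 1) (Function.update qu tl r)
      (Function.update mk r 1) fl := by
  have hlt := hI.h_le
  have hq : ∀ j < tl, Function.update qu tl r j = qu j := fun j hj =>
    Function.update_of_ne (by omega) _ _
  have hq' : ∀ j < h, Function.update qu tl r j = qu j := fun j hj => hq j (by omega)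
  have hnew : ∀ j < tl, qu j ≠ r := fun j hj e => (hI.mark r).2 ⟨j, hj, e⟩ hm
  obtain ⟨hh, ho₁, hcur⟩ := hI.cur.resolve_left ho
  refine
  { h_le := by omega
    tl_pos := by omega
    qu_zero := by rw [hq _ hI.tl_pos, hI.qu_zero]
    mark := fun p => ?_
    inj := fun j hj j' hj' e => ?_
    cur := cur_next hI ho hq' _ rfl
    sound := fun j hj => ?_
    img := fun j hj => ?_
    flag := hI.flag_next ho hc hf hq'
    fire := fun c' hc' h₁ h₂ => ?_
    progress := Or.inl (progress_next hI ho hq') }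
  · by_cases hp : p = r
    · subst hp
      simp only [Function.update_self, ne_eq, one_ne_zero, not_false_eq_true, true_iff]
      exact ⟨tl, by omega, by simp⟩
    · rw [Function.update_of_ne hp, hI.mark]
      constructor
      · rintro ⟨j, hj, e⟩
        exact ⟨j, by omega, by rw [hq j hj, e]⟩
      · rintro ⟨j, hj, e⟩
        rcases Nat.lt_succ_iff_lt_or_eq.1 hj with hj | rfl
        · exact ⟨j, hj, by rw [← hq j hj, e]⟩
        · rw [Function.update_self] at e; exact absurd e.symm hp
  · rcases Nat.lt_succ_iff_lt_or_eq.1 hj with hj | rfl <;>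
      rcases Nat.lt_succ_iff_lt_or_eq.1 hj' with hj' | rfl
    · rw [hq j hj, hq j' hj'] at e; exact hI.inj j hj j' hj' e
    · rw [hq j hj, Function.update_self] at e; exact absurd e (hnew j hj)
    · rw [hq j' hj', Function.update_self] at e; exact absurd e.symm (hnew j' hj')
    · rfl
  · rcases Nat.lt_succ_iff_lt_or_eq.1 hj with hj | rfl
    · rw [hq j hj]; exact hI.sound j hj
    · rw [Function.update_self, hr]; exact hI.derivable_concl ho hc hf
  · rcases Nat.lt_succ_iff_lt_or_eq.1 hj with hj | rfl
    · rw [hq j hj]; exact hI.img j hj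
    · rw [Function.update_self]; exact Or.inr ⟨c, by omega, hr⟩
  · by_cases h : c' = c
    · subst h; rw [← hr]; simp
    · have := hI.fire_old ho hc hq' h hc' h₁ h₂
      by_cases e : (L.getD c' 0).2.2 = r
      · rw [e]; simp
      · rwa [Function.update_of_ne e]

/-- Nothing is crossed out by taking out an atom: all its occurrences are at most the last one,
which becomes the current premise. The atoms taken out earlier are different from it, because the
queue has no repetitions. -/
theorem crossed_dequeue (hI : Inv L i 0 h tl qu mk fl) (hlt : h < tl) (x : ℕ) (hx : 0 < x)
    (hx' : x ≤ 2 * L.length) :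
    Crossed L (last (premise L) (qu h) (2 * L.length)) (h + 1) qu x ↔ Crossed L 0 h qu x := by
  rw [Crossed, Crossed]
  constructor
  · rintro ⟨⟨j, hj, e⟩, h₂⟩
    refine ⟨⟨j, ?_, e⟩, by omega⟩
    rcases Nat.lt_succ_iff_lt_or_eq.1 hj with hj | rfl
    · exact hj
    · exact absurd ⟨by omega, by simp [e], le_last hx hx' e.symm⟩ h₂
  · rintro ⟨⟨j, hj, e⟩, -⟩
    refine ⟨⟨j, by omega, e⟩, ?_⟩
    rintro ⟨-, e', -⟩
    rw [Nat.add_sub_cancel, ← e] at e'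
    exact absurd (hI.inj j (by omega) h hlt e') (by omega)

theorem Inv.dequeue (hI : Inv L i 0 h tl qu mk fl) (hlt : h < tl) :
    Inv L (i + 1) (last (premise L) (qu h) (2 * L.length)) (h + 1) tl qu mk fl where
  h_le := hlt
  tl_pos := hI.tl_pos
  qu_zero := hI.qu_zero
  mark := hI.mark
  inj := hI.inj
  cur := by
    by_cases h0 : last (premise L) (qu h) (2 * L.length) = 0
    · exact Or.inl h0
    · exact Or.inr ⟨by omega, last_le _ _ _, by rw [apply_last h0, Nat.add_sub_cancel]⟩
  sound := hI.sound
  img := hI.img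
  flag c hc := by
    rw [crossed_dequeue hI hlt _ (by omega) (by omega),
      crossed_dequeue hI hlt _ (by omega) (by omega), hI.flag c hc]
  fire c hc := by
    rw [crossed_dequeue hI hlt _ (by omega) (by omega),
      crossed_dequeue hI hlt _ (by omega) (by omega)]
    exact hI.fire c hc
  progress := by
    classical
    have h₁ := hI.progress.resolve_right fun H => by omega
    refine Or.inl ?_
    rw [Finset.filter_congr fun x hx => crossed_dequeue hI hlt x
      (by rw [Finset.mem_Icc] at hx; omega) (Finset.mem_Icc.1 hx).2]
    omega

theorem Inv.idle (hI : Inv L i 0 h tl qu mk fl) (hlt : ¬ h < tl) :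
    Inv L (i + 1) 0 h tl qu mk fl :=
  { hI with progress := Or.inr ⟨rfl, by have := hI.h_le; omega⟩ }

/-- The queued atoms are distinct, and each is `0` or the conclusion of one of the clauses. -/
theorem Inv.tl_le (hI : Inv L i o h tl qu mk fl) : tl ≤ L.length + 1 := by
  classical
  have : (Finset.range tl).image qu ⊆
      insert 0 ((Finset.range L.length).image fun c => (L.getD c 0).2.2) := by
    intro p hp
    obtain ⟨j, hj, rfl⟩ := Finset.mem_image.1 hp
    rcases hI.img j (Finset.mem_range.1 hj) with e | ⟨c, hc, e⟩
    · rw [e]; exact Finset.mem_insert_self _ _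
    · rw [e]; exact Finset.mem_insert_of_mem (Finset.mem_image.2 ⟨c, Finset.mem_range.2 hc, rfl⟩)
  have h₁ := Finset.card_le_card this
  rw [Finset.card_image_of_injOn fun a ha b hb e => hI.inj a (by simpa using ha) b
    (by simpa using hb) e, Finset.card_range] at h₁
  have h₂ := Finset.card_insert_le 0 ((Finset.range L.length).image fun c => (L.getD c 0).2.2)
  have h₃ := Finset.card_image_le (s := Finset.range L.length) (f := fun c => (L.getD c 0).2.2)
  rw [Finset.card_range] at h₃
  omega

/-- The potential never exceeds `(L.length + 1) + 2 * L.length`, so after `3 * L.length + 2` rounds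
the procedure is at rest: every queued atom has been taken out and every occurrence of it crossed
out. By `fire`, the marked atoms are then closed under the clauses. -/
theorem Inv.mark_iff (hI : Inv L (3 * L.length + 2) o h tl qu mk fl) (p : ℕ) :
    mk p ≠ 0 ↔ Derivable L p := by
  classical
  have hfin : o = 0 ∧ h = tl := by
    refine hI.progress.resolve_left fun H => ?_
    have h₁ := Finset.card_filter_le (Finset.Icc 1 (2 * L.length)) (Crossed L o h qu)
    rw [Nat.card_Icc] at h₁
    have := hI.tl_le
    have := hI.h_le
    omega
  obtain ⟨rfl, rfl⟩ := hfin
  constructor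
  · intro hp
    obtain ⟨j, hj, rfl⟩ := (hI.mark p).1 hp
    exact hI.sound j hj
  · intro hp
    induction hp with
    | zero => exact (hI.mark 0).2 ⟨0, hI.tl_pos, hI.qu_zero⟩
    | @mp p q r hm _ _ hp hq =>
      obtain ⟨c, hc, e⟩ := List.getElem_of_mem hm
      have e' : L.getD c 0 = (p, q, r) := by rw [List.getD_eq_getElem _ _ hc, e]
      have := hI.fire c hc ?_ ?_
      · rwa [e'] at this
      · obtain ⟨j, hj, ej⟩ := (hI.mark p).1 hp
        refine ⟨⟨j, hj, by rw [premise_odd, e', ej]⟩, by omega⟩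
      · obtain ⟨j, hj, ej⟩ := (hI.mark q).1 hq
        refine ⟨⟨j, hj, by rw [premise_even, e', ej]⟩, by omega⟩

end

end Horn

namespace LoopLang

/-! ### Forward chaining as a command -/

namespace Arr

/-- The answer. -/
abbrev result : Fin 31 := 0
/-- The largest arity. -/
abbrev top : Fin 31 := 1
/-- The powers of the number of elements. -/
abbrev pow : Fin 31 := 2
/-- The positions of the tables in the input. -/
abbrev tab : Fin 31 := 10
/-- The clause to be recorded. -/
abbrev tmp : Fin 31 := 11
/-- The number of clauses. -/
abbrev num : Fin 31 := 12
/-- For every atom, the number of the last premise equal to it. -/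
abbrev head : Fin 31 := 13
/-- For every premise, the number of the previous premise equal to it. -/
abbrev next : Fin 31 := 14
/-- For every premise, the number of its clause. -/
abbrev clause : Fin 31 := 15
/-- The conclusions of the clauses. -/
abbrev concl : Fin 31 := 16
/-- Marks the clauses of which a premise has been crossed out. -/
abbrev flag : Fin 31 := 17
/-- The queue of the atoms found. -/
abbrev queue : Fin 31 := 18
/-- Marks the atoms found. -/
abbrev mark : Fin 31 := 19
/-- The premise to be crossed out. -/
abbrev cur : Fin 31 := 20
/-- The number of atoms taken out of the queue. -/
abbrev front : Fin 31 := 21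
/-- The length of the queue. -/
abbrev back : Fin 31 := 22

end Arr

@[simp] theorem put_apply (σ : Store) (k k' : Fin 31) (i i' x : ℕ) :
    put σ k i x k' i' = if k' = k ∧ i' = i then x else σ k' i' := by
  unfold put
  by_cases hk : k' = k
  · subst hk; simp [Function.update_apply]
  · simp [hk]

theorem put_ne (σ : Store) {k k' : Fin 31} (h : k' ≠ k) (i x : ℕ) : put σ k i x k' = σ k' := by
  unfold put; rw [Function.update_of_ne h]

theorem put_same (σ : Store) (k : Fin 31) (i x : ℕ) :
    put σ k i x k = Function.update (σ k) i x := by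
  unfold put; rw [Function.update_self]

/-- The command that adds the clause in `tmp` to the list of clauses. -/
def record : Cmd :=
  let c : Expr := .arr Arr.num (.lit 0)
  let o₁ : Expr := .add (.add c c) (.lit 1)
  let o₂ : Expr := .add (.add c c) (.lit 2)
  let p : Expr := .arr Arr.tmp (.lit 0)
  let q : Expr := .arr Arr.tmp (.lit 1)
  .seq (.store Arr.next o₁ (.arr Arr.head p)) <|
  .seq (.store Arr.head p o₁) <|
  .seq (.store Arr.next o₂ (.arr Arr.head q)) <|
  .seq (.store Arr.head q o₂) <|
  .seq (.store Arr.clause o₁ c) <|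
  .seq (.store Arr.clause o₂ c) <|
  .seq (.store Arr.concl c (.arr Arr.tmp (.lit 2))) <|
  .store Arr.num (.lit 0) (.add c (.lit 1))

/-- The command that adds the clause `p ∧ q → r` to the list of clauses. -/
def emit (p q r : Expr) : Cmd :=
  .seq (.store Arr.tmp (.lit 0) p) <|
  .seq (.store Arr.tmp (.lit 1) q) <|
  .seq (.store Arr.tmp (.lit 2) r) record

/-- The effect of adding a clause. -/
def addClause (σ : Store) (a : HornClause) : Store :=
  record.eval [] (fun _ => 0)
    (put (put (put σ Arr.tmp 0 a.1) Arr.tmp 1 a.2.1) Arr.tmp 2 a.2.2)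

/-- The effect of adding several clauses. -/
def addClauses (L : List HornClause) (σ : Store) : Store := L.foldl addClause σ

theorem addClauses_append (L L' : List HornClause) (σ : Store) :
    addClauses (L ++ L') σ = addClauses L' (addClauses L σ) := List.foldl_append

theorem addClause_of_ne (σ : Store) (a : HornClause) {k : Fin 31}
    (h : k ∉ [Arr.tmp, Arr.num, Arr.head, Arr.next, Arr.clause, Arr.concl]) :
    addClause σ a k = σ k := by
  simp only [List.mem_cons, List.not_mem_nil, not_or, or_false] at h
  simp only [addClause, record, Cmd.eval]
  repeat rw [put_ne]
  all_goals tauto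

theorem addClauses_of_ne (L : List HornClause) (σ : Store) {k : Fin 31}
    (h : k ∉ [Arr.tmp, Arr.num, Arr.head, Arr.next, Arr.clause, Arr.concl]) :
    addClauses L σ k = σ k := by
  induction L generalizing σ with
  | nil => rfl
  | cons a L ih => rw [addClauses, List.foldl_cons, ← addClauses, ih, addClause_of_ne σ a h]

/-- The arrays of `σ` represent the list of clauses `L`. -/
structure Represents (L : List HornClause) (σ : Store) : Prop where
  num : σ Arr.num 0 = L.length
  concl : ∀ c < L.length, σ Arr.concl c = (L.getD c 0).2.2
  clause : ∀ o, 0 < o → o ≤ 2 * L.length → σ Arr.clause o = (o - 1) / 2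
  head : ∀ p, σ Arr.head p = Horn.last (Horn.premise L) p (2 * L.length)
  next : ∀ o, 0 < o → o ≤ 2 * L.length →
    σ Arr.next o = Horn.last (Horn.premise L) (Horn.premise L o) (o - 1)

/-- The new premises have the largest numbers, so each goes to the front of the linked list of its
atom. If both are the same atom, the second is linked to the first, since `head` is updated in
between. -/
theorem Represents.addClause {L : List HornClause} {σ : Store} (h : Represents L σ)
    (a : HornClause) : Represents (L ++ [a]) (addClause σ a) := by
  obtain ⟨p, q, r⟩ := a
  have e₁ : Horn.premise (L ++ [(p, q, r)]) (2 * L.length + 1) = p := by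
    rw [Horn.premise_odd, List.getD_append_right _ _ _ _ le_rfl]; simp
  have e₂ : Horn.premise (L ++ [(p, q, r)]) (2 * L.length + 2) = q := by
    rw [Horn.premise_even, List.getD_append_right _ _ _ _ le_rfl]; simp
  have hl : ∀ x m, m ≤ 2 * L.length → Horn.last (Horn.premise (L ++ [(p, q, r)])) x m =
      Horn.last (Horn.premise L) x m := fun x m hm => Horn.last_congr fun o h0 ho =>
    Horn.premise_append _ h0 (ho.trans hm)
  have hl' : ∀ x, Horn.last (Horn.premise (L ++ [(p, q, r)])) x (2 * L.length + 1) =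
      if p = x then 2 * L.length + 1 else Horn.last (Horn.premise L) x (2 * L.length) :=
    fun x => by rw [Horn.last, e₁, hl _ _ le_rfl]
  have hl'' : ∀ x, Horn.last (Horn.premise (L ++ [(p, q, r)])) x (2 * L.length + 2) =
      if q = x then 2 * L.length + 2 else if p = x then 2 * L.length + 1 else
        Horn.last (Horn.premise L) x (2 * L.length) :=
    fun x => by rw [Horn.last, e₂, hl']
  have hn := h.num
  refine ⟨?_, fun c hc => ?_, fun o h0 ho => ?_, fun x => ?_, fun o h0 ho => ?_⟩
  · simp +decide [LoopLang.addClause, record, Cmd.eval, Expr.eval, hn]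
  · rw [List.length_append, List.length_singleton] at hc
    simp +decide only [LoopLang.addClause, record, Cmd.eval, Expr.eval, put_apply, hn, if_true,
      if_false, false_and, true_and]
    split_ifs with hc'
    · subst hc'; rw [List.getD_append_right _ _ _ _ le_rfl]; simp
    · rw [List.getD_append _ _ _ _ (by omega), h.concl c (by omega)]
  · rw [List.length_append, List.length_singleton] at ho
    simp +decide only [LoopLang.addClause, record, Cmd.eval, Expr.eval, put_apply, hn, if_true,
      if_false, false_and, true_and]
    split_ifs
    · omega
    · omega
    · exact h.clause o h0 (by omega)
  · rw [List.length_append, List.length_singleton, Nat.mul_add, hl'']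
    simp +decide only [LoopLang.addClause, record, Cmd.eval, Expr.eval, put_apply, hn, if_true,
      if_false, false_and, true_and, h.head]
    simp only [eq_comm (a := x), two_mul]
  · rw [List.length_append, List.length_singleton] at ho
    simp +decide only [LoopLang.addClause, record, Cmd.eval, Expr.eval, put_apply, hn, if_true,
      if_false, false_and, true_and, h.head]
    split_ifs with h₁ h₂ h₃
    · obtain rfl : o = 2 * L.length + 2 := by omega
      rw [e₂, Nat.add_sub_assoc (by omega), hl', if_pos h₂.symm, two_mul]
    · obtain rfl : o = 2 * L.length + 2 := by omega
      rw [e₂, Nat.add_sub_assoc (by omega), hl', if_neg (Ne.symm h₂)]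
    · obtain rfl : o = 2 * L.length + 1 := by omega
      rw [e₁, Nat.add_sub_cancel, hl _ _ le_rfl]
    · rw [hl _ _ (by omega), Horn.premise_append _ h0 (by omega), h.next o h0 (by omega)]

theorem Represents.addClauses {L : List HornClause} {σ : Store} (h : Represents L σ)
    (L' : List HornClause) : Represents (L ++ L') (addClauses L' σ) := by
  induction L' generalizing L σ with
  | nil => simpa [LoopLang.addClauses] using h
  | cons a L' ih =>
    have := ih (h.addClause a)
    rwa [List.append_assoc] at this

theorem Represents.congr {L : List HornClause} {σ σ' : Store} (h : Represents L σ)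
    (e : ∀ k ∈ [Arr.num, Arr.head, Arr.next, Arr.clause, Arr.concl], σ' k = σ k) :
    Represents L σ' := by
  simp only [List.mem_cons, List.not_mem_nil, or_false, forall_eq_or_imp, forall_eq] at e
  obtain ⟨e₁, e₂, e₃, e₄, e₅⟩ := e
  exact ⟨e₁ ▸ h.num, e₅ ▸ h.concl, e₄ ▸ h.clause, e₂ ▸ h.head, e₃ ▸ h.next⟩

/-- Crossing out the premise `cur`. -/
def cross : Cmd :=
  let c : Expr := .arr Arr.clause (.arr Arr.cur (.lit 0))
  let r : Expr := .arr Arr.concl c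
  let t : Expr := .arr Arr.back (.lit 0)
  .ite (.arr Arr.flag c)
    (.ite (.arr Arr.mark r) .skip
      (.seq (.store Arr.mark r (.lit 1)) <|
       .seq (.store Arr.queue t r) <|
       .store Arr.back (.lit 0) (.add t (.lit 1))))
    (.store Arr.flag c (.lit 1))

/-- One round of forward chaining. -/
def chainStep : Cmd :=
  let o : Expr := .arr Arr.cur (.lit 0)
  let h : Expr := .arr Arr.front (.lit 0)
  let t : Expr := .arr Arr.back (.lit 0)
  .ite o
    (.seq cross (.store Arr.cur (.lit 0) (.arr Arr.next o)))
    (.ite (.sub t h)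
      (.seq (.store Arr.cur (.lit 0) (.arr Arr.head (.arr Arr.queue h))) <|
       .store Arr.front (.lit 0) (.add h (.lit 1)))
      .skip)

/-- Forward chaining from the recorded clauses. -/
def chain : Cmd :=
  let c : Expr := .arr Arr.num (.lit 0)
  .seq (.store Arr.mark (.lit 0) (.lit 1)) <|
  .seq (.store Arr.back (.lit 0) (.lit 1)) <|
  .loop (.lit 0) (.add (.add (.add c c) c) (.lit 2)) (.lit 0) chainStep

/-- The invariant of forward chaining, in terms of the arrays. -/
def ChainInv (L : List HornClause) (i : ℕ) (σ : Store) : Prop :=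
  Represents L σ ∧ Horn.Inv L i (σ Arr.cur 0) (σ Arr.front 0) (σ Arr.back 0) (σ Arr.queue)
    (σ Arr.mark) (σ Arr.flag)

variable {w : List ℕ} {ρ : ℕ → ℕ}

/-- Each path through the command realizes one of the moves `Inv.dequeue`, `Inv.idle`, `Inv.first`,
`Inv.push`, `Inv.second`. -/
theorem ChainInv.chainStep {L : List HornClause} {i : ℕ} {σ : Store} (h : ChainInv L i σ) :
    ChainInv L (i + 1) (chainStep.eval w ρ σ) := by
  obtain ⟨hR, hI⟩ := h
  by_cases ho : σ Arr.cur 0 = 0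
  · rw [ho] at hI
    by_cases hlt : σ Arr.front 0 < σ Arr.back 0
    · have h₁ : σ Arr.back 0 - σ Arr.front 0 ≠ 0 := by omega
      have e : LoopLang.chainStep.eval w ρ σ = put (put σ Arr.cur 0
          (Horn.last (Horn.premise L) (σ Arr.queue (σ Arr.front 0)) (2 * L.length)))
          Arr.front 0 (σ Arr.front 0 + 1) := by
        simp +decide only [LoopLang.chainStep, Cmd.eval, Expr.eval, ho, if_true, if_false, h₁,
          hR.head, put_apply]
      rw [e]
      refine ⟨hR.congr ?_, ?_⟩
      · simp +decide [put_ne]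
      · have := hI.dequeue hlt
        simpa +decide [put_ne, put_same] using this
    · have h₁ : σ Arr.back 0 - σ Arr.front 0 = 0 := by omega
      have e : LoopLang.chainStep.eval w ρ σ = σ := by
        simp only [LoopLang.chainStep, Cmd.eval, Expr.eval, ho, if_true, h₁]
      rw [e]
      refine ⟨hR, ?_⟩
      rw [ho]
      exact hI.idle hlt
  · have hc := hI.cur.resolve_left ho
    have hcl := hR.clause _ (by omega) hc.2.1
    have hnx := hR.next _ (by omega) hc.2.1
    have hco := hR.concl _ (show (σ Arr.cur 0 - 1) / 2 < L.length by omega)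
    obtain ⟨o, hodef⟩ : ∃ o, σ Arr.cur 0 = o := ⟨_, rfl⟩
    rw [hodef] at hI ho hc hcl hnx hco
    set c := (o - 1) / 2 with hcdef
    have he : LoopLang.chainStep.eval w ρ σ = put (cross.eval w ρ σ) Arr.cur 0
        (cross.eval w ρ σ Arr.next (cross.eval w ρ σ Arr.cur 0)) := by
      simp only [LoopLang.chainStep, Cmd.eval, Expr.eval, hodef, ho, if_false]
    by_cases hf : σ Arr.flag c = 0
    · have e : cross.eval w ρ σ = put σ Arr.flag c 1 := by
        simp only [cross, Cmd.eval, Expr.eval, hodef, hcl, hf, if_true]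
      rw [he, e, put_ne _ (by decide), put_ne _ (by decide), hodef, hnx]
      refine ⟨hR.congr ?_, ?_⟩
      · simp +decide [put_ne]
      · have := hI.first ho hcdef hf
        simpa +decide [put_ne, put_same] using this
    · by_cases hm : σ Arr.mark (L.getD c 0).2.2 = 0
      · have e : cross.eval w ρ σ = put (put (put σ Arr.mark (L.getD c 0).2.2 1)
            Arr.queue (σ Arr.back 0) (L.getD c 0).2.2) Arr.back 0 (σ Arr.back 0 + 1) := by
          simp +decide only [cross, Cmd.eval, Expr.eval, hodef, hcl, hf, hco, hm, if_true, if_false,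
            put_apply, false_and]
        rw [he, e, put_ne _ (by decide), put_ne _ (by decide), put_ne _ (by decide),
          put_ne (k' := Arr.cur) _ (by decide), put_ne (k' := Arr.cur) _ (by decide),
          put_ne (k' := Arr.cur) _ (by decide), hodef, hnx]
        refine ⟨hR.congr ?_, ?_⟩
        · simp +decide [put_ne]
        · have := hI.push ho hcdef hf rfl hm
          simpa +decide [put_ne, put_same] using this
      · have e : cross.eval w ρ σ = σ := by
          simp only [cross, Cmd.eval, Expr.eval, hodef, hcl, hf, hco, hm, if_false]
        rw [he, e, hodef, hnx]
        refine ⟨hR.congr ?_, ?_⟩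
        · simp +decide [put_ne]
        · have := hI.second ho hcdef hf hm
          simpa +decide [put_ne, put_same] using this

theorem chainStep_of_ne (σ : Store) {k : Fin 31}
    (h : k ∉ [Arr.cur, Arr.front, Arr.back, Arr.queue, Arr.mark, Arr.flag]) :
    chainStep.eval w ρ σ k = σ k := by
  simp only [List.mem_cons, List.not_mem_nil, not_or, or_false] at h
  simp only [chainStep, cross, Cmd.eval]
  split_ifs <;> simp [put_ne, h]

theorem chainStep_ticks_le (σ : Store) : chainStep.ticks w ρ σ ≤ 7 := by
  simp only [chainStep, cross, Cmd.ticks]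
  split_ifs <;> omega

theorem iter_induction {f : ℕ → Store → Store} {σ : Store} (p : ℕ → Store → Prop) {m : ℕ}
    (h0 : p 0 σ) (hs : ∀ i < m, ∀ τ, p i τ → p (i + 1) (f i τ)) : p m (iter f m σ) := by
  induction m with
  | zero => exact h0
  | succ m ih => exact hs m (by omega) _ (ih fun i hi => hs i (by omega))

theorem ticks_loop_le {s m b : Expr} {c : Cmd} {σ : Store} {K : ℕ}
    (h : ∀ i < m.eval w ρ σ, ∀ τ, c.ticks w (loopEnv (s.eval w ρ σ) (m.eval w ρ σ)
      (b.eval w ρ σ) i ρ) τ ≤ K) :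
    (Cmd.loop s m b c).ticks w ρ σ ≤ m.eval w ρ σ * (K + 1) + 1 := by
  rw [Cmd.ticks, add_comm]
  refine Nat.add_le_add_right ?_ 1
  refine (Finset.sum_le_card_nsmul _ _ (K + 1) fun i hi => ?_).trans ?_
  · rw [add_comm]; exact Nat.add_le_add_right (h i (Finset.mem_range.1 hi) _) 1
  · simp

/-- The loop has `3 * L.length + 2` rounds of at most `7 + 1` ticks; two stores and the loop itself
add `3`. -/
theorem chain_spec {L : List HornClause} {σ : Store} (hR : Represents L σ)
    (h0 : ∀ k ∈ [Arr.cur, Arr.front, Arr.queue, Arr.mark, Arr.flag], σ k = fun _ => 0) :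
    (∀ p, chain.eval w ρ σ Arr.mark p ≠ 0 ↔ Derivable L p) ∧
    (∀ k ∉ [Arr.cur, Arr.front, Arr.back, Arr.queue, Arr.mark, Arr.flag],
      chain.eval w ρ σ k = σ k) ∧ chain.ticks w ρ σ ≤ 24 * L.length + 19 := by
  simp only [List.mem_cons, List.not_mem_nil, or_false, forall_eq_or_imp, forall_eq] at h0
  obtain ⟨hc, hf, hq, hm, hfl⟩ := h0
  set σ' := put (put σ Arr.mark 0 1) Arr.back 0 1 with hσ'
  have hn : σ' Arr.num 0 = L.length := by
    rw [hσ', put_ne _ (by decide), put_ne _ (by decide), hR.num]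
  have hn' : ((σ' Arr.num 0 + σ' Arr.num 0) + σ' Arr.num 0) + 2 = 3 * L.length + 2 := by omega
  have hI : ChainInv L 0 σ' := by
    refine ⟨hR.congr ?_, ?_⟩
    · simp +decide [hσ', put_ne]
    · have := Horn.Inv.init (L := L) (qu := fun _ => 0) (fl := fun _ => 0)
        (mk := Function.update (fun _ => 0) 0 1) (fun p => by
          by_cases hp : p = 0
          · subst hp; simp
          · simp [hp]) rfl (fun _ => rfl)
      simpa +decide [hσ', put_ne, put_same, hc, hf, hq, hm, hfl] using this
  have he : chain.eval w ρ σ = iter (fun i => chainStep.eval w (loopEnv 0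
      (((σ' Arr.num 0 + σ' Arr.num 0) + σ' Arr.num 0) + 2) 0 i ρ))
      (((σ' Arr.num 0 + σ' Arr.num 0) + σ' Arr.num 0) + 2) σ' := rfl
  rw [hn'] at he
  rw [he]
  refine ⟨?_, fun k hk => ?_, ?_⟩
  · exact (iter_induction (ChainInv L) hI fun i _ τ h => h.chainStep).2.mark_iff
  · refine iter_induction (fun _ τ => τ k = σ k) ?_ fun i _ τ h => ?_
    · simp only [List.mem_cons, List.not_mem_nil, not_or, or_false] at hk
      rw [hσ', put_ne _ hk.2.2.1, put_ne _ hk.2.2.2.2.1]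
    · rw [chainStep_of_ne τ hk, h]
  · have : chain.ticks w ρ σ = 1 + (1 + (Cmd.loop (.lit 0) (.add (.add (.add (.arr Arr.num (.lit 0))
        (.arr Arr.num (.lit 0))) (.arr Arr.num (.lit 0))) (.lit 2)) (.lit 0) chainStep).ticks w ρ
        σ') := rfl
    have h₂ := ticks_loop_le (w := w) (ρ := ρ) (σ := σ') (s := .lit 0) (b := .lit 0)
      (m := .add (.add (.add (.arr Arr.num (.lit 0))
        (.arr Arr.num (.lit 0))) (.arr Arr.num (.lit 0))) (.lit 2)) (c := chainStep)
      fun i _ τ => chainStep_ticks_le τ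
    have h₃ : (Expr.add (.add (.add (.arr Arr.num (.lit 0))
        (.arr Arr.num (.lit 0))) (.arr Arr.num (.lit 0))) (.lit 2)).eval w ρ σ' =
        3 * L.length + 2 := hn'
    rw [h₃] at h₂
    omega

end LoopLang

namespace UniversalAlgebra

variable {ι : Type v} {A : Type u} {𝔸 : UniversalAlgebra ι A}

/-! ### Generated subuniverses, congruences and commutators -/

theorem subset_Sg (X : Set A) : X ⊆ 𝔸.Sg X := fun _ hx _ hS => hS.1 hx

theorem isSubuniverse_Sg (X : Set A) : 𝔸.IsSubuniverse (𝔸.Sg X) :=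
  fun i x hx S hS => hS.2 i x fun j => hx j S hS

theorem Sg_subset {X S : Set A} (h : X ⊆ S) (hS : 𝔸.IsSubuniverse S) : 𝔸.Sg X ⊆ S :=
  fun _ hx => hx S ⟨h, hS⟩

theorem isCongruence_Cg (a b : A) : 𝔸.IsCongruence (𝔸.Cg a b) := (𝔸.Cg_isLeast a b).1.1

theorem Cg_self (a b : A) : 𝔸.Cg a b a b := (𝔸.Cg_isLeast a b).1.2

theorem Cg_le {θ : Setoid A} (hθ : 𝔸.IsCongruence θ) {a b : A} (h : θ a b) : 𝔸.Cg a b ≤ θ :=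
  (𝔸.Cg_isLeast a b).2 ⟨hθ, h⟩

theorem isCongruence_commutator (α β : Setoid A) : 𝔸.IsCongruence (𝔸.commutator α β) :=
  (𝔸.commutator_isLeast α β).1.1

theorem centralizes_commutator (α β : Setoid A) : 𝔸.Centralizes α β (𝔸.commutator α β) :=
  (𝔸.commutator_isLeast α β).1.2

theorem commutator_le {α β γ : Setoid A} (h : 𝔸.IsCongruence γ) (h' : 𝔸.Centralizes α β γ) :
    𝔸.commutator α β ≤ γ :=
  (𝔸.commutator_isLeast α β).2 ⟨h, h'⟩

theorem matrices_mono {α β α' β' : Setoid A} (hα : α ≤ α') (hβ : β ≤ β') :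
    𝔸.matrices α β ⊆ 𝔸.matrices α' β' := by
  refine Sg_subset ?_ (isSubuniverse_Sg _)
  rintro p (⟨a, a', h, rfl⟩ | ⟨b, b', h, rfl⟩)
  · exact subset_Sg _ (Or.inl ⟨a, a', hα h, rfl⟩)
  · exact subset_Sg _ (Or.inr ⟨b, b', hβ h, rfl⟩)

/-- Larger congruences have more matrices and thus a stronger term condition. With this, a bound
modulo the commutator of a principal congruence serves every congruence above it. -/
theorem commutator_mono {α β α' β' : Setoid A} (hα : α ≤ α') (hβ : β ≤ β') :
    𝔸.commutator α β ≤ 𝔸.commutator α' β' :=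
  commutator_le (isCongruence_commutator _ _) fun x y u v h =>
    centralizes_commutator α' β' x y u v (matrices_mono hα hβ h)

/-! ### Term operations -/

namespace IsTermOp

variable {k l : ℕ} {t : (Fin k → A) → A}

theorem apply_const (ht : 𝔸.IsTermOp k t) (h : 𝔸.IsIdempotent) (a : A) : t (fun _ => a) = a := by
  induction ht with
  | proj j => rfl
  | comp i t _ ih => simp only [ih]; exact h i a

theorem rel (ht : 𝔸.IsTermOp k t) {θ : Setoid A} (hθ : 𝔸.IsCongruence θ) {x y : Fin k → A}
    (h : ∀ j, θ (x j) (y j)) : θ (t x) (t y) := by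
  induction ht with
  | proj j => exact h j
  | comp i t _ ih => exact hθ i _ _ ih

theorem subst (ht : 𝔸.IsTermOp k t) {s : Fin k → (Fin l → A) → A} (hs : ∀ j, 𝔸.IsTermOp l (s j)) :
    𝔸.IsTermOp l fun x => t fun j => s j x := by
  induction ht with
  | proj j => exact hs j
  | comp i t _ ih => exact comp i _ ih

theorem subst₃ {t : (Fin 3 → A) → A} (ht : 𝔸.IsTermOp 3 t) {s₀ s₁ s₂ : (Fin l → A) → A}
    (h₀ : 𝔸.IsTermOp l s₀) (h₁ : 𝔸.IsTermOp l s₁) (h₂ : 𝔸.IsTermOp l s₂) :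
    𝔸.IsTermOp l fun x => t ![s₀ x, s₁ x, s₂ x] := by
  have := ht.subst (s := ![s₀, s₁, s₂]) (by intro j; fin_cases j <;> assumption)
  convert this using 3
  ext j
  fin_cases j <;> rfl

theorem apply_same {t : (Fin 3 → A) → A} (ht : 𝔸.IsTermOp 3 t) (h : 𝔸.IsIdempotent) (a : A) :
    t ![a, a, a] = a := by
  have := ht.apply_const h a
  convert this using 2
  ext j
  fin_cases j <;> rfl

theorem rel₃ {t : (Fin 3 → A) → A} (ht : 𝔸.IsTermOp 3 t) {θ : Setoid A} (hθ : 𝔸.IsCongruence θ)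
    {a b c a' b' c' : A} (ha : θ a a') (hb : θ b b') (hc : θ c c') :
    θ (t ![a, b, c]) (t ![a', b', c']) :=
  ht.rel hθ (by intro j; fin_cases j <;> assumption)

theorem mem_of_isSubuniverse_sq (ht : 𝔸.IsTermOp k t) {S : Set (A × A)}
    (hS : 𝔸.sq.IsSubuniverse S) {x y : Fin k → A} (h : ∀ j, (x j, y j) ∈ S) : (t x, t y) ∈ S := by
  induction ht with
  | proj j => exact h j
  | comp i t _ ih => exact hS i (fun j => (t j x, t j y)) ih

end IsTermOp

/-- The pairs of values of ternary terms contain the generators, by projections, and are closed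
under the operations, by composition. This turns membership in a subuniverse into the existence of a
term. -/
theorem mem_Sg_sq_iff {a b c a' b' c' : A} {p : A × A} :
    p ∈ 𝔸.sq.Sg {(a, a'), (b, b'), (c, c')} ↔
      ∃ t, 𝔸.IsTermOp 3 t ∧ p = (t ![a, b, c], t ![a', b', c']) := by
  constructor
  · intro hp
    refine Sg_subset (𝔸 := 𝔸.sq) (S := {p | ∃ t, 𝔸.IsTermOp 3 t ∧
      p = (t ![a, b, c], t ![a', b', c'])}) ?_ ?_ hp
    · rintro q (rfl | rfl | rfl)
      · exact ⟨_, .proj 0, rfl⟩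
      · exact ⟨_, .proj 1, rfl⟩
      · exact ⟨_, .proj 2, rfl⟩
    · intro i x hx
      choose t ht hxt using hx
      refine ⟨_, .comp (𝔸 := 𝔸) i t ht, ?_⟩
      exact congrArg (𝔸.sq.op i) (funext hxt)
  · rintro ⟨t, ht, rfl⟩
    refine ht.mem_of_isSubuniverse_sq (isSubuniverse_Sg _) fun j => subset_Sg _ ?_
    fin_cases j <;> simp

/-! ### Local and global difference terms -/

theorem HasDifferenceTermOperation.passesLocalTest (h : 𝔸.HasDifferenceTermOperation) :
    𝔸.PassesLocalTest := by
  obtain ⟨d, hd, h⟩ := h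
  intro a b a' b'
  refine ⟨(d ![a, b, b], d ![a', a', b']), mem_Sg_sq_iff.2 ⟨d, hd, rfl⟩, ?_, (h a' b').1⟩
  exact (𝔸.commutator _ _).symm' ((h a b).2 _ (isCongruence_Cg a b) (Cg_self a b))

theorem PassesLocalTest.exists_term (h : 𝔸.PassesLocalTest) (a b a' b' : A) :
    ∃ t, 𝔸.IsTermOp 3 t ∧ 𝔸.commutator (𝔸.Cg a b) (𝔸.Cg a b) (t ![a, b, b]) a ∧
      t ![a', a', b'] = b' := by
  obtain ⟨p, hp, hc, hb⟩ := h a b a' b'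
  obtain ⟨t, ht, rfl⟩ := mem_Sg_sq_iff.1 hp
  exact ⟨t, ht, (𝔸.commutator _ _).symm' hc, hb⟩

/-- The good behaviour at the one pair `(a, b)` is kept while the pairs with `t(a', a', b') = b'`
are acquired one after the other. -/
theorem PassesLocalTest.exists_term_finset (h : 𝔸.PassesLocalTest) (hi : 𝔸.IsIdempotent) (a b : A)
    (S : Finset (A × A)) :
    ∃ t, 𝔸.IsTermOp 3 t ∧ 𝔸.commutator (𝔸.Cg a b) (𝔸.Cg a b) (t ![a, b, b]) a ∧
      ∀ p ∈ S, t ![p.1, p.1, p.2] = p.2 := by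
  classical
  induction S using Finset.induction_on with
  | empty => exact ⟨_, .proj 0, (𝔸.commutator _ _).refl' a, by simp⟩
  | insert p S _ ih =>
    obtain ⟨t, ht, hab, hS⟩ := ih
    obtain ⟨s, hs, hab', hp⟩ := h.exists_term a b (t ![p.1, p.1, p.2]) p.2
    -- The term is `s(t(x, y, z), t(y, y, z), z)`. At `x = y` its first two arguments coincide: for
    -- the new pair `s` was chosen to correct exactly this value, and for the old pairs all three
    -- arguments are equal to `z`. At `(a, b, b)` the arguments are, modulo the commutator, again
    -- `a, b, b`.
    refine ⟨fun x => s ![t ![x 0, x 1, x 2], t ![x 1, x 1, x 2], x 2],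
      hs.subst₃ (ht.subst₃ (.proj 0) (.proj 1) (.proj 2)) (ht.subst₃ (.proj 1) (.proj 1) (.proj 2))
        (.proj 2), ?_, ?_⟩
    · have hc := isCongruence_commutator (𝔸 := 𝔸) (𝔸.Cg a b) (𝔸.Cg a b)
      refine Setoid.trans' _ ?_ hab'
      refine hs.rel₃ hc hab ?_ (Setoid.refl' _ _)
      change 𝔸.commutator _ _ (t ![b, b, b]) b
      rw [ht.apply_same hi]
    · intro q hq
      rcases Finset.mem_insert.1 hq with rfl | hq
      · exact hp
      · change s ![t ![q.1, q.1, q.2], t ![q.1, q.1, q.2], q.2] = q.2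
        rw [hS q hq, hs.apply_same hi]

/-- Now the identity `t(x, x, y) = y` holds throughout, and the pairs `(a, b)` at which the
commutator condition holds are acquired one at a time, starting from the third projection. -/
theorem PassesLocalTest.hasDifferenceTermOperation [Finite A] (h : 𝔸.PassesLocalTest)
    (hi : 𝔸.IsIdempotent) : 𝔸.HasDifferenceTermOperation := by
  classical
  have := Fintype.ofFinite A
  suffices H : ∀ S : Finset (A × A), ∃ t, 𝔸.IsTermOp 3 t ∧
      (∀ p ∈ S, 𝔸.commutator (𝔸.Cg p.1 p.2) (𝔸.Cg p.1 p.2) (t ![p.1, p.2, p.2]) p.1) ∧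
      ∀ a b, t ![a, a, b] = b by
    obtain ⟨t, ht, h₀, h₁⟩ := H Finset.univ
    refine ⟨t, ht, fun a b => ⟨h₁ a b, fun θ hθ hab => ?_⟩⟩
    exact commutator_mono (Cg_le hθ hab) (Cg_le hθ hab) (h₀ (a, b) (Finset.mem_univ _))
  intro S
  induction S using Finset.induction_on with
  | empty => exact ⟨_, .proj 2, by simp, fun a b => rfl⟩
  | insert p S _ ih =>
    obtain ⟨t, ht, h₀, h₁⟩ := ih
    obtain ⟨a, b⟩ := p
    obtain ⟨s, hs, hs₀, hs₁⟩ := h.exists_term_finset hi a (t ![a, b, b]) Finset.univ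
    -- The term is `s(x, t(x, y, y), t(x, y, z))`. At `(a, b, b)` its last two arguments are `t(a,
    -- b, b)`, the element for which `s` was chosen; `t(a, b, b)` is `θ_ab`-related to `t(a, a, a) =
    -- a`, so the congruence used for `s` lies below `θ_ab`. At the old pairs `t(x, y, y)` is
    -- already related to `x`.
    refine ⟨fun x => s ![x 0, t ![x 0, x 1, x 1], t ![x 0, x 1, x 2]],
      hs.subst₃ (.proj 0) (ht.subst₃ (.proj 0) (.proj 1) (.proj 1))
        (ht.subst₃ (.proj 0) (.proj 1) (.proj 2)), ?_, ?_⟩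
    · intro q hq
      change 𝔸.commutator _ _ (s ![q.1, t ![q.1, q.2, q.2], t ![q.1, q.2, q.2]]) q.1
      rcases Finset.mem_insert.1 hq with rfl | hq
      · have hle : 𝔸.Cg a (t ![a, b, b]) ≤ 𝔸.Cg a b := by
          refine Cg_le (isCongruence_Cg a b) (Setoid.symm' _ ?_)
          have hab := Setoid.symm' _ (Cg_self (𝔸 := 𝔸) a b)
          have := ht.rel₃ (isCongruence_Cg (𝔸 := 𝔸) a b) (Setoid.refl' _ a) hab hab
          rwa [ht.apply_same hi] at this
        exact commutator_mono hle hle hs₀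
      · have := hs.rel₃ (isCongruence_commutator (𝔸 := 𝔸) (𝔸.Cg q.1 q.2) (𝔸.Cg q.1 q.2))
          (Setoid.refl' _ q.1) (h₀ q hq) (h₀ q hq)
        rwa [hs.apply_same hi] at this
    · intro a' b'
      change s ![a', t ![a', a', a'], t ![a', a', b']] = b'
      rw [ht.apply_same hi, h₁]
      exact hs₁ (a', b') (Finset.mem_univ _)

theorem hasDifferenceTermOperation_iff [Finite A] (hi : 𝔸.IsIdempotent) :
    𝔸.HasDifferenceTermOperation ↔ 𝔸.PassesLocalTest :=
  ⟨fun h => h.passesLocalTest, fun h => h.hasDifferenceTermOperation hi⟩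

/-! ### The local test as a system of Horn clauses -/

/-! ### Tuples as numbers in base `n`. -/

section Digits

set_option linter.unusedSectionVars false

variable {n : ℕ} [NeZero n]

/-- The digit of `X` in position `j`, in base `n`. -/
def digit (n : ℕ) [NeZero n] (X j : ℕ) : Fin n := Fin.ofNat n (X / n ^ j)

theorem ofNat_val (x : Fin n) : Fin.ofNat n x = x := by
  ext; simp [Fin.ofNat, Nat.mod_eq_of_lt x.2]

theorem ofNat_add_mul (x X : ℕ) : Fin.ofNat n (x + X * n) = Fin.ofNat n x := by
  ext; simp [Fin.ofNat]

theorem digit_cons_zero (x X : ℕ) : digit n (x + X * n) 0 = Fin.ofNat n x := by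
  rw [digit, pow_zero, Nat.div_one, ofNat_add_mul]

theorem digit_cons_succ {x : ℕ} (hx : x < n) (X j : ℕ) :
    digit n (x + X * n) (j + 1) = digit n X j := by
  have hn : 0 < n := NeZero.pos n
  rw [digit, digit, pow_succ', ← Nat.div_div_eq_div_mul, Nat.add_mul_div_right _ _ hn,
    Nat.div_eq_of_lt hx, zero_add]

/-- The number with the given digits. -/
def ofDigits {i : ℕ} (v : Fin i → Fin n) : ℕ := (finFunctionFinEquiv v : Fin (n ^ i))

theorem ofDigits_lt {i : ℕ} (v : Fin i → Fin n) : ofDigits v < n ^ i := (finFunctionFinEquiv v).2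

theorem digit_ofDigits {i : ℕ} (v : Fin i → Fin n) (j : Fin i) : digit n (ofDigits v) j = v j := by
  have := congrFun (finFunctionFinEquiv.symm_apply_apply v) j
  rw [← this]
  ext
  simp [digit, ofDigits, Fin.ofNat, finFunctionFinEquiv]

/-- For `M < n ^ j` and `x < n`, the number `H * n ^ (j + 1) + M + x * n ^ j` stands for the tuple
with entry `x` at position `j`, the earlier entries in `M` and the later ones in `H`. This form lets
one entry vary while the others stay fixed. -/
theorem digit_splice_lt {j l : ℕ} (h : l < j) (H M x : ℕ) :
    digit n (H * n ^ (j + 1) + M + x * n ^ j) l = digit n M l := by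
  have hn : 0 < n := NeZero.pos n
  obtain ⟨d, rfl⟩ : ∃ d, j = l + 1 + d := ⟨j - l - 1, by omega⟩
  have : H * n ^ (l + 1 + d + 1) + M + x * n ^ (l + 1 + d) =
      M + n ^ l * ((H * n ^ (d + 1) + x * n ^ d) * n) := by ring
  rw [digit, digit, this, Nat.add_mul_div_left _ _ (pow_pos hn l), ofNat_add_mul]

theorem digit_splice_self {j M : ℕ} (hM : M < n ^ j) (H x : ℕ) :
    digit n (H * n ^ (j + 1) + M + x * n ^ j) j = Fin.ofNat n x := by
  have hn : 0 < n := NeZero.pos n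
  have : H * n ^ (j + 1) + M + x * n ^ j = M + n ^ j * (x + H * n) := by ring
  rw [digit, this, Nat.add_mul_div_left _ _ (pow_pos hn j), Nat.div_eq_of_lt hM, zero_add,
    ofNat_add_mul]

theorem splice_lt {j M x : ℕ} (hM : M < n ^ j) (hx : x < n) : M + x * n ^ j < n ^ (j + 1) := by
  have : (x + 1) * n ^ j ≤ n * n ^ j := Nat.mul_le_mul_right _ hx
  rw [pow_succ']
  linarith

theorem digit_splice_gt {j l M x : ℕ} (h : j < l) (hM : M < n ^ j) (hx : x < n) (H : ℕ) :
    digit n (H * n ^ (j + 1) + M + x * n ^ j) l = digit n H (l - j - 1) := by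
  have hn : 0 < n := NeZero.pos n
  obtain ⟨d, rfl⟩ : ∃ d, l = j + 1 + d := ⟨l - j - 1, by omega⟩
  have : H * n ^ (j + 1) + M + x * n ^ j = (M + x * n ^ j) + n ^ (j + 1) * H := by ring
  rw [digit, digit, pow_add n (j + 1) d, ← Nat.div_div_eq_div_mul, this,
    Nat.add_mul_div_left _ _ (pow_pos hn _), Nat.div_eq_of_lt (splice_lt hM hx), zero_add]
  congr 3
  omega

theorem digit_splice_of_ne {j l M x x' : ℕ} (h : l ≠ j) (hM : M < n ^ j) (hx : x < n)
    (hx' : x' < n) (H : ℕ) : digit n (H * n ^ (j + 1) + M + x * n ^ j) l =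
      digit n (H * n ^ (j + 1) + M + x' * n ^ j) l := by
  rcases lt_or_gt_of_ne h with h | h
  · rw [digit_splice_lt h, digit_splice_lt h]
  · rw [digit_splice_gt h hM hx, digit_splice_gt h hM hx']

theorem splice_lt_pow {a j H M x : ℕ} (hj : j < a) (hH : H < n ^ (a - 1 - j)) (hM : M < n ^ j)
    (hx : x < n) : H * n ^ (j + 1) + M + x * n ^ j < n ^ a := by
  have h₁ := splice_lt hM hx
  have h₂ : (H + 1) * n ^ (j + 1) ≤ n ^ (a - 1 - j) * n ^ (j + 1) := Nat.mul_le_mul_right _ hH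
  rw [← pow_add, show a - 1 - j + (j + 1) = a by omega] at h₂
  linarith

theorem exists_splice {a j X : ℕ} (hj : j < a) (hX : X < n ^ a) :
    ∃ H < n ^ (a - 1 - j), ∃ M < n ^ j, X = H * n ^ (j + 1) + M + (digit n X j : ℕ) * n ^ j := by
  have hn : 0 < n := NeZero.pos n
  refine ⟨X / n ^ (j + 1), ?_, X % n ^ j, Nat.mod_lt _ (pow_pos hn j), ?_⟩
  · rw [Nat.div_lt_iff_lt_mul (pow_pos hn _), ← pow_add, show a - 1 - j + (j + 1) = a by omega]
    exact hX
  · have h₁ := Nat.div_add_mod X (n ^ j)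
    have h₂ := Nat.div_add_mod (X / n ^ j) n
    have h₃ : X / n ^ (j + 1) = X / n ^ j / n := by rw [pow_succ, Nat.div_div_eq_div_mul]
    have h₄ : (digit n X j : ℕ) = X / n ^ j % n := rfl
    rw [h₃, h₄]
    nth_rewrite 1 [← h₁]
    nth_rewrite 1 [← h₂]
    ring

end Digits

/-! ### Atoms as numbers. -/

/-- An atom as a number: the number with the digits `Y, X, i, d, c, b, a, t` in base `q`. -/
def atomCode (q t a b c d i X Y : ℕ) : ℕ :=
  Y + X * q + i * q ^ 2 + d * q ^ 3 + c * q ^ 4 + b * q ^ 5 + a * q ^ 6 + t * q ^ 7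

theorem add_mul_inj {q x y x' y' : ℕ} (hx : x < q) (hx' : x' < q) (h : x + y * q = x' + y' * q) :
    x = x' ∧ y = y' := by
  have hq : 0 < q := by omega
  have h₁ := congrArg (· % q) h
  have h₂ := congrArg (· / q) h
  simp only [Nat.add_mul_mod_self_right, Nat.mod_eq_of_lt hx, Nat.mod_eq_of_lt hx'] at h₁
  simp only [Nat.add_mul_div_right _ _ hq, Nat.div_eq_of_lt hx, Nat.div_eq_of_lt hx'] at h₂
  omega

/-- Digits are read off one by one from the lowest; the tag is the leading one and therefore needs
no bound. -/
theorem atomCode_inj {q t a b c d i X Y t' a' b' c' d' i' X' Y' : ℕ}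
    (ha : a < q) (hb : b < q) (hc : c < q) (hd : d < q) (hi : i < q) (hX : X < q) (hY : Y < q)
    (ha' : a' < q) (hb' : b' < q) (hc' : c' < q) (hd' : d' < q) (hi' : i' < q) (hX' : X' < q)
    (hY' : Y' < q) (h : atomCode q t a b c d i X Y = atomCode q t' a' b' c' d' i' X' Y') :
    t = t' ∧ a = a' ∧ b = b' ∧ c = c' ∧ d = d' ∧ i = i' ∧ X = X' ∧ Y = Y' := by
  have e : ∀ t a b c d i X Y, atomCode q t a b c d i X Y =
      Y + (X + (i + (d + (c + (b + (a + t * q) * q) * q) * q) * q) * q) * q := fun _ _ _ _ _ _ _ _ => by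
    rw [atomCode]; ring
  rw [e, e] at h
  obtain ⟨h₀, h⟩ := add_mul_inj hY hY' h
  obtain ⟨h₁, h⟩ := add_mul_inj hX hX' h
  obtain ⟨h₂, h⟩ := add_mul_inj hi hi' h
  obtain ⟨h₃, h⟩ := add_mul_inj hd hd' h
  obtain ⟨h₄, h⟩ := add_mul_inj hc hc' h
  obtain ⟨h₅, h⟩ := add_mul_inj hb hb' h
  obtain ⟨h₆, h⟩ := add_mul_inj ha ha' h
  exact ⟨h, h₆, h₅, h₄, h₃, h₂, h₁, h₀⟩

/-! ### The clauses. -/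

section Clauses

set_option linter.unusedSectionVars false

open List (range)

variable {n k : ℕ} [NeZero n] (𝔸 : UniversalAlgebra (Fin k) (Fin n))

/-- The arity of the operation with number `f`. -/
def arityNat (f : ℕ) : ℕ := if h : f < k then 𝔸.arity ⟨f, h⟩ else 0

/-- The value of the operation with number `f` at the tuple of digits of `X`. -/
def opNat (f X : ℕ) : ℕ := if h : f < k then 𝔸.op ⟨f, h⟩ fun j => digit n X j else 0

/-- The base in which atoms are written. -/
def base : ℕ := n ^ (𝔸.maxArity + 1)

/-- The code of an atom. -/
def atom (t a b c d i X Y : ℕ) : ℕ := atomCode 𝔸.base t a b c d i X Y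

/-- The clauses for the closure of the relation with tag `t` under the operations; the atoms with
tag `u` stand for tuples of related elements. -/
def closureClauses (t u a b c d : ℕ) : List HornClause :=
  [(0, 0, 𝔸.atom u a b c d 0 0 0)] ++
  (((range 𝔸.maxArity).flatMap fun i => (range (n ^ i)).flatMap fun X =>
    (range (n ^ i)).flatMap fun Y => (range n).flatMap fun x => (range n).flatMap fun y =>
      [(𝔸.atom u a b c d i X Y, 𝔸.atom t a b c d 0 x y,
        𝔸.atom u a b c d (i + 1) (x + X * n) (y + Y * n))]) ++
  ((range k).flatMap fun f => (range (n ^ 𝔸.arityNat f)).flatMap fun X =>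
    (range (n ^ 𝔸.arityNat f)).flatMap fun Y =>
      [(𝔸.atom u a b c d (𝔸.arityNat f) X Y, 0,
        𝔸.atom t a b c d 0 (𝔸.opNat f X) (𝔸.opNat f Y))]))

/-- The clauses for reflexivity, symmetry and transitivity of the relation with tag `t`. -/
def equivClauses (t a b : ℕ) : List HornClause :=
  (range n).flatMap fun x =>
    [(0, 0, 𝔸.atom t a b 0 0 0 x x)] ++
    ((range n).flatMap fun y =>
      [(𝔸.atom t a b 0 0 0 x y, 0, 𝔸.atom t a b 0 0 0 y x)] ++
      ((range n).flatMap fun z =>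
        [(𝔸.atom t a b 0 0 0 x y, 𝔸.atom t a b 0 0 0 y z, 𝔸.atom t a b 0 0 0 x z)]))

/-- The clauses for matrices in `M(θ_ab, θ_ab)`. -/
def matrixClauses (a b : ℕ) : List HornClause :=
  [(0, 0, 𝔸.atom 7 a b a a 0 b b)] ++ ([(0, 0, 𝔸.atom 7 a b b b 0 a a)] ++
  (range k).flatMap fun f => (range (𝔸.arityNat f)).flatMap fun j =>
    (range (n ^ (𝔸.arityNat f - 1 - j))).flatMap fun H =>
    (range (n ^ (𝔸.arityNat f - 1 - j))).flatMap fun H' =>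
    (range (n ^ j)).flatMap fun M => (range (n ^ j)).flatMap fun M' =>
    (range n).flatMap fun x => (range n).flatMap fun y =>
    (range n).flatMap fun x' => (range n).flatMap fun y' =>
      [(𝔸.atom 7 a b x y 0 x' y',
        𝔸.atom 2 a b 0 0 (𝔸.arityNat f) (H * n ^ (j + 1) + M + x * n ^ j)
          (H' * n ^ (j + 1) + M' + y * n ^ j),
        𝔸.atom 7 a b (𝔸.opNat f (H * n ^ (j + 1) + M + x * n ^ j))
          (𝔸.opNat f (H' * n ^ (j + 1) + M' + y * n ^ j)) 0
          (𝔸.opNat f (H * n ^ (j + 1) + M + x' * n ^ j))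
          (𝔸.opNat f (H' * n ^ (j + 1) + M' + y' * n ^ j)))])

/-- The clauses for the term condition of the commutator. -/
def termConditionClauses (a b : ℕ) : List HornClause :=
  (range n).flatMap fun x => (range n).flatMap fun y =>
    (range n).flatMap fun x' => (range n).flatMap fun y' =>
      [(𝔸.atom 3 a b 0 0 0 x y, 𝔸.atom 7 a b x y 0 x' y', 𝔸.atom 3 a b 0 0 0 x' y')]

/-- The clauses for the test at `a`, `b`, `c`, `d`. -/
def testClauses (a b c d : ℕ) : List HornClause :=
  [(0, 0, 𝔸.atom 5 a b c d 0 a c)] ++ ([(0, 0, 𝔸.atom 5 a b c d 0 b c)] ++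
  ([(0, 0, 𝔸.atom 5 a b c d 0 b d)] ++ (𝔸.closureClauses 5 6 a b c d ++
  (range n).flatMap fun x =>
    [(𝔸.atom 5 a b c d 0 x d, 𝔸.atom 3 a b 0 0 0 a x, 𝔸.atom 8 a b c d 0 0 0)])))

/-- The clauses for given `a`, `b`. -/
def pairClauses (a b : ℕ) : List HornClause :=
  𝔸.equivClauses 1 a b ++ ([(0, 0, 𝔸.atom 1 a b 0 0 0 a b)] ++
  (𝔸.closureClauses 1 2 a b 0 0 ++ (𝔸.matrixClauses a b ++
  (𝔸.equivClauses 3 a b ++ (𝔸.closureClauses 3 4 a b 0 0 ++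
  (𝔸.termConditionClauses a b ++
  (range n).flatMap fun c => (range n).flatMap fun d => 𝔸.testClauses a b c d))))))

/-- All clauses. -/
def clauses : List HornClause :=
  (range n).flatMap fun a => (range n).flatMap fun b => 𝔸.pairClauses a b

variable {𝔸}

theorem arityNat_val (f : Fin k) : 𝔸.arityNat f = 𝔸.arity f := by simp [arityNat]

theorem opNat_val (f : Fin k) (X : ℕ) : 𝔸.opNat f X = 𝔸.op f fun j => digit n X j := by
  simp [opNat]

theorem arity_le (f : Fin k) : 𝔸.arity f ≤ 𝔸.maxArity :=
  Finset.le_sup (f := 𝔸.arity) (Finset.mem_univ _)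

theorem arityNat_le (f : ℕ) : 𝔸.arityNat f ≤ 𝔸.maxArity := by
  rw [arityNat]
  split_ifs with h
  · exact Finset.le_sup (f := 𝔸.arity) (Finset.mem_univ _)
  · exact Nat.zero_le _

theorem pow_le_base {i : ℕ} (hi : i ≤ 𝔸.maxArity) : n ^ i ≤ 𝔸.base :=
  Nat.pow_le_pow_right (NeZero.pos n) (by omega)

theorem le_base : n ≤ 𝔸.base := by
  have := Nat.pow_le_pow_right (NeZero.pos n) (show 1 ≤ 𝔸.maxArity + 1 by omega)
  rwa [pow_one] at this

/-- Lengths of tuples are digits of atoms and have to stay below the base. For `n = 1` the base is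
`1`, so this fails as soon as some arity is positive. -/
theorem maxArity_lt_base (hn : 2 ≤ n) : 𝔸.maxArity < 𝔸.base :=
  (Nat.lt_succ_self _).trans (Nat.lt_pow_self hn)

/-! #### Completeness -/

/-- A basic operation, applied to pairs. -/
def opPair (𝔸 : UniversalAlgebra (Fin k) (Fin n)) (f : Fin k)
    (p : Fin (𝔸.arity f) → Fin n × Fin n) : Fin n × Fin n :=
  (𝔸.op f fun j => (p j).1, 𝔸.op f fun j => (p j).2)

section Completeness

variable {L : List HornClause}

/-- Induction on the length: the lowest digit is the entry that is added last, and each entry uses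
one clause with two premises. -/
theorem derivable_tuple {t u a b c d : ℕ} (h : 𝔸.closureClauses t u a b c d ⊆ L) {i : ℕ}
    (hi : i ≤ 𝔸.maxArity) : ∀ {X Y : ℕ}, X < n ^ i → Y < n ^ i →
      (∀ j < i, Derivable L (𝔸.atom t a b c d 0 (digit n X j) (digit n Y j))) →
      Derivable L (𝔸.atom u a b c d i X Y) := by
  have hn : 0 < n := NeZero.pos n
  induction i with
  | zero =>
    intro X Y hX hY _
    rw [pow_zero, Nat.lt_one_iff] at hX hY
    subst hX hY
    exact .mp (h (List.mem_append_left _ (List.mem_singleton_self _))) .zero .zero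
  | succ i ih =>
    intro X Y hX hY hj
    have eX : X % n + X / n * n = X := by rw [mul_comm, Nat.mod_add_div]
    have eY : Y % n + Y / n * n = Y := by rw [mul_comm, Nat.mod_add_div]
    have hX' : X / n < n ^ i := by rwa [Nat.div_lt_iff_lt_mul hn, ← pow_succ]
    have hY' : Y / n < n ^ i := by rwa [Nat.div_lt_iff_lt_mul hn, ← pow_succ]
    have h₁ := ih (by omega) hX' hY' fun j hj' => by
      have := hj (j + 1) (by omega)
      rwa [← eX, ← eY, digit_cons_succ (Nat.mod_lt _ hn), digit_cons_succ (Nat.mod_lt _ hn)] at this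
    have h₂ := hj 0 (by omega)
    have e₀ : ∀ Z, (digit n Z 0 : ℕ) = Z % n := fun Z => by simp [digit, Fin.ofNat]
    rw [e₀, e₀] at h₂
    have hm : (𝔸.atom u a b c d i (X / n) (Y / n), 𝔸.atom t a b c d 0 (X % n) (Y % n),
        𝔸.atom u a b c d (i + 1) X Y) ∈ L := by
      refine h (List.mem_append_right _ (List.mem_append_left _ ?_))
      simp only [List.mem_flatMap, List.mem_range, List.mem_singleton]
      exact ⟨i, by omega, X / n, hX', Y / n, hY', X % n, Nat.mod_lt _ hn, Y % n, Nat.mod_lt _ hn,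
        by rw [eX, eY]⟩
    exact .mp hm h₁ h₂

theorem derivable_opPair {t u a b c d : ℕ} (h : 𝔸.closureClauses t u a b c d ⊆ L) (f : Fin k)
    (p : Fin (𝔸.arity f) → Fin n × Fin n)
    (hp : ∀ j, Derivable L (𝔸.atom t a b c d 0 (p j).1 (p j).2)) :
    Derivable L (𝔸.atom t a b c d 0 (𝔸.opPair f p).1 (𝔸.opPair f p).2) := by
  obtain ⟨X, hX, dX⟩ : ∃ X < n ^ 𝔸.arity f, ∀ j : Fin (𝔸.arity f), digit n X j = (p j).1 :=
    ⟨_, ofDigits_lt fun j => (p j).1, digit_ofDigits _⟩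
  obtain ⟨Y, hY, dY⟩ : ∃ Y < n ^ 𝔸.arity f, ∀ j : Fin (𝔸.arity f), digit n Y j = (p j).2 :=
    ⟨_, ofDigits_lt fun j => (p j).2, digit_ofDigits _⟩
  have h₁ : Derivable L (𝔸.atom u a b c d (𝔸.arity f) X Y) := by
    refine derivable_tuple h (arity_le f) hX hY fun j hj => ?_
    have e₁ := dX ⟨j, hj⟩
    have e₂ := dY ⟨j, hj⟩
    simp only at e₁ e₂
    rw [e₁, e₂]
    exact hp ⟨j, hj⟩
  refine .mp (h ?_) h₁ .zero
  refine List.mem_append_right _ (List.mem_append_right _ ?_)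
  simp only [List.mem_flatMap, List.mem_range, List.mem_singleton]
  refine ⟨f, f.2, X, by rwa [arityNat_val], Y, by rwa [arityNat_val], ?_⟩
  rw [arityNat_val, opNat_val, opNat_val]
  simp only [dX, dY, opPair]

theorem isSubuniverse_derivable {t u a b c d : ℕ} (h : 𝔸.closureClauses t u a b c d ⊆ L) :
    𝔸.sq.IsSubuniverse {p | Derivable L (𝔸.atom t a b c d 0 p.1 p.2)} :=
  fun f p hp => derivable_opPair h f p hp

/-- The equivalence relation that consists of the derivable atoms with tag `t`. -/
def derivableSetoid {t a b : ℕ} (h : 𝔸.equivClauses t a b ⊆ L) : Setoid (Fin n) where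
  r x y := Derivable L (𝔸.atom t a b 0 0 0 x y)
  iseqv :=
    { refl := fun x => by
        refine .mp (h (List.mem_flatMap.2 ⟨x, List.mem_range.2 x.2, ?_⟩)) .zero .zero
        exact List.mem_append_left _ (List.mem_singleton_self _)
      symm := fun {x y} hxy => by
        refine .mp (h (List.mem_flatMap.2 ⟨x, List.mem_range.2 x.2, ?_⟩)) hxy .zero
        refine List.mem_append_right _ (List.mem_flatMap.2 ⟨y, List.mem_range.2 y.2, ?_⟩)
        exact List.mem_append_left _ (List.mem_singleton_self _)
      trans := fun {x y z} hxy hyz => by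
        refine .mp (h (List.mem_flatMap.2 ⟨x, List.mem_range.2 x.2, ?_⟩)) hxy hyz
        refine List.mem_append_right _ (List.mem_flatMap.2 ⟨y, List.mem_range.2 y.2, ?_⟩)
        refine List.mem_append_right _ (List.mem_flatMap.2 ⟨z, List.mem_range.2 z.2, ?_⟩)
        exact List.mem_singleton_self _ }

theorem isCongruence_derivableSetoid {t u a b : ℕ} (h : 𝔸.equivClauses t a b ⊆ L)
    (h' : 𝔸.closureClauses t u a b 0 0 ⊆ L) : 𝔸.IsCongruence (derivableSetoid h) :=
  fun f x y hxy => isSubuniverse_derivable h' f (fun j => (x j, y j)) hxy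

/-- A derivable matrix with rows in the congruence. -/
def MatrixStep (𝔸 : UniversalAlgebra (Fin k) (Fin n)) (L : List HornClause) (a b : ℕ)
    (p q : Fin n × Fin n) : Prop :=
  Derivable L (𝔸.atom 7 a b p.1 p.2 0 q.1 q.2) ∧ Derivable L (𝔸.atom 1 a b 0 0 0 p.1 p.2) ∧
    Derivable L (𝔸.atom 1 a b 0 0 0 q.1 q.2)

variable {a b : ℕ}

/-- Write the two coordinate tuples of `p` in spliced form at position `j`. Replacing the digit
there produces the tuples of the lower row, so a single clause of `matrixClauses` applies. Its
premise on tuples is available because the upper rows lie in the congruence; the lower rows are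
carried along so that a further step can start from them. -/
theorem MatrixStep.op (h : 𝔸.closureClauses 1 2 a b 0 0 ⊆ L) (h' : 𝔸.matrixClauses a b ⊆ L)
    (f : Fin k) (p : Fin (𝔸.arity f) → Fin n × Fin n)
    (hp : ∀ j, Derivable L (𝔸.atom 1 a b 0 0 0 (p j).1 (p j).2)) (j : Fin (𝔸.arity f))
    (q : Fin n × Fin n) (hq : MatrixStep 𝔸 L a b (p j) q) :
    MatrixStep 𝔸 L a b (𝔸.opPair f p) (𝔸.opPair f (Function.update p j q)) := by
  refine ⟨?_, derivable_opPair h f p hp,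
    derivable_opPair h f (Function.update p j q) fun l => ?_⟩
  · obtain ⟨X, hX, dX⟩ : ∃ X < n ^ 𝔸.arity f, ∀ j : Fin (𝔸.arity f), digit n X j = (p j).1 :=
      ⟨_, ofDigits_lt fun j => (p j).1, digit_ofDigits _⟩
    obtain ⟨Y, hY, dY⟩ : ∃ Y < n ^ 𝔸.arity f, ∀ j : Fin (𝔸.arity f), digit n Y j = (p j).2 :=
      ⟨_, ofDigits_lt fun j => (p j).2, digit_ofDigits _⟩
    obtain ⟨H, hH, M, hM, eX⟩ := exists_splice j.2 hX
    obtain ⟨H', hH', M', hM', eY⟩ := exists_splice j.2 hY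
    rw [dX j] at eX
    rw [dY j] at eY
    have h₁ : Derivable L (𝔸.atom 2 a b 0 0 (𝔸.arity f) X Y) :=
      derivable_tuple h (arity_le f) hX hY fun l hl => by
        have e₁ := dX ⟨l, hl⟩
        have e₂ := dY ⟨l, hl⟩
        simp only at e₁ e₂
        rw [e₁, e₂]
        exact hp ⟨l, hl⟩
    have hm : (𝔸.atom 7 a b (p j).1 (p j).2 0 q.1 q.2, 𝔸.atom 2 a b 0 0 (𝔸.arity f) X Y,
        𝔸.atom 7 a b (𝔸.opPair f p).1 (𝔸.opPair f p).2 0 (𝔸.opPair f (Function.update p j q)).1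
          (𝔸.opPair f (Function.update p j q)).2) ∈ L := by
      refine h' (List.mem_append_right _ (List.mem_append_right _ ?_))
      simp only [List.mem_flatMap, List.mem_range, List.mem_singleton]
      refine ⟨f, f.2, j, by rw [arityNat_val]; exact j.2, H, by rwa [arityNat_val], H',
        by rwa [arityNat_val], M, hM, M', hM', (p j).1, (p j).1.2, (p j).2, (p j).2.2, q.1, q.1.2,
        q.2, q.2.2, ?_⟩
      have u₁ : (fun l : Fin (𝔸.arity f) => digit n (H * n ^ ((j : ℕ) + 1) + M + q.1 * n ^ (j : ℕ))
          l) = fun l => (Function.update p j q l).1 := by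
        funext l
        by_cases hl : l = j
        · subst hl; rw [digit_splice_self hM, ofNat_val, Function.update_self]
        · rw [digit_splice_of_ne (fun e => hl (Fin.ext e)) hM q.1.2 (p j).1.2, ← eX, dX,
            Function.update_of_ne hl]
      have u₂ : (fun l : Fin (𝔸.arity f) => digit n (H' * n ^ ((j : ℕ) + 1) + M' + q.2 * n ^ (j : ℕ))
          l) = fun l => (Function.update p j q l).2 := by
        funext l
        by_cases hl : l = j
        · subst hl; rw [digit_splice_self hM', ofNat_val, Function.update_self]
        · rw [digit_splice_of_ne (fun e => hl (Fin.ext e)) hM' q.2.2 (p j).2.2, ← eY, dY,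
            Function.update_of_ne hl]
      rw [← eX, ← eY, arityNat_val, opNat_val, opNat_val, opNat_val, opNat_val, u₁, u₂]
      simp only [dX, dY, opPair]
    exact .mp hm hq.1 h₁
  · by_cases hl : l = j
    · subst hl; rw [Function.update_self]; exact hq.2.2
    · rw [Function.update_of_ne hl]; exact hp l

open Relation (ReflTransGen)

theorem derivable_of_chain {p q : Fin n × Fin n} (h : ReflTransGen (MatrixStep 𝔸 L a b) p q)
    (hp : Derivable L (𝔸.atom 1 a b 0 0 0 p.1 p.2)) :
    Derivable L (𝔸.atom 1 a b 0 0 0 q.1 q.2) := by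
  induction h with
  | refl => exact hp
  | tail _ h _ => exact h.2.2

theorem chain_update (h : 𝔸.closureClauses 1 2 a b 0 0 ⊆ L) (h' : 𝔸.matrixClauses a b ⊆ L)
    (f : Fin k) (p : Fin (𝔸.arity f) → Fin n × Fin n)
    (hp : ∀ j, Derivable L (𝔸.atom 1 a b 0 0 0 (p j).1 (p j).2)) (j : Fin (𝔸.arity f))
    {q : Fin n × Fin n} (hq : ReflTransGen (MatrixStep 𝔸 L a b) (p j) q) :
    ReflTransGen (MatrixStep 𝔸 L a b) (𝔸.opPair f p) (𝔸.opPair f (Function.update p j q)) := by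
  induction hq with
  | refl => rw [Function.update_eq_self]
  | @tail r q hr hrq ih =>
    refine ih.tail ?_
    have := MatrixStep.op h h' f (Function.update p j r) (fun l => ?_) j q (by simpa using hrq)
    · rwa [Function.update_idem] at this
    · by_cases hl : l = j
      · subst hl; rw [Function.update_self]; exact derivable_of_chain hr (hp l)
      · rw [Function.update_of_ne hl]; exact hp l

/-- Arguments are changed one at a time, so that moving along all chains at once becomes a
concatenation of chains that each move in a single argument. -/
theorem chain_op (h : 𝔸.closureClauses 1 2 a b 0 0 ⊆ L) (h' : 𝔸.matrixClauses a b ⊆ L)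
    (f : Fin k) (p q : Fin (𝔸.arity f) → Fin n × Fin n)
    (hp : ∀ j, Derivable L (𝔸.atom 1 a b 0 0 0 (p j).1 (p j).2))
    (hpq : ∀ j, ReflTransGen (MatrixStep 𝔸 L a b) (p j) (q j)) :
    ReflTransGen (MatrixStep 𝔸 L a b) (𝔸.opPair f p) (𝔸.opPair f q) := by
  suffices H : ∀ S : Finset (Fin (𝔸.arity f)), ReflTransGen (MatrixStep 𝔸 L a b) (𝔸.opPair f p)
      (𝔸.opPair f (S.piecewise q p)) by
    simpa using H Finset.univ
  intro S
  induction S using Finset.induction_on with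
  | empty => simpa using ReflTransGen.refl
  | insert j S hj ih =>
    refine ih.trans ?_
    rw [Finset.piecewise_insert]
    refine chain_update h h' f _ (fun l => ?_) j ?_
    · by_cases hl : l ∈ S
      · rw [Finset.piecewise_eq_of_mem _ _ _ hl]; exact derivable_of_chain (hpq l) (hp l)
      · rw [Finset.piecewise_eq_of_notMem _ _ _ hl]; exact hp l
    · rw [Finset.piecewise_eq_of_notMem _ _ _ hj]; exact hpq j

end Completeness

theorem pairClauses_subset {a b : ℕ} (ha : a < n) (hb : b < n) : 𝔸.pairClauses a b ⊆ 𝔸.clauses :=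
  fun _ hx => List.mem_flatMap.2 ⟨a, List.mem_range.2 ha,
    List.mem_flatMap.2 ⟨b, List.mem_range.2 hb, hx⟩⟩

section

variable (a b : Fin n)

theorem pairClauses_parts : 𝔸.equivClauses 1 a b ⊆ 𝔸.clauses ∧
    (0, 0, 𝔸.atom 1 a b 0 0 0 a b) ∈ 𝔸.clauses ∧ 𝔸.closureClauses 1 2 a b 0 0 ⊆ 𝔸.clauses ∧
    𝔸.matrixClauses a b ⊆ 𝔸.clauses ∧ 𝔸.equivClauses 3 a b ⊆ 𝔸.clauses ∧
    𝔸.closureClauses 3 4 a b 0 0 ⊆ 𝔸.clauses ∧ 𝔸.termConditionClauses a b ⊆ 𝔸.clauses ∧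
    ∀ c d : Fin n, 𝔸.testClauses a b c d ⊆ 𝔸.clauses := by
  have h := pairClauses_subset (𝔸 := 𝔸) a.2 b.2
  rw [pairClauses] at h
  simp only [List.append_subset, List.cons_subset, List.nil_subset, and_true] at h
  refine ⟨h.1, h.2.1, h.2.2.1, h.2.2.2.1, h.2.2.2.2.1, h.2.2.2.2.2.1, h.2.2.2.2.2.2.1,
    fun c d x hx => h.2.2.2.2.2.2.2 ?_⟩
  exact List.mem_flatMap.2 ⟨c, List.mem_range.2 c.2, List.mem_flatMap.2 ⟨d, List.mem_range.2 d.2,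
    hx⟩⟩

theorem derivable_of_Cg {x y : Fin n} (h : 𝔸.Cg a b x y) :
    Derivable 𝔸.clauses (𝔸.atom 1 a b 0 0 0 x y) := by
  obtain ⟨h₁, h₂, h₃, -⟩ := pairClauses_parts (𝔸 := 𝔸) a b
  exact Cg_le (isCongruence_derivableSetoid h₁ h₃) (show derivableSetoid h₁ a b from
    .mp h₂ .zero .zero) h

-- The pairs of rows that are joined by a chain and start in the congruence form a subuniverse, by
-- `chain_op`. A generator with two equal rows has the empty chain. For a generator with rows `(x,
-- x)`, `(x', x')` a chain exists because chains between diagonal rows define a congruence that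
-- contains `(a, b)`.
open Relation (ReflTransGen) in
theorem chain_of_matrices {p : (Fin n × Fin n) × (Fin n × Fin n)}
    (h : p ∈ 𝔸.matrices (𝔸.Cg a b) (𝔸.Cg a b)) :
    Derivable 𝔸.clauses (𝔸.atom 1 a b 0 0 0 p.1.1 p.1.2) ∧
      ReflTransGen (MatrixStep 𝔸 𝔸.clauses a b) p.1 p.2 := by
  obtain ⟨h₁, h₂, h₃, h₄, -⟩ := pairClauses_parts (𝔸 := 𝔸) a b
  have hr : ∀ x : Fin n, Derivable 𝔸.clauses (𝔸.atom 1 a b 0 0 0 x x) :=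
    fun x => (derivableSetoid h₁).refl' x
  -- Steps are directed, so symmetry is built in by asking for chains both ways; this is why both
  -- `(a, a), (b, b)` and its reverse are among the clauses.
  let ψ : Setoid (Fin n) :=
    { r := fun x y => ReflTransGen (MatrixStep 𝔸 𝔸.clauses a b) (x, x) (y, y) ∧
        ReflTransGen (MatrixStep 𝔸 𝔸.clauses a b) (y, y) (x, x)
      iseqv := ⟨fun x => ⟨.refl, .refl⟩, fun h => ⟨h.2, h.1⟩,
        fun h h' => ⟨h.1.trans h'.1, h'.2.trans h.2⟩⟩ }
  have hψ : 𝔸.IsCongruence ψ := fun f x y hxy =>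
    ⟨chain_op h₃ h₄ f (fun j => (x j, x j)) (fun j => (y j, y j)) (fun j => hr (x j))
      fun j => (hxy j).1,
     chain_op h₃ h₄ f (fun j => (y j, y j)) (fun j => (x j, x j)) (fun j => hr (y j))
      fun j => (hxy j).2⟩
  have hψab : ψ a b := by
    refine ⟨.single ⟨?_, hr a, hr b⟩, .single ⟨?_, hr b, hr a⟩⟩
    · exact .mp (h₄ (List.mem_append_left _ (List.mem_singleton_self _))) .zero .zero
    · exact .mp (h₄ (List.mem_append_right _ (List.mem_append_left _
        (List.mem_singleton_self _)))) .zero .zero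
  refine Sg_subset (𝔸 := 𝔸.sq.sq) (S := {p | Derivable 𝔸.clauses (𝔸.atom 1 a b 0 0 0 p.1.1 p.1.2) ∧
      ReflTransGen (MatrixStep 𝔸 𝔸.clauses a b) p.1 p.2}) ?_ ?_ h
  · rintro p (⟨x, x', hx, rfl⟩ | ⟨x, x', hx, rfl⟩)
    · exact ⟨hr x, (Cg_le hψ hψab hx).1⟩
    · exact ⟨derivable_of_Cg a b hx, .refl⟩
  · intro f p hp
    exact ⟨derivable_opPair h₃ f (fun j => (p j).1) fun j => (hp j).1,
      chain_op h₃ h₄ f (fun j => (p j).1) (fun j => (p j).2) (fun j => (hp j).1) fun j => (hp j).2⟩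

/-- The clauses state the term condition only for single steps, but relatedness is handed down a
chain from row to row. The derivable relation thus satisfies the full term condition and contains
the least congruence that does. -/
theorem derivable_of_commutator {x y : Fin n} (h : 𝔸.commutator (𝔸.Cg a b) (𝔸.Cg a b) x y) :
    Derivable 𝔸.clauses (𝔸.atom 3 a b 0 0 0 x y) := by
  obtain ⟨-, -, -, -, h₅, h₆, h₇, -⟩ := pairClauses_parts (𝔸 := 𝔸) a b
  refine commutator_le (isCongruence_derivableSetoid h₅ h₆) ?_ h
  intro x y u v hm hxy
  have := (chain_of_matrices a b hm).2
  change Derivable 𝔸.clauses (𝔸.atom 3 a b 0 0 0 u v)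
  suffices H : ∀ q : Fin n × Fin n, Relation.ReflTransGen (MatrixStep 𝔸 𝔸.clauses a b) (x, y) q →
      Derivable 𝔸.clauses (𝔸.atom 3 a b 0 0 0 q.1 q.2) from H _ this
  intro q hq
  induction hq with
  | refl => exact hxy
  | @tail r q _ hrq ih =>
    refine .mp (h₇ ?_) ih hrq.1
    simp only [termConditionClauses, List.mem_flatMap, List.mem_range, List.mem_singleton]
    exact ⟨r.1, r.1.2, r.2, r.2.2, q.1, q.1.2, q.2, q.2.2, rfl⟩

theorem derivable_of_test (c d : Fin n)
    (h : (𝔸.sq.Sg {(a, c), (b, c), (b, d)} ∩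
      {x | 𝔸.commutator (𝔸.Cg a b) (𝔸.Cg a b) a x} ×ˢ {d}).Nonempty) :
    Derivable 𝔸.clauses (𝔸.atom 8 a b c d 0 0 0) := by
  obtain ⟨⟨x, y⟩, hS, hx, hy⟩ := h
  obtain rfl : y = d := hy
  obtain ⟨-, -, -, -, -, -, -, h₈⟩ := pairClauses_parts (𝔸 := 𝔸) a b
  have h₉ := h₈ c y
  rw [testClauses] at h₉
  simp only [List.append_subset, List.cons_subset, List.nil_subset, and_true] at h₉
  obtain ⟨f₁, f₂, f₃, hcl, hQ⟩ := h₉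
  have h₁₀ : Derivable 𝔸.clauses (𝔸.atom 5 a b c y 0 x y) := by
    have hsub := isSubuniverse_derivable hcl
    refine Sg_subset ?_ hsub hS
    simp only [Set.insert_subset_iff, Set.singleton_subset_iff, Set.mem_ofPred_eq]
    refine ⟨?_, ?_, ?_⟩
    · exact .mp f₁ .zero .zero
    · exact .mp f₂ .zero .zero
    · exact .mp f₃ .zero .zero
  exact .mp (hQ (List.mem_flatMap.2 ⟨x, List.mem_range.2 x.2, List.mem_singleton_self _⟩)) h₁₀
    (derivable_of_commutator a b hx)

end

end Clauses
end UniversalAlgebra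

namespace UniversalAlgebra
section Clauses

set_option linter.unusedSectionVars false

open List (range)

variable {n k : ℕ} [NeZero n] {𝔸 : UniversalAlgebra (Fin k) (Fin n)}

/-! #### Soundness -/

/-- The test at `a`, `b`, `c`, `d`. -/
def TestAt (𝔸 : UniversalAlgebra (Fin k) (Fin n)) (a b c d : Fin n) : Prop :=
  (𝔸.sq.Sg {(a, c), (b, c), (b, d)} ∩
    {x | 𝔸.commutator (𝔸.Cg a b) (𝔸.Cg a b) a x} ×ˢ {d}).Nonempty

/-- The meaning of the atom with the given tag and arguments. -/
def Meaning (𝔸 : UniversalAlgebra (Fin k) (Fin n)) (t : ℕ) (a b c d : Fin n) (i X Y : ℕ) : Prop :=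
  match t with
  | 1 => 𝔸.Cg a b (Fin.ofNat n X) (Fin.ofNat n Y)
  | 2 => ∀ j < i, 𝔸.Cg a b (digit n X j) (digit n Y j)
  | 3 => 𝔸.commutator (𝔸.Cg a b) (𝔸.Cg a b) (Fin.ofNat n X) (Fin.ofNat n Y)
  | 4 => ∀ j < i, 𝔸.commutator (𝔸.Cg a b) (𝔸.Cg a b) (digit n X j) (digit n Y j)
  | 5 => (Fin.ofNat n X, Fin.ofNat n Y) ∈ 𝔸.sq.Sg {(a, c), (b, c), (b, d)}
  | 6 => ∀ j < i, (digit n X j, digit n Y j) ∈ 𝔸.sq.Sg {(a, c), (b, c), (b, d)}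
  | 7 => ((c, d), (Fin.ofNat n X, Fin.ofNat n Y)) ∈ 𝔸.matrices (𝔸.Cg a b) (𝔸.Cg a b)
  | 8 => 𝔸.TestAt a b c d
  | _ => True

/-- A number that is not the code of a false atom. -/
def IsTrue (𝔸 : UniversalAlgebra (Fin k) (Fin n)) (e : ℕ) : Prop :=
  ∀ t a b c d i X Y, a < 𝔸.base → b < 𝔸.base → c < 𝔸.base → d < 𝔸.base → i < 𝔸.base →
    X < 𝔸.base → Y < 𝔸.base → e = 𝔸.atom t a b c d i X Y →
      𝔸.Meaning t (Fin.ofNat n a) (Fin.ofNat n b) (Fin.ofNat n c) (Fin.ofNat n d) i X Y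

/-- Within the bounds on the digits a number codes only one atom, so quantifying over all decodings
says no more than the meaning of this one. -/
theorem isTrue_atom {t a b c d i X Y : ℕ} (ha : a < 𝔸.base) (hb : b < 𝔸.base) (hc : c < 𝔸.base)
    (hd : d < 𝔸.base) (hi : i < 𝔸.base) (hX : X < 𝔸.base) (hY : Y < 𝔸.base) :
    𝔸.IsTrue (𝔸.atom t a b c d i X Y) ↔
      𝔸.Meaning t (Fin.ofNat n a) (Fin.ofNat n b) (Fin.ofNat n c) (Fin.ofNat n d) i X Y := by
  constructor
  · exact fun h => h _ _ _ _ _ _ _ _ ha hb hc hd hi hX hY rfl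
  · intro h t' a' b' c' d' i' X' Y' ha' hb' hc' hd' hi' hX' hY' e
    obtain ⟨rfl, rfl, rfl, rfl, rfl, rfl, rfl, rfl⟩ :=
      atomCode_inj ha hb hc hd hi hX hY ha' hb' hc' hd' hi' hX' hY' e
    exact h

theorem base_pos : 0 < 𝔸.base := pow_pos (NeZero.pos n) _

/-- The number `0` codes an atom with tag `0`, whose meaning is `True`; it can therefore fill an
unused premise. -/
theorem isTrue_zero : 𝔸.IsTrue 0 := by
  have h := base_pos (𝔸 := 𝔸)
  have e : (0 : ℕ) = 𝔸.atom 0 0 0 0 0 0 0 0 := by simp [atom, atomCode]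
  rw [e, isTrue_atom h h h h h h h]
  trivial

theorem isTrue_elem {t : ℕ} (a b c d x y : Fin n) :
    𝔸.IsTrue (𝔸.atom t a b c d 0 x y) ↔ 𝔸.Meaning t a b c d 0 x y := by
  have h : ∀ z : Fin n, (z : ℕ) < 𝔸.base := fun z => z.2.trans_le le_base
  rw [isTrue_atom (h _) (h _) (h _) (h _) base_pos (h _) (h _)]
  simp only [ofNat_val]

theorem isTrue_tuple (hn : 2 ≤ n) {t i X Y : ℕ} (a b c d : Fin n) (hi : i ≤ 𝔸.maxArity)
    (hX : X < n ^ i) (hY : Y < n ^ i) :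
    𝔸.IsTrue (𝔸.atom t a b c d i X Y) ↔ 𝔸.Meaning t a b c d i X Y := by
  have h : ∀ z : Fin n, (z : ℕ) < 𝔸.base := fun z => z.2.trans_le le_base
  have hp := pow_le_base hi
  rw [isTrue_atom (h _) (h _) (h _) (h _) (by have := maxArity_lt_base (𝔸 := 𝔸) hn; omega)
    (hX.trans_le hp) (hY.trans_le hp)]
  simp only [ofNat_val]

/-- The clauses in `L` preserve truth. -/
def IsSound (𝔸 : UniversalAlgebra (Fin k) (Fin n)) (L : List HornClause) : Prop :=
  ∀ c ∈ L, 𝔸.IsTrue c.1 → 𝔸.IsTrue c.2.1 → 𝔸.IsTrue c.2.2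

theorem isSound_append {L L' : List HornClause} (h : 𝔸.IsSound L) (h' : 𝔸.IsSound L') :
    𝔸.IsSound (L ++ L') := fun c hc => (List.mem_append.1 hc).elim (h c) (h' c)

theorem isSound_flatMap {m : ℕ} {L : ℕ → List HornClause} (h : ∀ i < m, 𝔸.IsSound (L i)) :
    𝔸.IsSound ((range m).flatMap L) := fun c hc => by
  obtain ⟨i, hi, hc⟩ := List.mem_flatMap.1 hc
  exact h i (List.mem_range.1 hi) c hc

theorem isSound_flatMap_fin {m : ℕ} {L : ℕ → List HornClause} (h : ∀ i : Fin m, 𝔸.IsSound (L i)) :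
    𝔸.IsSound ((range m).flatMap L) := isSound_flatMap fun i hi => h ⟨i, hi⟩

theorem isSound_singleton {p q r : ℕ} (h : 𝔸.IsTrue p → 𝔸.IsTrue q → 𝔸.IsTrue r) :
    𝔸.IsSound [(p, q, r)] := fun c hc => by
  obtain rfl := List.mem_singleton.1 hc
  exact h

theorem isTrue_of_derivable {L : List HornClause} (hL : 𝔸.IsSound L) {e : ℕ}
    (h : Derivable L e) : 𝔸.IsTrue e := by
  induction h with
  | zero => exact isTrue_zero
  | mp h _ _ hp hq => exact hL _ h hp hq

/-- Stated for an arbitrary compatible relation `R`, to be used for the principal congruence, its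
commutator and the generated subuniverse of the square. -/
theorem isSound_closureClauses (hn : 2 ≤ n) {t u : ℕ} {a b c d : Fin n}
    {R : Set (Fin n × Fin n)} (hR : 𝔸.sq.IsSubuniverse R)
    (ht : ∀ X Y, 𝔸.Meaning t a b c d 0 X Y ↔ (Fin.ofNat n X, Fin.ofNat n Y) ∈ R)
    (hu : ∀ i X Y, 𝔸.Meaning u a b c d i X Y ↔ ∀ j < i, (digit n X j, digit n Y j) ∈ R) :
    𝔸.IsSound (𝔸.closureClauses t u a b c d) := by
  refine isSound_append (isSound_singleton fun _ _ => ?_) (isSound_append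
    (isSound_flatMap fun i hi => isSound_flatMap fun X hX => isSound_flatMap fun Y hY =>
      isSound_flatMap_fin fun x => isSound_flatMap_fin fun y => isSound_singleton ?_)
    (isSound_flatMap_fin fun f => isSound_flatMap fun X hX => isSound_flatMap fun Y hY =>
      isSound_singleton ?_))
  · rw [isTrue_tuple hn a b c d (Nat.zero_le _) (by simp) (by simp), hu]
    simp
  · have hlt : ∀ {X : ℕ} (x : Fin n), X < n ^ i → x + X * n < n ^ (i + 1) := fun {X} x h => by
      have : (X + 1) * n ≤ n ^ i * n := Nat.mul_le_mul_right _ h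
      have := x.2
      rw [pow_succ]
      linarith
    rw [isTrue_tuple hn a b c d hi.le hX hY, isTrue_elem,
      isTrue_tuple hn a b c d hi (hlt x hX) (hlt y hY), hu, hu, ht]
    intro h₁ h₂ j hj
    cases j with
    | zero => rwa [digit_cons_zero, digit_cons_zero]
    | succ j =>
      rw [digit_cons_succ x.2, digit_cons_succ y.2]
      exact h₁ j (by omega)
  · rw [isTrue_tuple hn a b c d (arityNat_le _) hX hY, opNat_val, opNat_val, isTrue_elem, hu, ht]
    intro h₁ _
    rw [ofNat_val, ofNat_val]
    exact hR f (fun j => (digit n X j, digit n Y j)) fun j => h₁ j (by rw [arityNat_val]; exact j.2)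

theorem isSound_equivClauses {t : ℕ} {a b : Fin n} {R : Setoid (Fin n)}
    (ht : ∀ x y : Fin n, 𝔸.Meaning t a b 0 0 0 x y ↔ R x y) :
    𝔸.IsSound (𝔸.equivClauses t a b) := by
  have e : ∀ x y : Fin n, 𝔸.IsTrue (𝔸.atom t a b 0 0 0 x y) ↔ R x y := fun x y => by
    rw [← ht, ← isTrue_elem]; simp
  refine isSound_flatMap_fin fun x => isSound_append (isSound_singleton fun _ _ => ?_)
    (isSound_flatMap_fin fun y => isSound_append (isSound_singleton ?_)
    (isSound_flatMap_fin fun z => isSound_singleton ?_))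
  · exact (e x x).2 (R.refl' x)
  · rw [e, e]; exact fun h _ => R.symm' h
  · rw [e, e, e]; exact R.trans'

/-- The new matrix is an operation applied to a matrix in `M(θ, θ)` at position `j` and to
generators with two equal rows elsewhere. -/
theorem isSound_matrixClauses (hn : 2 ≤ n) (a b : Fin n) : 𝔸.IsSound (𝔸.matrixClauses a b) := by
  have e₀ : ∀ x : Fin n, Fin.ofNat n x = x := ofNat_val
  refine isSound_append (isSound_singleton fun _ _ => ?_) (isSound_append
    (isSound_singleton fun _ _ => ?_) (isSound_flatMap_fin fun f => isSound_flatMap fun j hj =>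
      isSound_flatMap fun H hH => isSound_flatMap fun H' hH' => isSound_flatMap fun M hM =>
      isSound_flatMap fun M' hM' => isSound_flatMap_fin fun x => isSound_flatMap_fin fun y =>
      isSound_flatMap_fin fun x' => isSound_flatMap_fin fun y' => isSound_singleton ?_))
  · rw [isTrue_elem]
    refine subset_Sg _ (Or.inl ⟨a, b, Cg_self a b, ?_⟩)
    rw [e₀]
  · rw [isTrue_elem]
    refine subset_Sg _ (Or.inl ⟨b, a, (𝔸.Cg a b).symm' (Cg_self a b), ?_⟩)
    rw [e₀]
  · have e₂ : ∀ X Y, X < n ^ 𝔸.arityNat f → Y < n ^ 𝔸.arityNat f →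
        (𝔸.IsTrue (𝔸.atom 2 a b 0 0 (𝔸.arityNat f) X Y) ↔
          ∀ j < 𝔸.arity f, 𝔸.Cg a b (digit n X j) (digit n Y j)) := fun X Y hX hY => by
      have := isTrue_tuple (𝔸 := 𝔸) (t := 2) hn a b 0 0 (arityNat_le f) hX hY
      simpa [Meaning, arityNat_val] using this
    rw [e₂ _ _ (splice_lt_pow hj hH hM x.2) (splice_lt_pow hj hH' hM' y.2), opNat_val, opNat_val,
      opNat_val, opNat_val, isTrue_elem, isTrue_elem]
    simp only [Meaning, e₀]
    intro h₁ h₂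
    refine isSubuniverse_Sg (𝔸 := 𝔸.sq.sq) _ f (fun l : Fin (𝔸.arity f) =>
      ((digit n (H * n ^ (j + 1) + M + x * n ^ j) l,
        digit n (H' * n ^ (j + 1) + M' + y * n ^ j) l),
       (digit n (H * n ^ (j + 1) + M + x' * n ^ j) l,
        digit n (H' * n ^ (j + 1) + M' + y' * n ^ j) l))) fun l => ?_
    change Fin (𝔸.arity f) at l
    by_cases hl : (l : ℕ) = j
    · simp only [hl, digit_splice_self hM, digit_splice_self hM', e₀]
      exact h₁
    · have hl' := h₂ l l.2
      simp only [digit_splice_of_ne hl hM x'.2 x.2, digit_splice_of_ne hl hM' y'.2 y.2]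
      exact subset_Sg _ (Or.inr ⟨_, _, hl', rfl⟩)

theorem isSound_termConditionClauses (a b : Fin n) :
    𝔸.IsSound (𝔸.termConditionClauses a b) := by
  refine isSound_flatMap_fin fun x => isSound_flatMap_fin fun y => isSound_flatMap_fin fun x' =>
    isSound_flatMap_fin fun y' => isSound_singleton ?_
  have e : ∀ x y : Fin n, 𝔸.IsTrue (𝔸.atom 3 a b 0 0 0 x y) ↔
      𝔸.commutator (𝔸.Cg a b) (𝔸.Cg a b) x y := fun x y => by
    have := isTrue_elem (𝔸 := 𝔸) (t := 3) a b 0 0 x y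
    simpa [Meaning, ofNat_val] using this
  rw [e, e, isTrue_elem]
  simp only [Meaning, ofNat_val]
  exact fun h h' => centralizes_commutator _ _ _ _ _ _ h' h

theorem isSound_testClauses (hn : 2 ≤ n) (a b c d : Fin n) :
    𝔸.IsSound (𝔸.testClauses a b c d) := by
  have e₃ : ∀ x y : Fin n, 𝔸.IsTrue (𝔸.atom 3 a b 0 0 0 x y) ↔
      𝔸.commutator (𝔸.Cg a b) (𝔸.Cg a b) x y := fun x y => by
    have := isTrue_elem (𝔸 := 𝔸) (t := 3) a b 0 0 x y
    simpa [Meaning, ofNat_val] using this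
  have e₅ : ∀ x y : Fin n, 𝔸.IsTrue (𝔸.atom 5 a b c d 0 x y) ↔
      (x, y) ∈ 𝔸.sq.Sg {(a, c), (b, c), (b, d)} := fun x y => by
    rw [isTrue_elem]; simp only [Meaning, ofNat_val]
  have e₈ : 𝔸.IsTrue (𝔸.atom 8 a b c d 0 0 0) ↔ 𝔸.TestAt a b c d := by
    have := isTrue_elem (𝔸 := 𝔸) (t := 8) a b c d 0 0
    simpa [Meaning] using this
  refine isSound_append (isSound_singleton fun _ _ => ?_) (isSound_append
    (isSound_singleton fun _ _ => ?_) (isSound_append (isSound_singleton fun _ _ => ?_)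
    (isSound_append ?_ (isSound_flatMap_fin fun x => isSound_singleton ?_))))
  · rw [e₅]; exact subset_Sg _ (by simp)
  · rw [e₅]; exact subset_Sg _ (by simp)
  · rw [e₅]; exact subset_Sg _ (by simp)
  · exact isSound_closureClauses hn (isSubuniverse_Sg _) (fun _ _ => Iff.rfl) fun _ _ _ => Iff.rfl
  · rw [e₃, e₅, e₈]
    exact fun h h' => ⟨(x, d), h, h', rfl⟩

theorem isSound_clauses (hn : 2 ≤ n) : 𝔸.IsSound 𝔸.clauses := by
  refine isSound_flatMap_fin fun a => isSound_flatMap_fin fun b => ?_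
  have e : ((0 : Fin n) : ℕ) = 0 := rfl
  have h₁ := isSound_equivClauses (𝔸 := 𝔸) (t := 1) (a := a) (b := b) (R := 𝔸.Cg a b)
    fun x y => by simp only [Meaning, ofNat_val]
  have h₂ := isSound_closureClauses (𝔸 := 𝔸) hn (t := 1) (u := 2) (a := a) (b := b) (c := 0)
    (d := 0) (R := {p | 𝔸.Cg a b p.1 p.2}) (fun f p hp => isCongruence_Cg a b f _ _ hp)
    (fun _ _ => Iff.rfl) fun _ _ _ => Iff.rfl
  have h₃ := isSound_equivClauses (𝔸 := 𝔸) (t := 3) (a := a) (b := b)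
    (R := 𝔸.commutator (𝔸.Cg a b) (𝔸.Cg a b)) fun x y => by simp only [Meaning, ofNat_val]
  have h₄ := isSound_closureClauses (𝔸 := 𝔸) hn (t := 3) (u := 4) (a := a) (b := b) (c := 0)
    (d := 0) (R := {p | 𝔸.commutator (𝔸.Cg a b) (𝔸.Cg a b) p.1 p.2})
    (fun f p hp => isCongruence_commutator _ _ f _ _ hp) (fun _ _ => Iff.rfl)
    fun _ _ _ => Iff.rfl
  refine isSound_append h₁ (isSound_append (isSound_singleton fun _ _ => ?_) (isSound_append h₂
    (isSound_append (isSound_matrixClauses hn a b) (isSound_append h₃ (isSound_append h₄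
    (isSound_append (isSound_termConditionClauses a b) (isSound_flatMap_fin fun c =>
    isSound_flatMap_fin fun d => isSound_testClauses hn a b c d)))))))
  have := isTrue_elem (𝔸 := 𝔸) (t := 1) a b 0 0 a b
  rw [e] at this
  rw [this]
  simp only [Meaning, ofNat_val]
  exact Cg_self a b

/-- Derivable atoms yield closed relations, which contain the least ones; conversely, the intended
meanings form a model of the clauses, so nothing false is derived. -/
theorem passesLocalTest_iff (hn : 2 ≤ n) : 𝔸.PassesLocalTest ↔
    ∀ a b c d : Fin n, Derivable 𝔸.clauses (𝔸.atom 8 a b c d 0 0 0) := by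
  constructor
  · exact fun h a b c d => derivable_of_test a b c d (h a b c d)
  · intro h a b c d
    have h₁ := isTrue_of_derivable (isSound_clauses hn) (h a b c d)
    have h₂ := isTrue_elem (𝔸 := 𝔸) (t := 8) a b c d 0 0
    exact h₂.1 h₁

end Clauses
end UniversalAlgebra

namespace LoopLang

set_option linter.unusedSectionVars false

open UniversalAlgebra
open List (range)

/-! ### Emission of the clauses -/

/-- The array of the multiples of the power `s + 1` of the base. -/
def mulArr (s : ℕ) : Fin 31 := Fin.ofNat 31 (s + 3)

/-- The counter of the loop that is `l` levels further out. -/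
def cnt (l : ℕ) : Expr := .var (4 * l)

/-- The accumulator of the loop that is `l` levels further out. -/
def acc (l : ℕ) : Expr := .var (4 * l + 1)

/-- The number of elements. -/
def sizeE : Expr := .inp (.lit 0)

/-- The number of operations. -/
def opsE : Expr := .inp (.lit 1)

/-- The arity of an operation. -/
def arityE (f : Expr) : Expr := .inp (.add (.lit 2) f)

/-- The power of the number of elements with exponent `e`. -/
def powE (e : Expr) : Expr := .arr Arr.pow e

/-- The entry of the table of an operation at position `X`. -/
def valueE (f X : Expr) : Expr := .inp (.add (.arr Arr.tab f) X)

/-- The code of an atom. -/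
def atomE (t : ℕ) (a b c d i X Y : Expr) : Expr :=
  .add (.add (.add (.add (.add (.add (.add Y (.arr (mulArr 0) X)) (.arr (mulArr 1) i))
    (.arr (mulArr 2) d)) (.arr (mulArr 3) c)) (.arr (mulArr 4) b)) (.arr (mulArr 5) a))
    (.arr (mulArr 6) (.lit t))

/-- A loop with the bound `m`. -/
def loop (m : Expr) (c : Cmd) : Cmd := .loop (.lit 0) m (.lit 0) c

/-- A loop over all elements. -/
def loopN (c : Cmd) : Cmd := loop sizeE c

variable {n k : ℕ} [NeZero n] {𝔸 : UniversalAlgebra (Fin k) (Fin n)}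

/-- The auxiliary tables for `𝔸`. -/
structure Tables (𝔸 : UniversalAlgebra (Fin k) (Fin n)) (σ : Store) : Prop where
  top : σ Arr.top 0 = 𝔸.maxArity
  pow : ∀ i ≤ 𝔸.maxArity + 1, σ Arr.pow i = n ^ i
  mul : ∀ s < 7, ∀ x < 𝔸.base + 9, σ (mulArr s) x = x * 𝔸.base ^ (s + 1)
  tab : ∀ f < k, ∀ X < n ^ 𝔸.arityNat f, 𝔸.encode.getD (σ Arr.tab f + X) 0 = 𝔸.opNat f X

/-- The numbers of the arrays for the auxiliary tables are at most `10`, while recording clauses and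
forward chaining write only to arrays with larger numbers. -/
theorem Tables.congr {σ τ : Store} (h : Tables 𝔸 σ) (e : ∀ k : Fin 31, k ≤ 10 → τ k = σ k) :
    Tables 𝔸 τ where
  top := by rw [e _ (by decide), h.top]
  pow := by rw [e _ (by decide)]; exact h.pow
  mul s hs := by
    rw [e (mulArr s) (by rw [Fin.le_def, mulArr, Fin.val_ofNat]; simp; omega)]; exact h.mul s hs
  tab := by rw [e _ (by decide)]; exact h.tab

theorem Tables.put {σ : Store} (h : Tables 𝔸 σ) {k : Fin 31} (hk : 10 < k) (i x : ℕ) :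
    Tables 𝔸 (put σ k i x) := h.congr fun _ hk' => put_ne _ (hk'.trans_lt hk).ne _ _

theorem Tables.addClauses {σ : Store} (h : Tables 𝔸 σ) (L : List HornClause) :
    Tables 𝔸 (addClauses L σ) := h.congr fun k' hk' => addClauses_of_ne _ _ (by
  intro hm
  fin_cases hm <;> exact absurd hk' (by decide))

/-- The expression `e` has the value `v`. -/
def Val (𝔸 : UniversalAlgebra (Fin k) (Fin n)) (ρ : ℕ → ℕ) (e : Expr) (v : ℕ) : Prop :=
  ∀ σ, Tables 𝔸 σ → e.eval 𝔸.encode ρ σ = v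

/-- The expression `e` has the value `v`, which is at most the base. -/
def ValB (𝔸 : UniversalAlgebra (Fin k) (Fin n)) (ρ : ℕ → ℕ) (e : Expr) (v : ℕ) : Prop :=
  Val 𝔸 ρ e v ∧ v ≤ 𝔸.base

variable {ρ : ℕ → ℕ}

theorem val_lit (v : ℕ) : Val 𝔸 ρ (.lit v) v := fun _ _ => rfl

theorem val_var {i v : ℕ} (h : ρ i = v) : Val 𝔸 ρ (.var i) v := fun _ _ => h

theorem Val.add {e e' : Expr} {v v' : ℕ} (h : Val 𝔸 ρ e v) (h' : Val 𝔸 ρ e' v') :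
    Val 𝔸 ρ (.add e e') (v + v') := fun σ hσ => by rw [Expr.eval, h σ hσ, h' σ hσ]

theorem Val.sub {e e' : Expr} {v v' : ℕ} (h : Val 𝔸 ρ e v) (h' : Val 𝔸 ρ e' v') :
    Val 𝔸 ρ (.sub e e') (v - v') := fun σ hσ => by rw [Expr.eval, h σ hσ, h' σ hσ]

theorem val_size : Val 𝔸 ρ sizeE n := fun _ _ => rfl

theorem val_ops : Val 𝔸 ρ opsE k := fun _ _ => rfl

theorem encode_arity {f : ℕ} (hf : f < k) : 𝔸.encode.getD (2 + f) 0 = 𝔸.arityNat f := by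
  have : 2 + f = f + 1 + 1 := by omega
  rw [encode, this, List.getD_cons_succ, List.getD_cons_succ,
    List.getD_append _ _ _ _ (by simpa using hf), List.getD_eq_getElem _ _ (by simpa using hf)]
  simp [arityNat, hf]

theorem val_arity {f : ℕ} (hf : f < k) {e : Expr} (h : Val 𝔸 ρ e f) :
    Val 𝔸 ρ (arityE e) (𝔸.arityNat f) := fun σ hσ => by
  rw [arityE, Expr.eval, Expr.eval, h σ hσ, Expr.eval, encode_arity hf]

theorem val_pow {i : ℕ} (hi : i ≤ 𝔸.maxArity + 1) {e : Expr} (h : Val 𝔸 ρ e i) :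
    Val 𝔸 ρ (powE e) (n ^ i) := fun σ hσ => by
  rw [powE, Expr.eval, h σ hσ, hσ.pow i hi]

theorem val_top : Val 𝔸 ρ (.arr Arr.top (.lit 0)) 𝔸.maxArity := fun _ hσ => hσ.top

theorem val_value {f X : ℕ} (hf : f < k) (hX : X < n ^ 𝔸.arityNat f) {e e' : Expr}
    (h : Val 𝔸 ρ e f) (h' : Val 𝔸 ρ e' X) : Val 𝔸 ρ (valueE e e') (𝔸.opNat f X) := fun σ hσ => by
  rw [valueE, Expr.eval, Expr.eval, Expr.eval, h σ hσ, h' σ hσ, hσ.tab f hf X hX]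

/-- Multiples of powers of the base are looked up. The tables extend to `base + 8`, which covers
digits up to the base and tags up to `8`; `Y` is added as it is and needs no bound. -/
theorem val_atom {t : ℕ} (ht : t ≤ 8) {a b c d i X Y : Expr} {va vb vc vd vi vX vY : ℕ}
    (ha : ValB 𝔸 ρ a va) (hb : ValB 𝔸 ρ b vb) (hc : ValB 𝔸 ρ c vc) (hd : ValB 𝔸 ρ d vd)
    (hi : ValB 𝔸 ρ i vi) (hX : ValB 𝔸 ρ X vX) (hY : Val 𝔸 ρ Y vY) :
    Val 𝔸 ρ (atomE t a b c d i X Y) (𝔸.atom t va vb vc vd vi vX vY) := fun σ hσ => by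
  simp only [atomE, Expr.eval, ha.1 σ hσ, hb.1 σ hσ, hc.1 σ hσ, hd.1 σ hσ, hi.1 σ hσ, hX.1 σ hσ,
    hY σ hσ]
  rw [hσ.mul 0 (by omega) _ (by have := hX.2; omega), hσ.mul 1 (by omega) _ (by have := hi.2; omega),
    hσ.mul 2 (by omega) _ (by have := hd.2; omega), hσ.mul 3 (by omega) _ (by have := hc.2; omega),
    hσ.mul 4 (by omega) _ (by have := hb.2; omega), hσ.mul 5 (by omega) _ (by have := ha.2; omega),
    hσ.mul 6 (by omega) _ (by omega), atom, atomCode, pow_one]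

theorem valB_zero : ValB 𝔸 ρ (.lit 0) 0 := ⟨val_lit 0, Nat.zero_le _⟩

theorem valB_elem {i v : ℕ} (hv : v < n) (h : ρ i = v) : ValB 𝔸 ρ (.var i) v :=
  ⟨val_var h, hv.le.trans le_base⟩

theorem opNat_lt (f X : ℕ) : 𝔸.opNat f X < n := by
  rw [opNat]; split_ifs
  · exact Fin.is_lt _
  · exact NeZero.pos n

theorem valB_value {f X : ℕ} (hf : f < k) (hX : X < n ^ 𝔸.arityNat f) {e e' : Expr}
    (h : Val 𝔸 ρ e f) (h' : Val 𝔸 ρ e' X) : ValB 𝔸 ρ (valueE e e') (𝔸.opNat f X) :=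
  ⟨val_value hf hX h h', (opNat_lt f X).le.trans le_base⟩

/-- The command `c` adds the clauses in `L`, at most `K` in number, in at most `K` ticks. -/
def Emits (𝔸 : UniversalAlgebra (Fin k) (Fin n)) (c : Cmd) (ρ : ℕ → ℕ) (L : List HornClause)
    (K : ℕ) : Prop :=
  ∀ σ, Tables 𝔸 σ → c.eval 𝔸.encode ρ σ = addClauses L σ ∧ c.ticks 𝔸.encode ρ σ ≤ K ∧ L.length ≤ K

theorem Emits.mono {c : Cmd} {L : List HornClause} {K K' : ℕ} (h : Emits 𝔸 c ρ L K)
    (hK : K ≤ K') : Emits 𝔸 c ρ L K' := fun σ hσ => 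
  ⟨(h σ hσ).1, (h σ hσ).2.1.trans hK, (h σ hσ).2.2.trans hK⟩

/-- Three stores into `tmp` and the eight of `record` make `11` ticks. The expressions have values
determined by the tables alone, so writing to `tmp` in between does not affect them. -/
theorem emits_emit {p q r : Expr} {vp vq vr : ℕ} (hp : Val 𝔸 ρ p vp) (hq : Val 𝔸 ρ q vq)
    (hr : Val 𝔸 ρ r vr) : Emits 𝔸 (emit p q r) ρ [(vp, vq, vr)] 11 := fun σ hσ => by
  refine ⟨?_, le_rfl, by simp⟩
  have h₁ : Tables 𝔸 (put σ Arr.tmp 0 vp) := hσ.put (by decide) _ _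
  have h₂ : Tables 𝔸 (put (put σ Arr.tmp 0 vp) Arr.tmp 1 vq) := h₁.put (by decide) _ _
  have e : (emit p q r).eval 𝔸.encode ρ σ = record.eval 𝔸.encode ρ
      (put (put (put σ Arr.tmp 0 vp) Arr.tmp 1 vq) Arr.tmp 2 vr) := by
    simp only [emit, Cmd.eval]
    rw [hp σ hσ]
    simp only [Expr.eval]
    rw [hq _ h₁, hr _ h₂]
  rw [e]
  rfl

theorem Emits.seq {c c' : Cmd} {L L' : List HornClause} {K K' : ℕ} (h : Emits 𝔸 c ρ L K)
    (h' : Emits 𝔸 c' ρ L' K') : Emits 𝔸 (.seq c c') ρ (L ++ L') (K + K') := fun σ hσ => by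
  have h₁ := h σ hσ
  have h₂ := h' _ (hσ.addClauses L)
  rw [addClauses_append, Cmd.eval, Cmd.ticks, h₁.1]
  exact ⟨h₂.1, Nat.add_le_add h₁.2.1 h₂.2.1, by
    rw [List.length_append]; exact Nat.add_le_add h₁.2.2 h₂.2.2⟩

theorem iter_addClauses {c : Cmd} {s m b M : ℕ} {L : ℕ → List HornClause} {K : ℕ → ℕ}
    (h : ∀ i < M, Emits 𝔸 c (loopEnv s m b i ρ) (L i) (K i)) {σ : Store} (hσ : Tables 𝔸 σ) :
    iter (fun i => c.eval 𝔸.encode (loopEnv s m b i ρ)) M σ =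
      addClauses ((range M).flatMap L) σ := by
  induction M with
  | zero => rfl
  | succ M ih =>
    rw [iter, ih fun i hi => h i (by omega), ((h M (by omega)) _ (hσ.addClauses _)).1,
      List.range_succ, List.flatMap_append, addClauses_append]
    simp

theorem length_flatMap_range {α : Type*} (T : ℕ → List α) (m : ℕ) :
    ((range m).flatMap T).length = ∑ i ∈ Finset.range m, (T i).length := by
  induction m with
  | zero => rfl
  | succ m ih => rw [List.range_succ, List.flatMap_append, List.length_append, ih,
      Finset.sum_range_succ]; simp

theorem emits_loop_sum {s m b : Expr} {c : Cmd} {S M B : ℕ} (hs : Val 𝔸 ρ s S)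
    (hm : Val 𝔸 ρ m M) (hb : Val 𝔸 ρ b B) {L : ℕ → List HornClause} {K : ℕ → ℕ}
    (h : ∀ i < M, Emits 𝔸 c (loopEnv S M B i ρ) (L i) (K i)) :
    Emits 𝔸 (.loop s m b c) ρ ((range M).flatMap L) (1 + ∑ i ∈ Finset.range M, (1 + K i)) := by
  intro σ hσ
  rw [Cmd.eval, Cmd.ticks, hs σ hσ, hm σ hσ, hb σ hσ]
  refine ⟨iter_addClauses h hσ, Nat.add_le_add_left (Finset.sum_le_sum fun i hi => ?_) 1, ?_⟩
  · have hi := Finset.mem_range.1 hi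
    rw [iter_addClauses (fun j hj => h j (hj.trans hi)) hσ]
    exact Nat.add_le_add_left (h i hi _ (hσ.addClauses _)).2.1 1
  · rw [length_flatMap_range]
    refine le_add_left (Finset.sum_le_sum fun i hi => ?_)
    exact le_add_left (h i (Finset.mem_range.1 hi) _ hσ).2.2

/-- For positive `M` and `K` one has `1 + M * (1 + K) ≤ 3 * (M * K)`, a form that simply multiplies
through nested loops. -/
theorem emits_loop {s m b : Expr} {c : Cmd} {S M B : ℕ} (hs : Val 𝔸 ρ s S)
    (hm : Val 𝔸 ρ m M) (hb : Val 𝔸 ρ b B) {L : ℕ → List HornClause} {K : ℕ}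
    (hM : 0 < M) (hK : 0 < K)
    (h : ∀ i < M, Emits 𝔸 c (loopEnv S M B i ρ) (L i) K) :
    Emits 𝔸 (.loop s m b c) ρ ((range M).flatMap L) (3 * (M * K)) := by
  refine (emits_loop_sum hs hm hb (K := fun _ => K) h).mono ?_
  simp only [Finset.sum_const, Finset.card_range, smul_eq_mul]
  have := Nat.mul_le_mul hM hK
  have : M ≤ M * K := Nat.le_mul_of_pos_right M hK
  rw [Nat.mul_add]
  omega

theorem emits_loopN {c : Cmd} {L : ℕ → List HornClause} {K : ℕ} (hK : 0 < K)
    (h : ∀ i < n, Emits 𝔸 c (loopEnv 0 n 0 i ρ) (L i) K) :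
    Emits 𝔸 (loopN c) ρ ((range n).flatMap L) (3 * (n * K)) :=
  emits_loop (val_lit 0) val_size (val_lit 0) (NeZero.pos n) hK h

/-! #### The commands -/

/-- Emits `closureClauses t u a b c d`, where `a`, `b`, `c`, `d` are the counters of the last four
loops. -/
def closureCmd (t u : ℕ) : Cmd :=
  .seq (emit (.lit 0) (.lit 0) (atomE u (cnt 3) (cnt 2) (cnt 1) (cnt 0) (.lit 0) (.lit 0) (.lit 0)))
  (.seq
    (loop (.arr Arr.top (.lit 0)) <| .loop sizeE (powE (cnt 0)) (.lit 0) <|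
      .loop sizeE (powE (cnt 1)) (.lit 0) <| loopN <| loopN <|
      emit (atomE u (cnt 8) (cnt 7) (cnt 6) (cnt 5) (cnt 4) (cnt 3) (cnt 2))
        (atomE t (cnt 8) (cnt 7) (cnt 6) (cnt 5) (.lit 0) (cnt 1) (cnt 0))
        (atomE u (cnt 8) (cnt 7) (cnt 6) (cnt 5) (.add (cnt 4) (.lit 1))
          (.add (cnt 1) (acc 3)) (.add (cnt 0) (acc 2))))
    (loop opsE <| loop (powE (arityE (cnt 0))) <| loop (powE (arityE (cnt 1))) <|
      emit (atomE u (cnt 6) (cnt 5) (cnt 4) (cnt 3) (arityE (cnt 2)) (cnt 1) (cnt 0)) (.lit 0)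
        (atomE t (cnt 6) (cnt 5) (cnt 4) (cnt 3) (.lit 0) (valueE (cnt 2) (cnt 1))
          (valueE (cnt 2) (cnt 0)))))

/-- Emits `equivClauses t a b`. -/
def equivCmd (t : ℕ) : Cmd :=
  let z : Expr := .lit 0
  loopN <| .seq (emit z z (atomE t (cnt 2) (cnt 1) z z z (cnt 0) (cnt 0))) <|
    loopN <| .seq (emit (atomE t (cnt 3) (cnt 2) z z z (cnt 1) (cnt 0)) z
        (atomE t (cnt 3) (cnt 2) z z z (cnt 0) (cnt 1))) <|
      loopN <| emit (atomE t (cnt 4) (cnt 3) z z z (cnt 2) (cnt 1))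
        (atomE t (cnt 4) (cnt 3) z z z (cnt 1) (cnt 0))
        (atomE t (cnt 4) (cnt 3) z z z (cnt 2) (cnt 0))

/-- A loop over all elements `x`, with accumulator `H * n ^ (j + 1) + M + x * n ^ j`. -/
def spliceLoop (j H M : Expr) (c : Cmd) : Cmd :=
  .loop (powE j) sizeE (.add H M) c

/-- Emits `matrixClauses a b`. -/
def matrixCmd : Cmd :=
  let z : Expr := .lit 0
  .seq (emit z z (atomE 7 (cnt 1) (cnt 0) (cnt 1) (cnt 1) z (cnt 0) (cnt 0))) <|
  .seq (emit z z (atomE 7 (cnt 1) (cnt 0) (cnt 0) (cnt 0) z (cnt 1) (cnt 1))) <|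
  loop opsE <| loop (arityE (cnt 0)) <|
    .loop (powE (.add (cnt 0) (.lit 1)))
      (powE (.sub (.sub (arityE (cnt 1)) (.lit 1)) (cnt 0))) z <|
    .loop (powE (.add (cnt 1) (.lit 1)))
      (powE (.sub (.sub (arityE (cnt 2)) (.lit 1)) (cnt 1))) z <|
    loop (powE (cnt 2)) <| loop (powE (cnt 3)) <|
    spliceLoop (cnt 4) (acc 3) (cnt 1) <| spliceLoop (cnt 5) (acc 3) (cnt 1) <|
    spliceLoop (cnt 6) (acc 5) (cnt 3) <| spliceLoop (cnt 7) (acc 5) (cnt 3) <|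
    emit (atomE 7 (cnt 11) (cnt 10) (cnt 3) (cnt 2) z (cnt 1) (cnt 0))
      (atomE 2 (cnt 11) (cnt 10) z z (arityE (cnt 9)) (acc 3) (acc 2))
      (atomE 7 (cnt 11) (cnt 10) (valueE (cnt 9) (acc 3)) (valueE (cnt 9) (acc 2)) z
        (valueE (cnt 9) (acc 1)) (valueE (cnt 9) (acc 0)))

/-- Emits `termConditionClauses a b`. -/
def termConditionCmd : Cmd :=
  let z : Expr := .lit 0
  loopN <| loopN <| loopN <| loopN <|
    emit (atomE 3 (cnt 5) (cnt 4) z z z (cnt 3) (cnt 2))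
      (atomE 7 (cnt 5) (cnt 4) (cnt 3) (cnt 2) z (cnt 1) (cnt 0))
      (atomE 3 (cnt 5) (cnt 4) z z z (cnt 1) (cnt 0))

/-- Emits `testClauses a b c d`. -/
def testCmd : Cmd :=
  let z : Expr := .lit 0
  .seq (emit z z (atomE 5 (cnt 3) (cnt 2) (cnt 1) (cnt 0) z (cnt 3) (cnt 1))) <|
  .seq (emit z z (atomE 5 (cnt 3) (cnt 2) (cnt 1) (cnt 0) z (cnt 2) (cnt 1))) <|
  .seq (emit z z (atomE 5 (cnt 3) (cnt 2) (cnt 1) (cnt 0) z (cnt 2) (cnt 0))) <|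
  .seq (closureCmd 5 6) <|
  loopN <| emit (atomE 5 (cnt 4) (cnt 3) (cnt 2) (cnt 1) z (cnt 0) (cnt 1))
    (atomE 3 (cnt 4) (cnt 3) z z z (cnt 4) (cnt 0))
    (atomE 8 (cnt 4) (cnt 3) (cnt 2) (cnt 1) z z z)

/-- Emits `pairClauses a b`. -/
def pairCmd : Cmd :=
  let z : Expr := .lit 0
  .seq (equivCmd 1) <|
  .seq (emit z z (atomE 1 (cnt 1) (cnt 0) z z z (cnt 1) (cnt 0))) <|
  .seq (loop (.lit 1) <| loop (.lit 1) <| closureCmd 1 2) <|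
  .seq matrixCmd <|
  .seq (equivCmd 3) <|
  .seq (loop (.lit 1) <| loop (.lit 1) <| closureCmd 3 4) <|
  .seq termConditionCmd <|
  loopN <| loopN testCmd

/-- Emits all clauses. -/
def clausesCmd : Cmd := loopN <| loopN pairCmd

/-! #### The clauses emitted, and their number -/

theorem valB_pow {i x v : ℕ} (hx : x ≤ 𝔸.maxArity) (hv : v < n ^ x) (h : ρ i = v) :
    ValB 𝔸 ρ (.var i) v := ⟨val_var h, hv.le.trans (pow_le_base hx)⟩

theorem emits_closureCmd_sum (hn : 2 ≤ n) {t u a b c d : ℕ} (ht : t ≤ 8) (hu : u ≤ 8) (ha : a < n)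
    (hb : b < n) (hc : c < n) (hd : d < n) (ea : ρ 12 = a) (eb : ρ 8 = b) (ec : ρ 4 = c)
    (ed : ρ 0 = d) :
    Emits 𝔸 (closureCmd t u) ρ (𝔸.closureClauses t u a b c d)
      (11 + ((1 + ∑ i ∈ Finset.range 𝔸.maxArity,
          (1 + 3 * (n ^ i * (3 * (n ^ i * (3 * (n * (3 * (n * 11))))))))) +
        (1 + ∑ f ∈ Finset.range k,
          (1 + 3 * (n ^ 𝔸.arityNat f * (3 * (n ^ 𝔸.arityNat f * 11))))))) := by
  have hR := maxArity_lt_base (𝔸 := 𝔸) hn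
  have hp : ∀ i, 0 < n ^ i := fun i => pow_pos (NeZero.pos n) i
  refine (emits_emit (val_lit 0) (val_lit 0) (val_atom hu (valB_elem ha ea) (valB_elem hb eb)
    (valB_elem hc ec) (valB_elem hd ed) valB_zero valB_zero (val_lit 0))).seq (Emits.seq ?_ ?_)
  · refine emits_loop_sum (val_lit 0) val_top (val_lit 0) fun i hi =>
      emits_loop val_size (val_pow (𝔸 := 𝔸) (i := i) (by omega) (val_var rfl)) (val_lit 0) (hp i) (by positivity)
      fun X hX => emits_loop val_size (val_pow (𝔸 := 𝔸) (i := i) (by omega) (val_var rfl)) (val_lit 0) (hp i)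
      (by positivity) fun Y hY => emits_loopN (by positivity) fun x hx =>
      emits_loopN (by positivity) fun y hy => ?_
    have hlt : ∀ {X x : ℕ}, X < n ^ i → x < n → x + X * n ≤ 𝔸.base := fun {X x} h h' => by
      have : (X + 1) * n ≤ n ^ i * n := Nat.mul_le_mul_right _ h
      have : n ^ (i + 1) ≤ 𝔸.base := pow_le_base hi
      rw [pow_succ] at this
      linarith
    exact emits_emit
      (val_atom hu (valB_elem ha ea) (valB_elem hb eb) (valB_elem hc ec) (valB_elem hd ed)
        ⟨val_var rfl, by omega⟩ (valB_pow hi.le hX rfl) (val_var rfl))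
      (val_atom ht (valB_elem ha ea) (valB_elem hb eb) (valB_elem hc ec) (valB_elem hd ed)
        valB_zero (valB_elem hx rfl) (val_var rfl))
      (val_atom hu (valB_elem ha ea) (valB_elem hb eb) (valB_elem hc ec) (valB_elem hd ed)
        ⟨(val_var rfl).add (val_lit 1), by omega⟩
        ⟨(val_var rfl).add (val_var rfl), hlt hX hx⟩ ((val_var rfl).add (val_var rfl)))
  · refine emits_loop_sum (val_lit 0) val_ops (val_lit 0) fun f hf => ?_
    have hR' := arityNat_le (𝔸 := 𝔸) f
    refine emits_loop (val_lit 0) (val_pow (by omega) (val_arity hf (val_var rfl))) (val_lit 0)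
      (hp _) (by positivity) fun X hX => emits_loop (val_lit 0)
      (val_pow (by omega) (val_arity hf (val_var rfl))) (val_lit 0) (hp _) (by positivity)
      fun Y hY => ?_
    exact emits_emit
      (val_atom hu (valB_elem ha ea) (valB_elem hb eb) (valB_elem hc ec) (valB_elem hd ed)
        ⟨val_arity hf (val_var rfl), by omega⟩ (valB_pow hR' hX rfl) (val_var rfl))
      (val_lit 0)
      (val_atom ht (valB_elem ha ea) (valB_elem hb eb) (valB_elem hc ec) (valB_elem hd ed)
        valB_zero (valB_value hf hX (val_var rfl) (val_var rfl))
        (val_value hf hY (val_var rfl) (val_var rfl)))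

theorem emits_equivCmd {t a b : ℕ} (ht : t ≤ 8) (ha : a < n) (hb : b < n) (ea : ρ 4 = a)
    (eb : ρ 0 = b) : Emits 𝔸 (equivCmd t) ρ (𝔸.equivClauses t a b) (429 * n ^ 3) := by
  -- Expanded, this is `33 * n + 99 * n ^ 2 + 297 * n ^ 3`, and the coefficients add up to `429`.
  refine Emits.mono (K := 3 * (n * (11 + 3 * (n * (11 + 3 * (n * 11)))))) ?h ?_
  case h => exact (emits_loopN (by positivity) fun x hx => Emits.seq (emits_emit (val_lit 0)
    (val_lit 0) (val_atom ht (valB_elem ha ea) (valB_elem hb eb) valB_zero valB_zero valB_zero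
      (valB_elem hx rfl) (val_var rfl))) (emits_loopN (K := 11 + 3 * (n * 11)) (by positivity)
    fun y hy => Emits.seq (emits_emit (val_atom ht (valB_elem ha ea) (valB_elem hb eb) valB_zero
      valB_zero valB_zero (valB_elem hx rfl) (val_var rfl)) (val_lit 0) (val_atom ht
      (valB_elem ha ea) (valB_elem hb eb) valB_zero valB_zero valB_zero (valB_elem hy rfl)
      (val_var rfl))) (emits_loopN (by positivity) fun z hz => emits_emit
    (val_atom ht (valB_elem ha ea) (valB_elem hb eb) valB_zero valB_zero valB_zero
      (valB_elem hx rfl) (val_var rfl))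
    (val_atom ht (valB_elem ha ea) (valB_elem hb eb) valB_zero valB_zero valB_zero
      (valB_elem hy rfl) (val_var rfl))
    (val_atom ht (valB_elem ha ea) (valB_elem hb eb) valB_zero valB_zero valB_zero
      (valB_elem hx rfl) (val_var rfl)))))
  have h₁ : n ≤ n ^ 3 := Nat.le_self_pow (by norm_num) n
  have h₂ : n ^ 2 ≤ n ^ 3 := Nat.pow_le_pow_right (NeZero.pos n) (by norm_num)
  nlinarith

theorem emits_termConditionCmd {a b : ℕ} (ha : a < n) (hb : b < n) (ea : ρ 4 = a)
    (eb : ρ 0 = b) :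
    Emits 𝔸 termConditionCmd ρ (𝔸.termConditionClauses a b) (891 * n ^ 4) := by
  have hn := NeZero.pos n
  refine Emits.mono (K := 3 * (n * (3 * (n * (3 * (n * (3 * (n * 11)))))))) ?h ?_
  case h => exact (emits_loopN (by positivity) fun x hx => emits_loopN (by positivity)
    fun y hy => emits_loopN (by positivity) fun x' hx' => emits_loopN (by positivity)
    fun y' hy' => emits_emit
    (val_atom (by norm_num) (valB_elem ha ea) (valB_elem hb eb) valB_zero valB_zero valB_zero
      (valB_elem hx rfl) (val_var rfl))
    (val_atom (by norm_num) (valB_elem ha ea) (valB_elem hb eb) (valB_elem hx rfl)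
      (valB_elem hy rfl) valB_zero (valB_elem hx' rfl) (val_var rfl))
    (val_atom (by norm_num) (valB_elem ha ea) (valB_elem hb eb) valB_zero valB_zero valB_zero
      (valB_elem hx' rfl) (val_var rfl)))
  apply le_of_eq; ring

/-- Eight nested loops surround the emission, and `72171 = 3 ^ 8 * 11`. For arity `r` their bounds
multiply to `n ^ (2 * (r - 1 - j)) * n ^ (2 * j) * n ^ 4 = n ^ (2 * r + 2)`. -/
theorem emits_matrixCmd_sum (hn : 2 ≤ n) {a b : ℕ} (ha : a < n) (hb : b < n) (ea : ρ 4 = a)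
    (eb : ρ 0 = b) :
    Emits 𝔸 matrixCmd ρ (𝔸.matrixClauses a b)
      (11 + (11 + (1 + ∑ f ∈ Finset.range k, (1 + (1 + ∑ _j ∈ Finset.range (𝔸.arityNat f),
        (1 + 72171 * (n ^ (𝔸.arityNat f) * n ^ (𝔸.arityNat f) * n ^ 2))))))) := by
  have hR := maxArity_lt_base (𝔸 := 𝔸) hn
  have hp : ∀ i, 0 < n ^ i := fun i => pow_pos (NeZero.pos n) i
  refine (emits_emit (val_lit 0) (val_lit 0) (val_atom (by norm_num) (valB_elem ha ea)
    (valB_elem hb eb) (valB_elem ha ea) (valB_elem ha ea) valB_zero (valB_elem hb eb)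
    (val_var eb))).seq ((emits_emit (val_lit 0) (val_lit 0) (val_atom (by norm_num)
    (valB_elem ha ea) (valB_elem hb eb) (valB_elem hb eb) (valB_elem hb eb) valB_zero
    (valB_elem ha ea) (val_var ea))).seq ?_)
  refine emits_loop_sum (val_lit 0) val_ops (val_lit 0) fun f hf => emits_loop_sum (val_lit 0)
    (val_arity hf (val_var rfl)) (val_lit 0) fun j hj => ?_
  have hR' := arityNat_le (𝔸 := 𝔸) f
  have hv : ∀ {X : ℕ}, X < n ^ 𝔸.arityNat f → X ≤ 𝔸.base := fun h => h.le.trans (pow_le_base hR')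
  have hl : ∀ {H M x : ℕ}, H < n ^ (𝔸.arityNat f - 1 - j) → M < n ^ j → x < n →
    H * n ^ (j + 1) + M + x * n ^ j < n ^ 𝔸.arityNat f := fun h h' h'' => splice_lt_pow hj h h' h''
  refine Emits.mono (K := 3 * (n ^ (𝔸.arityNat f - 1 - j) * (3 * (n ^ (𝔸.arityNat f - 1 - j) * (3 * (n ^ j * (3 * (n ^ j * (3 * (n * (3 * (n * (3 * (n * (3 * (n * 11)))))))))))))))) ?h ?_
  case h =>
    refine (emits_loop (S := n ^ (j + 1))
    (val_pow (𝔸 := 𝔸) (i := j + 1) (by omega) ((val_var rfl).add (val_lit 1)))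
    (val_pow (𝔸 := 𝔸) (i := 𝔸.arityNat f - 1 - j) (by omega) (((val_arity hf (val_var rfl)).sub (val_lit 1)).sub (val_var rfl)))
    (val_lit 0) (hp _) (by positivity) fun H hH => emits_loop (S := n ^ (j + 1))
    (val_pow (𝔸 := 𝔸) (i := j + 1) (by omega) ((val_var rfl).add (val_lit 1)))
    (val_pow (𝔸 := 𝔸) (i := 𝔸.arityNat f - 1 - j) (by omega) (((val_arity hf (val_var rfl)).sub (val_lit 1)).sub (val_var rfl)))
    (val_lit 0) (hp _) (by positivity) fun H' hH' =>
    emits_loop (val_lit 0) (val_pow (𝔸 := 𝔸) (i := j) (by omega) (val_var rfl)) (val_lit 0) (hp j) (by positivity)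
    fun M hM =>
    emits_loop (val_lit 0) (val_pow (𝔸 := 𝔸) (i := j) (by omega) (val_var rfl)) (val_lit 0) (hp j) (by positivity)
    fun M' hM' =>
    emits_loop (S := n ^ j) (B := H * n ^ (j + 1) + M) (val_pow (𝔸 := 𝔸) (i := j) (by omega) (val_var rfl)) val_size
      (by exact fun _ _ => rfl) (NeZero.pos n) (by positivity) fun x hx =>
    emits_loop (S := n ^ j) (B := H' * n ^ (j + 1) + M') (val_pow (𝔸 := 𝔸) (i := j) (by omega) (val_var rfl)) val_size
      (by exact fun _ _ => rfl) (NeZero.pos n) (by positivity) fun y hy =>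
    emits_loop (S := n ^ j) (B := H * n ^ (j + 1) + M) (val_pow (𝔸 := 𝔸) (i := j) (by omega) (val_var rfl)) val_size
      (by exact fun _ _ => rfl) (NeZero.pos n) (by positivity) fun x' hx' =>
    emits_loop (S := n ^ j) (B := H' * n ^ (j + 1) + M') (val_pow (𝔸 := 𝔸) (i := j) (by omega) (val_var rfl)) val_size
      (by exact fun _ _ => rfl) (NeZero.pos n) (by positivity) fun y' hy' => ?_)
    -- The accumulators of the four innermost loops have the form `x * n ^ j + (H * n ^ (j + 1) +
    -- M)`, with the summands in the other order than in the clauses; hence `Nat.add_comm`.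
    exact emits_emit
      (val_atom (by norm_num) (valB_elem ha ea) (valB_elem hb eb) (valB_elem hx rfl)
        (valB_elem hy rfl) valB_zero (valB_elem hx' rfl) (val_var rfl))
      (val_atom (by norm_num) (valB_elem ha ea) (valB_elem hb eb) valB_zero valB_zero
        ⟨val_arity hf (val_var rfl), by omega⟩
        ⟨val_var (Nat.add_comm _ _), hv (hl hH hM hx)⟩ (val_var (Nat.add_comm _ _)))
      (val_atom (by norm_num) (valB_elem ha ea) (valB_elem hb eb)
        (valB_value hf (hl hH hM hx) (val_var rfl) (val_var (Nat.add_comm _ _)))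
        (valB_value hf (hl hH' hM' hy) (val_var rfl) (val_var (Nat.add_comm _ _))) valB_zero
        (valB_value hf (hl hH hM hx') (val_var rfl) (val_var (Nat.add_comm _ _)))
        (val_value hf (hl hH' hM' hy') (val_var rfl) (val_var (Nat.add_comm _ _))))
  · have e : n ^ 𝔸.arityNat f = n ^ (𝔸.arityNat f - 1 - j) * n ^ j * n := by
      rw [← pow_add, ← pow_succ]; congr 1; omega
    rw [e]
    apply le_of_eq
    ring


/-! ### Bounds in terms of arity and input size. -/

/-- The main term of the running time. -/
def workload (𝔸 : UniversalAlgebra (Fin k) (Fin n)) : ℕ := 𝔸.maxArity * 𝔸.inputSize ^ 2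

theorem sum_pow_arityNat : ∑ f ∈ Finset.range k, n ^ 𝔸.arityNat f = 𝔸.inputSize := by
  rw [Finset.sum_range, inputSize]
  simp only [arityNat_val]

theorem exists_arity_eq_maxArity (h : 0 < 𝔸.maxArity) : ∃ f : Fin k, 𝔸.arity f = 𝔸.maxArity := by
  have hk : (Finset.univ : Finset (Fin k)).Nonempty := by
    rw [Finset.nonempty_iff_ne_empty]
    intro e
    rw [maxArity, e, Finset.sup_empty] at h
    exact lt_irrefl _ h
  obtain ⟨f, -, hf⟩ := Finset.exists_mem_eq_sup _ hk 𝔸.arity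
  exact ⟨f, hf.symm⟩

theorem pow_maxArity_le (h : 0 < 𝔸.maxArity) : n ^ 𝔸.maxArity ≤ 𝔸.inputSize := by
  obtain ⟨f, hf⟩ := exists_arity_eq_maxArity h
  rw [← hf]
  exact Finset.single_le_sum (f := fun f => n ^ 𝔸.arity f) (fun _ _ => Nat.zero_le _)
    (Finset.mem_univ f)

/-- A nullary operation has just one value, and idempotence would make it equal to both `0` and `1`.
-/
theorem arity_pos (hn : 2 ≤ n) (hi : 𝔸.IsIdempotent) (f : Fin k) : 0 < 𝔸.arity f := by
  by_contra h
  have h0 : IsEmpty (Fin (𝔸.arity f)) := by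
    rw [Nat.eq_zero_of_not_pos h]; infer_instance
  have h₁ := hi f (0 : Fin n)
  rw [Subsingleton.elim (fun _ => (0 : Fin n)) fun _ => ⟨1, hn⟩, hi] at h₁
  exact absurd (congrArg Fin.val h₁) one_ne_zero

/-- If there is an operation, its arity is positive and so `maxArity ≥ 1`; if there is none, the
input size is `0`. -/
theorem le_workload_of_le_sq (hn : 2 ≤ n) (hi : 𝔸.IsIdempotent) {x : ℕ}
    (hx : x ≤ 𝔸.inputSize ^ 2) : x ≤ workload 𝔸 := by
  rcases Nat.eq_zero_or_pos k with rfl | hk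
  · rw [inputSize, Finset.univ_eq_empty, Finset.sum_empty] at hx
    simp only [ne_eq, OfNat.ofNat_ne_zero, not_false_eq_true, zero_pow, nonpos_iff_eq_zero] at hx
    rw [hx]
    exact Nat.zero_le _
  · have : 0 < 𝔸.maxArity := (arity_pos hn hi ⟨0, hk⟩).trans_le (arity_le _)
    exact hx.trans (Nat.le_mul_of_pos_left _ this)

theorem sum_sq_arityNat_le :
    ∑ f ∈ Finset.range k, n ^ 𝔸.arityNat f * n ^ 𝔸.arityNat f ≤ 𝔸.inputSize ^ 2 := by
  rw [← sum_pow_arityNat]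
  refine le_trans (le_of_eq (Finset.sum_congr rfl fun _ _ => (pow_two _).symm))
    (Finset.sum_sq_le_sq_sum_of_nonneg fun _ _ => Nat.zero_le _)

theorem card_le_inputSize : k ≤ 𝔸.inputSize := by
  have := Finset.card_nsmul_le_sum (Finset.univ : Finset (Fin k)) (fun f => n ^ 𝔸.arity f) 1
    fun f _ => pow_pos (NeZero.pos n) _
  rw [Finset.card_univ, Fintype.card_fin, smul_eq_mul, mul_one] at this
  exact this

theorem card_le_sq : k ≤ 𝔸.inputSize ^ 2 :=
  card_le_inputSize.trans (Nat.le_self_pow two_ne_zero _)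

/-- For `i < maxArity` the tuple loop costs about `(n ^ (i + 1)) ^ 2`, which is at most `inputSize ^
2`; the operations contribute the sum of the squared sizes of their tables. -/
theorem emits_closureCmd (hn : 2 ≤ n) (hi : 𝔸.IsIdempotent) {t u a b c d : ℕ} (ht : t ≤ 8)
    (hu : u ≤ 8) (ha : a < n) (hb : b < n) (hc : c < n) (hd : d < n) (ea : ρ 12 = a) (eb : ρ 8 = b)
    (ec : ρ 4 = c) (ed : ρ 0 = d) :
    Emits 𝔸 (closureCmd t u) ρ (𝔸.closureClauses t u a b c d) (1000 * (workload 𝔸 + 1)) := by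
  refine (emits_closureCmd_sum hn ht hu ha hb hc hd ea eb ec ed).mono ?_
  have h₁ : ∑ i ∈ Finset.range 𝔸.maxArity,
      (1 + 3 * (n ^ i * (3 * (n ^ i * (3 * (n * (3 * (n * 11)))))))) ≤ 892 * workload 𝔸 := by
    rcases Nat.eq_zero_or_pos 𝔸.maxArity with h | h
    · simp [h]
    · refine (Finset.sum_le_card_nsmul _ _ (892 * 𝔸.inputSize ^ 2) fun i hi => ?_).trans
        (le_of_eq ?_)
      · have h₂ : n ^ (i + 1) ≤ 𝔸.inputSize := (Nat.pow_le_pow_right (NeZero.pos n)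
          (Finset.mem_range.1 hi)).trans (pow_maxArity_le h)
        have h₃ : 0 < n ^ (i + 1) := pow_pos (NeZero.pos n) _
        have e : 3 * (n ^ i * (3 * (n ^ i * (3 * (n * (3 * (n * 11))))))) =
          891 * (n ^ (i + 1)) ^ 2 := by ring
        have h₄ := Nat.pow_le_pow_left h₂ 2
        have h₅ : 0 < (n ^ (i + 1)) ^ 2 := pow_pos h₃ 2
        rw [e]
        omega
      · rw [Finset.card_range, smul_eq_mul, workload]; ring
  have h₂ : ∑ f ∈ Finset.range k,
      (1 + 3 * (n ^ 𝔸.arityNat f * (3 * (n ^ 𝔸.arityNat f * 11)))) ≤ 100 * workload 𝔸 := by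
    have e : ∑ f ∈ Finset.range k,
        (1 + 3 * (n ^ 𝔸.arityNat f * (3 * (n ^ 𝔸.arityNat f * 11)))) =
        k + 99 * ∑ f ∈ Finset.range k, n ^ 𝔸.arityNat f * n ^ 𝔸.arityNat f := by
      rw [Finset.sum_add_distrib, Finset.sum_const, Finset.card_range, smul_eq_mul, mul_one,
        Finset.mul_sum]
      congr 1
      exact Finset.sum_congr rfl fun _ _ => by ring
    have h₃ := le_workload_of_le_sq hn hi (card_le_sq (𝔸 := 𝔸))
    have h₄ := le_workload_of_le_sq hn hi (sum_sq_arityNat_le (𝔸 := 𝔸))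
    rw [e]
    omega
  omega

theorem emits_matrixCmd (hn : 2 ≤ n) (hi : 𝔸.IsIdempotent) {a b : ℕ} (ha : a < n) (hb : b < n)
    (ea : ρ 4 = a) (eb : ρ 0 = b) :
    Emits 𝔸 matrixCmd ρ (𝔸.matrixClauses a b) (80000 * (workload 𝔸 * n ^ 2 + 1)) := by
  refine (emits_matrixCmd_sum hn ha hb ea eb).mono ?_
  have h₁ : ∑ f ∈ Finset.range k, (1 + (1 + ∑ _j ∈ Finset.range (𝔸.arityNat f),
      (1 + 72171 * (n ^ (𝔸.arityNat f) * n ^ (𝔸.arityNat f) * n ^ 2)))) ≤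
      2 * workload 𝔸 + 72172 * (workload 𝔸 * n ^ 2) := by
    calc _ ≤ ∑ f ∈ Finset.range k, (2 + 𝔸.maxArity * (72172 * n ^ 2) *
          (n ^ (𝔸.arityNat f) * n ^ (𝔸.arityNat f))) := by
            refine Finset.sum_le_sum fun f _ => ?_
            rw [Finset.sum_const, Finset.card_range, smul_eq_mul, ← add_assoc]
            refine Nat.add_le_add_left ?_ 2
            rw [mul_assoc 𝔸.maxArity]
            refine Nat.mul_le_mul (arityNat_le f) ?_
            have : 0 < n ^ (𝔸.arityNat f) * n ^ (𝔸.arityNat f) * n ^ 2 := by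
              have := NeZero.pos n
              positivity
            linarith
      _ = 2 * k + 𝔸.maxArity * (72172 * n ^ 2) * ∑ f ∈ Finset.range k,
          n ^ 𝔸.arityNat f * n ^ 𝔸.arityNat f := by
            rw [Finset.sum_add_distrib, Finset.sum_const, Finset.card_range, smul_eq_mul,
              Finset.mul_sum, mul_comm k]
      _ ≤ 2 * k + 𝔸.maxArity * (72172 * n ^ 2) * 𝔸.inputSize ^ 2 :=
            Nat.add_le_add_left (Nat.mul_le_mul_left _ sum_sq_arityNat_le) _
      _ = 2 * k + 72172 * (workload 𝔸 * n ^ 2) := by rw [workload]; ring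
      _ ≤ _ := by
            have h₃ := le_workload_of_le_sq hn hi (card_le_sq (𝔸 := 𝔸))
            omega
  have h₂ : workload 𝔸 ≤ workload 𝔸 * n ^ 2 := Nat.le_mul_of_pos_right _ (by positivity)
  omega

theorem emits_testCmd (hn : 2 ≤ n) (hi : 𝔸.IsIdempotent) {a b c d : ℕ}
    (ha : a < n) (hb : b < n) (hc : c < n) (hd : d < n) (ea : ρ 12 = a) (eb : ρ 8 = b)
    (ec : ρ 4 = c) (ed : ρ 0 = d) :
    Emits 𝔸 testCmd ρ (𝔸.testClauses a b c d) (1100 * (workload 𝔸 + n)) := by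
  refine Emits.mono (K := 11 + (11 + (11 + (1000 * (workload 𝔸 + 1) + 3 * (n * 11)))))
    ((emits_emit (val_lit 0) (val_lit 0) (val_atom (by norm_num) (valB_elem ha ea)
      (valB_elem hb eb) (valB_elem hc ec) (valB_elem hd ed) valB_zero (valB_elem ha ea)
      (val_var ec))).seq <|
    (emits_emit (val_lit 0) (val_lit 0) (val_atom (by norm_num) (valB_elem ha ea)
      (valB_elem hb eb) (valB_elem hc ec) (valB_elem hd ed) valB_zero (valB_elem hb eb)
      (val_var ec))).seq <|
    (emits_emit (val_lit 0) (val_lit 0) (val_atom (by norm_num) (valB_elem ha ea)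
      (valB_elem hb eb) (valB_elem hc ec) (valB_elem hd ed) valB_zero (valB_elem hb eb)
      (val_var ed))).seq <|
    (emits_closureCmd hn hi (by norm_num) (by norm_num) ha hb hc hd ea eb ec ed).seq <|
    emits_loopN (by norm_num) fun x hx => emits_emit
      (val_atom (by norm_num) (valB_elem ha ea) (valB_elem hb eb) (valB_elem hc ec)
        (valB_elem hd ed) valB_zero (valB_elem hx rfl) (val_var ed))
      (val_atom (by norm_num) (valB_elem ha ea) (valB_elem hb eb) valB_zero valB_zero valB_zero
        (valB_elem ha ea) (val_var rfl))
      (val_atom (by norm_num) (valB_elem ha ea) (valB_elem hb eb) (valB_elem hc ec)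
        (valB_elem hd ed) valB_zero valB_zero (val_lit 0))) ?_
  omega

theorem emits_once {c : Cmd} {L : ℕ → List HornClause} {K : ℕ} (hK : 0 < K)
    (h : Emits 𝔸 c (loopEnv 0 1 0 0 ρ) (L 0) K) :
    Emits 𝔸 (loop (.lit 1) c) ρ (L 0) (3 * K) := by
  have := emits_loop (val_lit 0) (val_lit 1) (val_lit 0) one_pos hK (ρ := ρ) (L := L) (c := c)
    (𝔸 := 𝔸) fun i hi => by
      obtain rfl : i = 0 := by omega
      exact h
  rw [List.range_one, List.flatMap_singleton, one_mul] at this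
  exact this

/-- `closureCmd` reads all four arguments from counters of enclosing loops; two loops of a single
round supply the missing zeros. -/
theorem emits_closureCmd_pair (hn : 2 ≤ n) (hi : 𝔸.IsIdempotent) {t u a b : ℕ} (ht : t ≤ 8)
    (hu : u ≤ 8) (ha : a < n) (hb : b < n) (ea : ρ 4 = a) (eb : ρ 0 = b) :
    Emits 𝔸 (loop (.lit 1) <| loop (.lit 1) <| closureCmd t u) ρ (𝔸.closureClauses t u a b 0 0)
      (3 * (3 * (1000 * (workload 𝔸 + 1)))) :=
  emits_once (L := fun _ => 𝔸.closureClauses t u a b 0 0) (by positivity) <|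
    emits_once (L := fun _ => 𝔸.closureClauses t u a b 0 0) (by positivity) <|
    emits_closureCmd hn hi ht hu ha hb (NeZero.pos n) (NeZero.pos n) ea eb rfl rfl

theorem emits_pairCmd (hn : 2 ≤ n) (hi : 𝔸.IsIdempotent) {a b : ℕ} (ha : a < n) (hb : b < n)
    (ea : ρ 4 = a) (eb : ρ 0 = b) :
    Emits 𝔸 pairCmd ρ (𝔸.pairClauses a b) (200000 * (workload 𝔸 * n ^ 2 + n ^ 4)) := by
  refine Emits.mono (K := 429 * n ^ 3 + (11 + (3 * (3 * (1000 * (workload 𝔸 + 1))) +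
      (80000 * (workload 𝔸 * n ^ 2 + 1) + (429 * n ^ 3 + (3 * (3 * (1000 * (workload 𝔸 + 1))) +
      (891 * n ^ 4 + 3 * (n * (3 * (n * (1100 * (workload 𝔸 + n))))))))))))
    ((emits_equivCmd (by norm_num) ha hb ea eb).seq <|
    (emits_emit (val_lit 0) (val_lit 0) (val_atom (by norm_num) (valB_elem ha ea)
      (valB_elem hb eb) valB_zero valB_zero valB_zero (valB_elem ha ea) (val_var eb))).seq <|
    (emits_closureCmd_pair hn hi (by norm_num) (by norm_num) ha hb ea eb).seq <|
    (emits_matrixCmd hn hi ha hb ea eb).seq <|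
    (emits_equivCmd (by norm_num) ha hb ea eb).seq <|
    (emits_closureCmd_pair hn hi (by norm_num) (by norm_num) ha hb ea eb).seq <|
    (emits_termConditionCmd ha hb ea eb).seq <|
    emits_loopN (by positivity) fun c hc => emits_loopN (by positivity) fun d hd =>
    emits_testCmd hn hi ha hb hc hd ea eb rfl rfl) ?_
  have h₀ := NeZero.pos n
  have h₁ : n ^ 3 ≤ n ^ 4 := Nat.pow_le_pow_right h₀ (by norm_num)
  have h₂ : 1 ≤ n ^ 3 := pow_pos h₀ 3
  have h₃ : workload 𝔸 ≤ workload 𝔸 * n ^ 2 := Nat.le_mul_of_pos_right _ (by positivity)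
  have e : 3 * (n * (3 * (n * (1100 * (workload 𝔸 + n))))) =
    9900 * (workload 𝔸 * n ^ 2) + 9900 * n ^ 3 := by ring
  rw [e]
  omega

theorem emits_clausesCmd (hn : 2 ≤ n) (hi : 𝔸.IsIdempotent) :
    Emits 𝔸 clausesCmd ρ 𝔸.clauses (1800000 * (workload 𝔸 * n ^ 4 + n ^ 7)) := by
  refine Emits.mono (K := 3 * (n * (3 * (n * (200000 * (workload 𝔸 * n ^ 2 + n ^ 4))))))
    (emits_loopN (by positivity) fun a ha => emits_loopN (by positivity) fun b hb =>
      emits_pairCmd hn hi ha hb rfl rfl) ?_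
  have h₁ : n ^ 6 ≤ n ^ 7 := Nat.pow_le_pow_right (NeZero.pos n) (by norm_num)
  have e : 3 * (n * (3 * (n * (200000 * (workload 𝔸 * n ^ 2 + n ^ 4))))) =
    1800000 * (workload 𝔸 * n ^ 4 + n ^ 6) := by ring
  rw [e]
  omega

/-! #### The auxiliary tables -/

theorem getD_flatMap_range (T : ℕ → List ℕ) {m f X : ℕ} (hf : f < m) (hX : X < (T f).length) :
    ((range m).flatMap T).getD (∑ g ∈ Finset.range f, (T g).length + X) 0 = (T f).getD X 0 := by
  induction m with
  | zero => omega
  | succ m ih =>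
    rw [List.range_succ, List.flatMap_append, List.flatMap_singleton]
    rcases Nat.lt_succ_iff_lt_or_eq.1 hf with h | rfl
    · rw [List.getD_append, ih h]
      rw [length_flatMap_range]
      have h₁ := Finset.sum_range_succ (fun g => (T g).length) f
      have h₂ := Finset.sum_le_sum_of_subset (f := fun g => (T g).length)
        (Finset.range_mono (Nat.succ_le_of_lt h))
      simp only [Nat.succ_eq_add_one] at h₂
      omega
    · rw [List.getD_append_right] <;> rw [length_flatMap_range]
      · simp
      · omega

/-- The tables start after the `2 + k` entries for the two sizes and the arities. -/
theorem encode_value {f X : ℕ} (hf : f < k) (hX : X < n ^ 𝔸.arityNat f) :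
    𝔸.encode.getD (2 + k + ∑ g ∈ Finset.range f, n ^ 𝔸.arityNat g + X) 0 = 𝔸.opNat f X := by
  set T : ℕ → List ℕ := fun g => if h : g < k then 𝔸.table ⟨g, h⟩ else [] with hT
  have hl : ∀ g < k, (T g).length = n ^ 𝔸.arityNat g := fun g hg => by
    simp [hT, hg, table, arityNat]
  have e₁ : (List.ofFn 𝔸.table).flatten = (range k).flatMap T := by
    rw [List.flatMap_def]
    congr 1
    apply List.ext_getElem
    · simp
    · intro i h₁ h₂
      have : i < k := by simpa using h₁
      simp [hT, this]
  have e₂ : 2 + k + ∑ g ∈ Finset.range f, n ^ 𝔸.arityNat g + X =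
      k + (∑ g ∈ Finset.range f, (T g).length + X) + 1 + 1 := by
    have : ∑ g ∈ Finset.range f, n ^ 𝔸.arityNat g = ∑ g ∈ Finset.range f, (T g).length :=
      Finset.sum_congr rfl fun g hg => (hl g ((Finset.mem_range.1 hg).trans hf)).symm
    omega
  rw [encode, e₂, List.getD_cons_succ, List.getD_cons_succ, List.getD_append_right _ _ _ _
    (by simp), List.length_ofFn, Nat.add_sub_cancel_left, e₁,
    getD_flatMap_range T hf (by rwa [hl f hf])]
  have hX' : X < n ^ 𝔸.arity ⟨f, hf⟩ := by simpa [arityNat, hf] using hX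
  simp only [hT, hf, dif_pos, table, opNat]
  rw [List.getD_eq_getElem _ _ (by simpa using hX'), List.getElem_ofFn]
  congr 2

/-- Computes the largest arity. -/
def topCmd : Cmd :=
  loop opsE <| .ite (.sub (arityE (cnt 0)) (.arr Arr.top (.lit 0)))
    (.store Arr.top (.lit 0) (arityE (cnt 0))) .skip

/-- Computes the powers of the number of elements. -/
def powCmd : Cmd :=
  .seq (.store Arr.pow (.lit 0) (.lit 1)) <|
  loop (.add (.arr Arr.top (.lit 0)) (.lit 1)) <| .loop (powE (cnt 0)) sizeE (.lit 0) <|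
    .store Arr.pow (.add (cnt 1) (.lit 1)) (.add (acc 0) (.var 3))

/-- The base. -/
def baseE : Expr := .arr Arr.pow (.add (.arr Arr.top (.lit 0)) (.lit 1))

/-- Computes the multiples of the powers of the base with exponents `1, ..., s`. -/
def mulCmd : ℕ → Cmd
  | 0 => .skip
  | s + 1 => .seq (mulCmd s) <|
      .loop (if s = 0 then baseE else .arr (mulArr (s - 1)) baseE) (.add baseE (.lit 9)) (.lit 0)
        (.store (mulArr s) (cnt 0) (acc 0))

/-- Computes the positions of the tables in the input. -/
def tabCmd : Cmd :=
  .seq (.store Arr.tab (.lit 0) (.add (.lit 2) opsE)) <|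
  loop opsE <| .store Arr.tab (.add (cnt 0) (.lit 1))
    (.add (.arr Arr.tab (cnt 0)) (powE (arityE (cnt 0))))

/-- Computes the auxiliary tables. -/
def setupCmd : Cmd := .seq topCmd <| .seq powCmd <| .seq (mulCmd 7) tabCmd

theorem topCmd_spec {σ : Store} (h0 : σ Arr.top 0 = 0) :
    topCmd.eval 𝔸.encode ρ σ Arr.top 0 = 𝔸.maxArity ∧
    (∀ k ≠ Arr.top, topCmd.eval 𝔸.encode ρ σ k = σ k) ∧
    topCmd.ticks 𝔸.encode ρ σ ≤ k * (2 + 1) + 1 := by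
  have h : (fun m (τ : Store) => τ Arr.top 0 = (Finset.range m).sup 𝔸.arityNat ∧
      ∀ k ≠ Arr.top, τ k = σ k) k (topCmd.eval 𝔸.encode ρ σ) := by
    refine iter_induction (fun m (τ : Store) => τ Arr.top 0 = (Finset.range m).sup 𝔸.arityNat ∧
      ∀ k ≠ Arr.top, τ k = σ k) ⟨h0, fun _ _ => rfl⟩ fun i hi τ hτ => ?_
    have e : ∀ τ, (arityE (cnt 0)).eval 𝔸.encode (loopEnv 0 k 0 i ρ) τ = 𝔸.arityNat i :=
      fun τ => encode_arity hi
    have e' : ((Cmd.ite (.sub (arityE (cnt 0)) (.arr Arr.top (.lit 0)))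
        (.store Arr.top (.lit 0) (arityE (cnt 0))) .skip).eval 𝔸.encode (loopEnv 0 k 0 i ρ) τ) =
        if 𝔸.arityNat i - τ Arr.top 0 = 0 then τ else put τ Arr.top 0 (𝔸.arityNat i) := by
      simp only [Cmd.eval, Expr.eval, e]
    refine And.intro (Eq.trans (congrFun (congrFun e' _) _) ?_) fun k hk =>
      Eq.trans (congrFun e' _) ?_
    · rw [Finset.range_add_one, Finset.sup_insert, ← hτ.1]
      split_ifs with h
      · exact (max_eq_right (by omega)).symm
      · rw [put_apply, if_pos ⟨rfl, rfl⟩]; exact (max_eq_left (by omega)).symm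
    · split_ifs with h
      · exact hτ.2 k hk
      · rw [put_ne _ hk, hτ.2 k hk]
  refine ⟨h.1.trans ?_, h.2, ticks_loop_le fun i _ τ => ?_⟩
  · rw [maxArity]
    apply le_antisymm
    · exact Finset.sup_le fun f _ => arityNat_le f
    · refine Finset.sup_le fun f _ => ?_
      rw [← arityNat_val]
      exact Finset.le_sup (f := 𝔸.arityNat) (Finset.mem_range.2 f.2)
  · rw [Cmd.ticks]; split_ifs <;> simp [Cmd.ticks]

/-- The next power is the sum of `n` copies of the present one: round `x` of the inner loop stores
its accumulator `x * n ^ i` plus its step width `n ^ i`, and the last round leaves `n * n ^ i`. -/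
theorem powCmd_spec {σ : Store} {R : ℕ} (hR : σ Arr.top 0 = R) :
    (∀ i ≤ R + 1, powCmd.eval 𝔸.encode ρ σ Arr.pow i = n ^ i) ∧
    (∀ k ≠ Arr.pow, powCmd.eval 𝔸.encode ρ σ k = σ k) ∧
    powCmd.ticks 𝔸.encode ρ σ ≤ 1 + ((R + 1) * ((n * (1 + 1) + 1) + 1) + 1) := by
  set p : ℕ → Store → Prop := fun m τ => (∀ i ≤ m, τ Arr.pow i = n ^ i) ∧
      ∀ k ≠ Arr.pow, τ k = σ k with hp
  have h : p (R + 1) (powCmd.eval 𝔸.encode ρ σ) := by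
    subst hR
    have h₀ : p 0 (put σ Arr.pow 0 1) := by
      refine ⟨fun i hi => ?_, fun k hk => put_ne _ hk _ _⟩
      obtain rfl : i = 0 := by omega
      simp
    refine iter_induction p h₀ fun i hi τ hτ => ?_
    have h₁ : ∀ x, (fun x (τ : Store) => p i τ ∧ (0 < x → τ Arr.pow (i + 1) = x * n ^ i)) x
        (iter (fun x τ => put τ Arr.pow (i + 1) (x * n ^ i + 0 + n ^ i)) x τ) := fun x => by
      refine iter_induction (fun x (τ : Store) => p i τ ∧ (0 < x → τ Arr.pow (i + 1) = x * n ^ i))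
        ⟨hτ, fun h => absurd h (lt_irrefl 0)⟩ fun x _ τ hτ => ?_
      refine ⟨⟨fun i' hi' => ?_, fun k hk => ?_⟩, fun _ => ?_⟩
      · rw [put_apply, if_neg (by omega), hτ.1.1 i' hi']
      · rw [put_ne _ hk, hτ.1.2 k hk]
      · rw [put_apply, if_pos ⟨rfl, rfl⟩]; ring
    have h₂ := h₁ n
    have e : (Cmd.loop (powE (cnt 0)) sizeE (.lit 0) <|
        .store Arr.pow (.add (cnt 1) (.lit 1)) (.add (acc 0) (.var 3))).eval 𝔸.encode
          (loopEnv 0 (σ Arr.top 0 + 1) 0 i ρ) τ =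
        iter (fun x τ => put τ Arr.pow (i + 1) (x * n ^ i + 0 + n ^ i)) n τ := by
      rw [← hτ.1 i le_rfl]
      rfl
    change p (i + 1) ((Cmd.loop (powE (cnt 0)) sizeE (.lit 0) <|
        .store Arr.pow (.add (cnt 1) (.lit 1)) (.add (acc 0) (.var 3))).eval 𝔸.encode
          (loopEnv 0 (σ Arr.top 0 + 1) 0 i ρ) τ)
    rw [e]
    refine ⟨fun i' hi' => ?_, h₂.1.2⟩
    rcases Nat.lt_or_ge i' (i + 1) with h | h
    · exact h₂.1.1 i' (by omega)
    · obtain rfl : i' = i + 1 := by omega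
      rw [h₂.2 (NeZero.pos n), pow_succ']
  refine ⟨h.1, h.2, Nat.add_le_add_left ?_ 1⟩
  subst hR
  exact ticks_loop_le fun i _ τ => ticks_loop_le fun x _ τ => le_rfl

theorem mulArr_injOn {s s' : ℕ} (hs : s < 7) (hs' : s' < 7) (h : mulArr s = mulArr s') :
    s = s' := by
  have := congrArg Fin.val h
  simp only [mulArr, Fin.val_ofNat] at this
  omega

theorem mulArr_ne {s : ℕ} (hs : s < 7) {k : Fin 31} (hk : k ≤ 2 ∨ 10 ≤ k) : k ≠ mulArr s := by
  rintro rfl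
  simp only [mulArr, Fin.le_def, Fin.val_ofNat] at hk
  norm_num at hk
  omega

/-- The step width `q ^ (s + 1)` of table `s` is entry `q` of the preceding table, so each table has
to include the argument `q`. -/
theorem mulCmd_spec {σ : Store} {q : ℕ} (hq : σ Arr.pow (σ Arr.top 0 + 1) = q) {s : ℕ}
    (hs : s ≤ 7) :
    (∀ s' < s, ∀ x < q + 9, (mulCmd s).eval 𝔸.encode ρ σ (mulArr s') x = x * q ^ (s' + 1)) ∧
    (∀ k, k ≤ 2 ∨ 10 ≤ k → (mulCmd s).eval 𝔸.encode ρ σ k = σ k) ∧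
    (mulCmd s).ticks 𝔸.encode ρ σ ≤ s * ((q + 9) * (1 + 1) + 1) := by
  induction s with
  | zero => exact ⟨fun _ h => absurd h (Nat.not_lt_zero _), fun _ _ => rfl, Nat.zero_le _⟩
  | succ s ih =>
    obtain ⟨h₁, h₂, h₃⟩ := ih (by omega)
    set τ := (mulCmd s).eval 𝔸.encode ρ σ with hτ
    have hb : baseE.eval 𝔸.encode ρ τ = q := by
      rw [← hq]
      simp only [baseE, Expr.eval]
      rw [h₂ Arr.pow (by decide), h₂ Arr.top (by decide)]
    have hS : (if s = 0 then baseE else .arr (mulArr (s - 1)) baseE).eval 𝔸.encode ρ τ =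
        q ^ (s + 1) := by
      split_ifs with h
      · rw [hb, h, zero_add, pow_one]
      · rw [Expr.eval, hb, h₁ (s - 1) (by omega) q (by omega), Nat.sub_add_cancel (by omega),
          pow_succ']
    have hM : (Expr.add baseE (.lit 9)).eval 𝔸.encode ρ τ = q + 9 := by rw [Expr.eval, hb]; rfl
    have e : (mulCmd (s + 1)).eval 𝔸.encode ρ σ =
        iter (fun x υ => put υ (mulArr s) x (x * q ^ (s + 1))) (q + 9) τ := by
      rw [mulCmd, Cmd.eval, ← hτ, Cmd.eval, hS, hM]
      rfl
    have h : (fun x (υ : Store) => (∀ y < x, υ (mulArr s) y = y * q ^ (s + 1)) ∧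
        ∀ k ≠ mulArr s, υ k = τ k) (q + 9) ((mulCmd (s + 1)).eval 𝔸.encode ρ σ) := by
      rw [e]
      refine iter_induction (fun x (υ : Store) => (∀ y < x, υ (mulArr s) y = y * q ^ (s + 1)) ∧
        ∀ k ≠ mulArr s, υ k = τ k) ⟨fun _ h => absurd h (Nat.not_lt_zero _), fun _ _ => rfl⟩
        fun x _ υ hυ => ⟨fun y hy => ?_, fun k hk => ?_⟩
      · rw [put_apply]
        split_ifs with h
        · rw [h.2]
        · exact hυ.1 y (by simp at h; omega)
      · rw [put_ne _ hk, hυ.2 k hk]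
    refine ⟨fun s' hs' x hx => ?_, fun k hk => ?_, ?_⟩
    · rcases Nat.lt_succ_iff_lt_or_eq.1 hs' with h' | rfl
      · rw [h.2 _ fun e => h'.ne (mulArr_injOn (by omega) (by omega) e), h₁ s' h' x hx]
      · exact h.1 x hx
    · rw [h.2 _ (mulArr_ne (by omega) hk), h₂ k hk]
    · rw [mulCmd, Cmd.ticks, ← hτ, Nat.succ_mul]
      refine Nat.add_le_add h₃ ((ticks_loop_le (K := 1) fun _ _ _ => le_rfl).trans ?_)
      rw [hM]

theorem tabCmd_spec {σ : Store} (hp : ∀ i ≤ 𝔸.maxArity, σ Arr.pow i = n ^ i) :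
    (∀ f ≤ k, tabCmd.eval 𝔸.encode ρ σ Arr.tab f =
      2 + k + ∑ g ∈ Finset.range f, n ^ 𝔸.arityNat g) ∧
    (∀ k ≠ Arr.tab, tabCmd.eval 𝔸.encode ρ σ k = σ k) ∧
    tabCmd.ticks 𝔸.encode ρ σ ≤ 1 + (k * (1 + 1) + 1) := by
  set p : ℕ → Store → Prop := fun m τ => (∀ f ≤ m, τ Arr.tab f =
      2 + k + ∑ g ∈ Finset.range f, n ^ 𝔸.arityNat g) ∧ ∀ k ≠ Arr.tab, τ k = σ k
  have h : p k (tabCmd.eval 𝔸.encode ρ σ) := by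
    have h₀ : p 0 (put σ Arr.tab 0 (2 + k)) := by
      refine ⟨fun i hi => ?_, fun k hk => put_ne _ hk _ _⟩
      obtain rfl : i = 0 := by omega
      simp
    refine iter_induction p h₀ fun i hi τ hτ => ?_
    have e : (Cmd.store Arr.tab (.add (cnt 0) (.lit 1))
        (.add (.arr Arr.tab (cnt 0)) (powE (arityE (cnt 0))))).eval 𝔸.encode
          (loopEnv 0 k 0 i ρ) τ =
        put τ Arr.tab (i + 1) (2 + k + ∑ g ∈ Finset.range i, n ^ 𝔸.arityNat g +
          n ^ 𝔸.arityNat i) := by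
      rw [← hτ.1 i le_rfl, ← hp _ (arityNat_le i), ← hτ.2 Arr.pow (by decide), ← encode_arity hi]
      rfl
    change p (i + 1) ((Cmd.store Arr.tab (.add (cnt 0) (.lit 1))
        (.add (.arr Arr.tab (cnt 0)) (powE (arityE (cnt 0))))).eval 𝔸.encode
          (loopEnv 0 k 0 i ρ) τ)
    rw [e]
    refine ⟨fun f hf => ?_, fun k hk => ?_⟩
    · rw [put_apply]
      split_ifs with h
      · rw [h.2, Finset.sum_range_succ]; omega
      · exact hτ.1 f (by simp at h; omega)
    · rw [put_ne _ hk, hτ.2 k hk]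
  exact ⟨h.1, h.2, Nat.add_le_add_left (ticks_loop_le fun _ _ _ => le_rfl) 1⟩

theorem setupCmd_spec :
    Tables 𝔸 (setupCmd.eval 𝔸.encode ρ fun _ _ => 0) ∧
    (∀ k : Fin 31, 10 < k → setupCmd.eval 𝔸.encode ρ (fun _ _ => 0) k = fun _ => 0) ∧
    setupCmd.ticks 𝔸.encode ρ (fun _ _ => 0) ≤
      5 * k + (𝔸.maxArity + 1) * (2 * n + 2) + 14 * 𝔸.base + 150 := by
  obtain ⟨h₁, h₁', t₁⟩ := topCmd_spec (𝔸 := 𝔸) (ρ := ρ) (σ := fun _ _ => 0) rfl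
  set σ₁ := topCmd.eval 𝔸.encode ρ fun _ _ => 0 with e₁
  obtain ⟨h₂, h₂', t₂⟩ := powCmd_spec (𝔸 := 𝔸) (ρ := ρ) h₁
  set σ₂ := powCmd.eval 𝔸.encode ρ σ₁ with e₂
  have top₂ : σ₂ Arr.top 0 = 𝔸.maxArity := by rw [h₂' _ (by decide), h₁]
  obtain ⟨h₃, h₃', t₃⟩ := mulCmd_spec (𝔸 := 𝔸) (ρ := ρ) (σ := σ₂) (q := 𝔸.base)
    (by rw [top₂, h₂ _ le_rfl, base]) le_rfl
  set σ₃ := (mulCmd 7).eval 𝔸.encode ρ σ₂ with e₃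
  have pow₃ : ∀ i ≤ 𝔸.maxArity + 1, σ₃ Arr.pow i = n ^ i := fun i hi => by
    rw [h₃' Arr.pow (by decide), h₂ i hi]
  obtain ⟨h₄, h₄', t₄⟩ := tabCmd_spec (𝔸 := 𝔸) (ρ := ρ) (σ := σ₃)
    fun i hi => pow₃ i (by omega)
  set σ₄ := tabCmd.eval 𝔸.encode ρ σ₃ with e₄
  have e : setupCmd.eval 𝔸.encode ρ (fun _ _ => 0) = σ₄ := by
    simp only [setupCmd, Cmd.eval, ← e₁, ← e₂, ← e₃, ← e₄]
  have t : setupCmd.ticks 𝔸.encode ρ (fun _ _ => 0) = topCmd.ticks 𝔸.encode ρ (fun _ _ => 0) +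
      (powCmd.ticks 𝔸.encode ρ σ₁ + ((mulCmd 7).ticks 𝔸.encode ρ σ₂ +
      tabCmd.ticks 𝔸.encode ρ σ₃)) := by
    simp only [setupCmd, Cmd.ticks, ← e₁, ← e₂, ← e₃]
  rw [e, t]
  refine ⟨⟨?_, fun i hi => ?_, fun s hs x hx => ?_, fun f hf X hX => ?_⟩, fun k hk => ?_, ?_⟩
  · rw [h₄' _ (by decide), h₃' _ (by decide), top₂]
  · rw [h₄' _ (by decide), pow₃ i hi]
  · rw [h₄' _ (mulArr_ne hs (Or.inr le_rfl)).symm, h₃ s hs x hx]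
  · rw [h₄ f hf.le, encode_value hf hX]
  · have ne : ∀ {k' : Fin 31}, k' ≤ 10 → k ≠ k' := fun h => (h.trans_lt hk).ne'
    rw [h₄' k (ne (by decide)), h₃' k (Or.inr hk.le), h₂' k (ne (by decide)),
      h₁' k (ne (by decide))]
  · have : (𝔸.maxArity + 1) * ((n * (1 + 1) + 1) + 1) = (𝔸.maxArity + 1) * (2 * n + 2) := by ring
    omega

/-! ### The decision procedure -/

/-- The command `c` checks the condition `φ`, and records a failure, if the atoms found are given
by `μ`. -/
def Checks (𝔸 : UniversalAlgebra (Fin k) (Fin n)) (μ : ℕ → ℕ) (c : Cmd) (ρ : ℕ → ℕ)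
    (φ : Prop) : Prop :=
  ∀ σ, Tables 𝔸 σ → σ Arr.mark = μ → (φ → c.eval 𝔸.encode ρ σ = σ) ∧
    (¬ φ → c.eval 𝔸.encode ρ σ = put σ Arr.result 0 0)

theorem Tables.put_result {σ : Store} (h : Tables 𝔸 σ) (x : ℕ) :
    Tables 𝔸 (LoopLang.put σ Arr.result 0 x) where
  top := by rw [put_ne _ (by decide), h.top]
  pow := by rw [put_ne _ (by decide)]; exact h.pow
  mul s hs := by
    rw [put_ne _ fun e => ?_]
    · exact h.mul s hs
    · exact mulArr_ne hs (Or.inl (by decide)) e.symm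
  tab := by rw [put_ne _ (by decide)]; exact h.tab

theorem put_put (σ : Store) (k : Fin 31) (i x : ℕ) : put (put σ k i x) k i x = put σ k i x := by
  funext k' i'
  simp only [put_apply]
  split_ifs <;> rfl

/-- A failure writes `0` into the one result cell, so repeated failures have the same effect as one,
and the tables and marks stay intact for later rounds. -/
theorem checks_loopN {μ : ℕ → ℕ} {c : Cmd} {φ : ℕ → Prop}
    (h : ∀ i < n, Checks 𝔸 μ c (loopEnv 0 n 0 i ρ) (φ i)) :
    Checks 𝔸 μ (loopN c) ρ (∀ i < n, φ i) := by
  intro σ hσ hμ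
  refine iter_induction (fun m τ => ((∀ i < m, φ i) → τ = σ) ∧
    (¬ (∀ i < m, φ i) → τ = put σ Arr.result 0 0))
    ⟨fun _ => rfl, fun h => absurd (fun i hi => absurd hi (Nat.not_lt_zero i)) h⟩
    fun i hi τ hτ => ?_
  by_cases h₁ : ∀ j < i, φ j
  · obtain rfl := hτ.1 h₁
    have h₂ := h i hi τ hσ hμ
    refine ⟨fun h₃ => h₂.1 (h₃ i (Nat.lt_succ_self i)), fun h₃ => h₂.2 fun h₄ => h₃ fun j hj => ?_⟩
    rcases Nat.lt_succ_iff_lt_or_eq.1 hj with h' | rfl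
    · exact h₁ j h'
    · exact h₄
  · obtain rfl := hτ.2 h₁
    have h₂ := h i hi _ (hσ.put_result 0) ((put_ne _ (by decide) _ _).trans hμ)
    refine ⟨fun h₃ => absurd (fun j hj => h₃ j (Nat.lt_succ_of_lt hj)) h₁, fun _ => ?_⟩
    by_cases h₄ : φ i
    · exact h₂.1 h₄
    · exact (h₂.2 h₄).trans (put_put _ _ _ _)

/-- Checks that all tests have been passed. -/
def checkCmd : Cmd :=
  let z : Expr := .lit 0
  .seq (.store Arr.result z (.lit 1)) <|
  loopN <| loopN <| loopN <| loopN <|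
    .ite (.arr Arr.mark (atomE 8 (cnt 3) (cnt 2) (cnt 1) (cnt 0) z z z)) .skip
      (.store Arr.result z z)

theorem checkCmd_eval {σ : Store} (hσ : Tables 𝔸 σ) :
    checkCmd.eval 𝔸.encode ρ σ Arr.result 0 ≤ 1 ∧
    (checkCmd.eval 𝔸.encode ρ σ Arr.result 0 = 1 ↔
      ∀ a b c d : Fin n, σ Arr.mark (𝔸.atom 8 a b c d 0 0 0) ≠ 0) := by
  have h : Checks 𝔸 (σ Arr.mark) _ ρ (∀ a < n, ∀ b < n, ∀ c < n, ∀ d < n,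
      σ Arr.mark (𝔸.atom 8 a b c d 0 0 0) ≠ 0) :=
    checks_loopN (c := loopN <| loopN <| loopN <|
    .ite (.arr Arr.mark (atomE 8 (cnt 3) (cnt 2) (cnt 1) (cnt 0) (.lit 0) (.lit 0) (.lit 0))) .skip
      (.store Arr.result (.lit 0) (.lit 0))) fun a ha => checks_loopN fun b hb =>
    checks_loopN fun c hc => checks_loopN fun d hd τ hτ hμ => by
      have e := val_atom (t := 8) (by norm_num) (valB_elem (𝔸 := 𝔸) (i := 4 * 3) ha rfl)
        (valB_elem (i := 4 * 2) hb rfl) (valB_elem (i := 4 * 1) hc rfl) (valB_elem (i := 4 * 0) hd rfl) valB_zero valB_zero (val_lit 0)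
        (ρ := loopEnv 0 n 0 d (loopEnv 0 n 0 c (loopEnv 0 n 0 b (loopEnv 0 n 0 a ρ)))) τ hτ
      refine ⟨fun h => ?_, fun h => ?_⟩
      · rw [Cmd.eval, if_neg]
        · rfl
        · rw [Expr.eval, hμ]
          exact fun h' => h ((congrArg _ e.symm).trans h')
      · rw [Cmd.eval, if_pos]
        · rfl
        · rw [Expr.eval, hμ]
          exact (congrArg _ e).trans (not_not.1 h)
  have h' := h (put σ Arr.result 0 1) (hσ.put_result 1) (put_ne _ (by decide) _ _)
  have hiff : (∀ a < n, ∀ b < n, ∀ c < n, ∀ d < n, σ Arr.mark (𝔸.atom 8 a b c d 0 0 0) ≠ 0) ↔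
      ∀ a b c d : Fin n, σ Arr.mark (𝔸.atom 8 a b c d 0 0 0) ≠ 0 :=
    ⟨fun h a b c d => h a a.2 b b.2 c c.2 d d.2,
      fun h a ha b hb c hc d hd => h ⟨a, ha⟩ ⟨b, hb⟩ ⟨c, hc⟩ ⟨d, hd⟩⟩
  rw [← hiff]
  by_cases hφ : ∀ a < n, ∀ b < n, ∀ c < n, ∀ d < n, σ Arr.mark (𝔸.atom 8 a b c d 0 0 0) ≠ 0
  · have e : checkCmd.eval 𝔸.encode ρ σ = put σ Arr.result 0 1 := h'.1 hφ
    rw [e]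
    exact ⟨by simp, fun _ => hφ, fun _ => by simp⟩
  · have e : checkCmd.eval 𝔸.encode ρ σ = put (put σ Arr.result 0 1) Arr.result 0 0 := h'.2 hφ
    rw [e]
    exact ⟨by simp, ⟨fun h => absurd h (by simp), fun h => absurd h hφ⟩⟩

theorem checkCmd_ticks (σ : Store) : checkCmd.ticks 𝔸.encode ρ σ ≤ 12 * n ^ 4 := by
  have h : checkCmd.ticks 𝔸.encode ρ σ ≤
      1 + (n * ((n * ((n * ((n * (2 + 1) + 1) + 1) + 1) + 1) + 1) + 1) + 1) :=
    Nat.add_le_add_left (ticks_loop_le fun _ _ _ => ticks_loop_le fun _ _ _ =>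
      ticks_loop_le fun _ _ _ => ticks_loop_le fun _ _ τ => by
        rw [Cmd.ticks]; split_ifs <;> simp [Cmd.ticks]) 1
  refine h.trans ?_
  have h₀ := NeZero.pos n
  have h₁ : n ≤ n ^ 4 := Nat.le_self_pow (by norm_num) n
  have h₂ : n ^ 2 ≤ n ^ 4 := Nat.pow_le_pow_right h₀ (by norm_num)
  have h₃ : n ^ 3 ≤ n ^ 4 := Nat.pow_le_pow_right h₀ (by norm_num)
  have e : 1 + (n * ((n * ((n * ((n * (2 + 1) + 1) + 1) + 1) + 1) + 1) + 1) + 1) =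
    3 * n ^ 4 + 2 * n ^ 3 + 2 * n ^ 2 + 2 * n + 2 := by ring
  rw [e]
  omega

/-- Decides whether an algebra has a difference term operation. -/
def decideCmd : Cmd :=
  .ite (.sub sizeE (.lit 1)) (.seq setupCmd <| .seq clausesCmd <| .seq chain checkCmd)
    (.store Arr.result (.lit 0) (.lit 1))

/-- Emission costs at most `1800000` units of `workload * n ^ 4 + n ^ 7`, which also bounds the
number of clauses. Forward chaining costs `24` times as much, `45000000` units together, and the
rest absorbs the preparation and the final check. -/
theorem decideCmd_spec (hn : 2 ≤ n) (hi : 𝔸.IsIdempotent) :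
    decideCmd.eval 𝔸.encode ρ (fun _ _ => 0) Arr.result 0 ≤ 1 ∧
    (decideCmd.eval 𝔸.encode ρ (fun _ _ => 0) Arr.result 0 = 1 ↔ 𝔸.PassesLocalTest) ∧
    decideCmd.ticks 𝔸.encode ρ (fun _ _ => 0) ≤
      50000000 * (workload 𝔸 * n ^ 4 + n ^ 7) := by
  obtain ⟨h₁, h₁', t₁⟩ := setupCmd_spec (𝔸 := 𝔸) (ρ := ρ)
  set σ₁ := setupCmd.eval 𝔸.encode ρ fun _ _ => 0 with e₁
  obtain ⟨h₂, t₂, l₂⟩ := emits_clausesCmd (ρ := ρ) hn hi σ₁ h₁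
  have hR : Represents [] σ₁ := by
    have h : ∀ {k : Fin 31}, 10 < k → ∀ i, σ₁ k i = 0 := fun hk i => congrFun (h₁' _ hk) i
    refine ⟨h (by decide) 0, fun c hc => absurd hc (Nat.not_lt_zero _), fun o h₀ h₁ => ?_,
      fun p => h (by decide) p, fun o h₀ h₁ => ?_⟩
    all_goals simp at h₁; omega
  have hR₂ := hR.addClauses (L' := 𝔸.clauses)
  rw [List.nil_append] at hR₂
  have hT₂ := h₁.addClauses 𝔸.clauses
  set σ₂ := addClauses 𝔸.clauses σ₁ with e₂
  obtain ⟨h₃, h₃', t₃⟩ := chain_spec (w := 𝔸.encode) (ρ := ρ) hR₂ (by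
    intro k hk
    rw [e₂, addClauses_of_ne]
    · exact h₁' k (by fin_cases hk <;> decide)
    · fin_cases hk <;> decide)
  set σ₃ := chain.eval 𝔸.encode ρ σ₂ with e₃
  have hT₃ : Tables 𝔸 σ₃ := hT₂.congr fun k hk => h₃' k (by
    intro hm
    fin_cases hm <;> exact absurd hk (by decide))
  obtain ⟨h₄, h₄'⟩ := checkCmd_eval (ρ := ρ) hT₃
  have t₄ := checkCmd_ticks (𝔸 := 𝔸) (ρ := ρ) σ₃
  have hn' : (Expr.sub sizeE (.lit 1)).eval 𝔸.encode ρ (fun _ _ => 0) ≠ 0 := by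
    change n - 1 ≠ 0
    omega
  have e : decideCmd.eval 𝔸.encode ρ (fun _ _ => 0) = checkCmd.eval 𝔸.encode ρ σ₃ := by
    rw [decideCmd, Cmd.eval, if_neg hn', Cmd.eval, Cmd.eval, Cmd.eval, ← e₁, h₂, ← e₃]
  have t : decideCmd.ticks 𝔸.encode ρ (fun _ _ => 0) = 1 + (setupCmd.ticks 𝔸.encode ρ
      (fun _ _ => 0) + (clausesCmd.ticks 𝔸.encode ρ σ₁ + (chain.ticks 𝔸.encode ρ σ₂ +
      checkCmd.ticks 𝔸.encode ρ σ₃))) := by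
    rw [decideCmd, Cmd.ticks, if_neg hn', Cmd.ticks, Cmd.ticks, Cmd.ticks, ← e₁, h₂, ← e₃]
  rw [e, t]
  refine ⟨h₄, h₄'.trans ?_, ?_⟩
  · rw [passesLocalTest_iff hn]
    simp only [h₃]
  · have h₀ := NeZero.pos n
    have i₁ : k ≤ workload 𝔸 := le_workload_of_le_sq hn hi card_le_sq
    -- The separate summand `n` is for `maxArity = 0`, where the base is `n` but the workload is
    -- `0`.
    have i₂ : 𝔸.maxArity ≤ workload 𝔸 ∧ 𝔸.base ≤ n * workload 𝔸 + n := by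
      rcases Nat.eq_zero_or_pos 𝔸.maxArity with h | h
      · simp [h, base]
      · have h₅ := pow_maxArity_le h
        have h₆ : 0 < n ^ 𝔸.maxArity := pow_pos h₀ _
        have h₇ : 𝔸.inputSize ≤ workload 𝔸 :=
          le_workload_of_le_sq hn hi (Nat.le_self_pow two_ne_zero _)
        refine ⟨Nat.le_mul_of_pos_right _ (pow_pos (h₆.trans_le h₅) 2), ?_⟩
        rw [base, pow_succ']
        exact (Nat.mul_le_mul_left n (h₅.trans h₇)).trans (Nat.le_add_right _ _)
    have i₃ : workload 𝔸 ≤ workload 𝔸 * n ^ 4 := Nat.le_mul_of_pos_right _ (by positivity)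
    have i₄ : n * workload 𝔸 ≤ workload 𝔸 * n ^ 4 := by
      rw [mul_comm]
      exact Nat.mul_le_mul_left _ (Nat.le_self_pow (by norm_num) n)
    have i₅ : n ≤ n ^ 7 := Nat.le_self_pow (by norm_num) n
    have i₆ : n ^ 4 ≤ n ^ 7 := Nat.pow_le_pow_right h₀ (by norm_num)
    have i₇ : (𝔸.maxArity + 1) * (2 * n + 2) ≤
        2 * (n * workload 𝔸) + 2 * workload 𝔸 + 2 * n + 2 := by
      refine (Nat.mul_le_mul_right _ (Nat.add_le_add_right i₂.1 1)).trans (le_of_eq ?_)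
      ring
    omega

theorem decideCmd_one (h : n = 1) :
    decideCmd.eval 𝔸.encode ρ (fun _ _ => 0) Arr.result 0 = 1 ∧
    decideCmd.ticks 𝔸.encode ρ (fun _ _ => 0) = 2 := by
  have hn' : (Expr.sub sizeE (.lit 1)).eval 𝔸.encode ρ (fun _ _ => 0) = 0 := by
    change n - 1 = 0
    omega
  rw [decideCmd, Cmd.eval, if_pos hn', Cmd.ticks, if_pos hn']
  exact ⟨by simp [Cmd.eval, Expr.eval], rfl⟩

/-- For `n ≥ 2` the largest arity is below `n ^ maxArity`, so it is at most the input size, and both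
summands have degree at most `7`. -/
theorem workload_add_le (hn : 2 ≤ n) :
    workload 𝔸 * n ^ 4 + n ^ 7 ≤ 2 * (n + 𝔸.inputSize) ^ 7 := by
  have h₁ : 𝔸.maxArity ≤ 𝔸.inputSize := by
    rcases Nat.eq_zero_or_pos 𝔸.maxArity with h | h
    · rw [h]; exact Nat.zero_le _
    · exact (Nat.lt_pow_self hn).le.trans (pow_maxArity_le h)
  have h₂ : 𝔸.inputSize ≤ n + 𝔸.inputSize := Nat.le_add_left _ _
  have h₃ : n ≤ n + 𝔸.inputSize := Nat.le_add_right _ _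
  have h₄ : workload 𝔸 * n ^ 4 ≤ (n + 𝔸.inputSize) * (n + 𝔸.inputSize) ^ 2 *
      (n + 𝔸.inputSize) ^ 4 :=
    Nat.mul_le_mul (Nat.mul_le_mul (h₁.trans h₂) (Nat.pow_le_pow_left h₂ 2))
      (Nat.pow_le_pow_left h₃ 4)
  have h₅ : n ^ 7 ≤ (n + 𝔸.inputSize) ^ 7 := Nat.pow_le_pow_left h₃ 7
  have e : (n + 𝔸.inputSize) * (n + 𝔸.inputSize) ^ 2 * (n + 𝔸.inputSize) ^ 4 =
    (n + 𝔸.inputSize) ^ 7 := by ring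
  omega

end LoopLang

/-! ### One-element algebras and the final assembly. -/

theorem UniversalAlgebra.hasDifferenceTermOperation_of_subsingleton {ι : Type v} {A : Type u}
    [Subsingleton A] (𝔸 : UniversalAlgebra ι A) : 𝔸.HasDifferenceTermOperation :=
  ⟨fun x => x 0, .proj 0, fun a b => ⟨Subsingleton.elim _ _, fun θ _ _ => by
    change 𝔸.commutator θ θ a a
    exact (𝔸.commutator θ θ).refl' a⟩⟩

open LoopLang UniversalAlgebra in
theorem mainTheorem7 :
    (∀ (ι : Type v) (A : Type u) [Finite A] (𝔸 : UniversalAlgebra ι A), 𝔸.IsIdempotent →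
      (𝔸.HasDifferenceTermOperation ↔ 𝔸.PassesLocalTest)) ∧
    ∃ (P : RAM.Program) (C e : ℕ),
      ∀ (n k : ℕ), 0 < n → ∀ 𝔸 : UniversalAlgebra (Fin k) (Fin n), 𝔸.IsIdempotent →
        ∃ T : ℕ,
          T ≤ C * (𝔸.maxArity * 𝔸.inputSize ^ 2 * n ^ 4 + n ^ 7) ∧
          T ≤ C * (n + 𝔸.inputSize) ^ e ∧
          (𝔸.HasDifferenceTermOperation → RAM.OutputsWithin P 𝔸.encode T 1) ∧
          (¬ 𝔸.HasDifferenceTermOperation → RAM.OutputsWithin P 𝔸.encode T 0) := by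
  -- The factor `100000000` is `50000000` from `decideCmd_spec` times `2` from `workload_add_le`;
  -- the summand `1` pays for the instruction that copies the result.
  refine ⟨fun ι A _ 𝔸 hi => hasDifferenceTermOperation_iff hi, decideCmd.program,
    decideCmd.weight 1 * 100000000 + 1, 7, fun n k hn 𝔸 hi => ?_⟩
  have := NeZero.of_pos hn
  obtain ⟨T, hT, h⟩ := Cmd.outputsWithin (w := 𝔸.encode) decideCmd
  change RAM.OutputsWithin _ _ _ (decideCmd.eval 𝔸.encode (fun _ => 0) (fun _ _ => 0) Arr.result 0)
    at h
  have hT' : ∀ X, 1 ≤ X → decideCmd.ticks 𝔸.encode (fun _ => 0) (fun _ _ => 0) ≤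
      100000000 * X → T ≤ (decideCmd.weight 1 * 100000000 + 1) * X := fun X hX h' => by
    refine hT.trans ?_
    rw [Nat.add_mul, mul_assoc, one_mul]
    exact Nat.add_le_add (Nat.mul_le_mul_left _ h') hX
  have h₁ : 1 ≤ 𝔸.maxArity * 𝔸.inputSize ^ 2 * n ^ 4 + n ^ 7 :=
    le_add_left (Nat.one_le_pow _ _ hn)
  have h₂ : 1 ≤ (n + 𝔸.inputSize) ^ 7 := Nat.one_le_pow _ _ (by omega)
  rcases Nat.lt_or_ge n 2 with hn | hn
  · obtain rfl : n = 1 := by omega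
    obtain ⟨e, t⟩ := decideCmd_one (𝔸 := 𝔸) (ρ := fun _ => 0) rfl
    exact ⟨T, hT' _ h₁ (by omega), hT' _ h₂ (by omega), fun _ => by rwa [e] at h,
      fun h' => absurd (hasDifferenceTermOperation_of_subsingleton 𝔸) h'⟩
  · obtain ⟨e, e', t⟩ := decideCmd_spec (𝔸 := 𝔸) (ρ := fun _ => 0) hn hi
    have t' := workload_add_le (𝔸 := 𝔸) hn
    refine ⟨T, hT' _ h₁ (t.trans (Nat.mul_le_mul_right _ (by norm_num))), hT' _ h₂ (by omega),
      fun h' => ?_, fun h' => ?_⟩ <;> rw [hasDifferenceTermOperation_iff hi, ← e'] at h'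
    · rwa [h'] at h
    · rwa [show decideCmd.eval 𝔸.encode (fun _ => 0) (fun _ _ => 0) Arr.result 0 = 0 by omega] at h
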